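/- Let $\Omega\subset\mathbb{C}^n$ be a bounded domain and let $1\le q\le n-1$. Write $L^2_{(0,q)}(\Omega)$ for the space of forms $u=\sum'_{|J|=q}u_J\,d\bar z_J$ with $u_J\in L^2(\Omega)$, normed by $\|u\|^2=\sum'_J\|u_J\|^2$. Let $\bar\partial_q\colon L^2_{(0,q)}(\Omega)\to L^2_{(0,q+1)}(\Omega)$ be the maximal (distributional) Cauchy–Riemann operator, $\bar\partial_q^*$ its Hilbert space adjoint, and $$Q_q(u,v)=\langle\bar\partial_q u,\bar\partial_q v\rangle+\langle\bar\partial_{q-1}^*u,\bar\partial_{q-1}^*v\rangle,\qquad \operatorname{Dom}(Q_q)=\operatorname{Dom}(\bar\partial_q)\cap\operatorname{Dom}(\bar\partial_{q-1}^*).$$ For $t>0$ let $$Q_q^t(u,v)=Q_q(u,v)+t\langle\nabla u,\nabla v\rangle,\qquad \operatorname{Dom}(Q^t_q)=W^1_{(0,q)}(\Omega)\cap\operatorname{Dom}(\bar\partial_{q-1}^*),$$ where $W^1_{(0,q)}(\Omega)$ is the space of forms with coefficients in the $L^2$-Sobolev space $W^1(\Omega)$ and the full real gradient $\nabla$ acts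 on coefficients. Let $\Box_q^t$ be the operator associated with $Q_q^t$ (the Kohn–Nirenberg Laplacian): $\Box_q^tu=f$ if and only if $u\in\operatorname{Dom}(Q_q^t)$ and $Q_q^t(u,v)=\langle f,v\rangle$ for all $v\in\operatorname{Dom}(Q_q^t)$. The $k$-th variational eigenvalue of a nonnegative form $Q$ is $$\inf_{L\subset\operatorname{Dom}(Q),\ \dim L=k}\ \sup_{u\in L\setminus\{0\}}Q(u,u)/\|u\|^2 .$$ Let $\lambda_k^q$, $\lambda_k^{t,q}$, $\lambda_k^N$, $\lambda_k^D$ be the $k$-th variational eigenvalues of, respectively, $Q_q$, $Q_q^t$, and the form $\langle\nabla u,\nabla v\rangle$ on complex-valued functions with domain $W^1(\Omega)$ (Neumann Laplacian) and with domain $W^1_0(\Omega)$, the closure of $C_c^\infty(\Omega)$ in $W^1(\Omega)$ (Dirichlet Laplacian). (1) For all $t>0$ and all integers $k\ge1$, with $K=k\binom nq$, $$\lambda_k^q\le\lambda_k^{t,q}\qquad\text{and}\qquad t\,\lambda_k^N\le\lambda_K^{t,q}\le\Bigl(\tfrac14+t\Bigr)\lambda_k^D .$$ (2) If moreover $\partial\Omega$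 is $C^1$-smooth, then there is a constant $C>0$, independent of $t$, such that for every $t>0$: the spectrum of $\Box_q^t$ is purely discrete (every point of it is isolated in it and is an eigenvalue of finite multiplicity); $\lambda_1^{t,q}$ is the smallest eigenvalue of $\Box_q^t$ and satisfies $\lambda_1^{t,q}\ge C\min\{t,1\}$; and $\Box_q^t$ has a bounded inverse $N_q^t=(\Box_q^t)^{-1}$ on $L^2_{(0,q)}(\Omega)$, which is compact and satisfies $$\|N_q^tu\|\le\frac{1}{C\min\{t,1\}}\|u\|,\qquad u\in L^2_{(0,q)}(\Omega).$$ -/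

import Mathlib

open MeasureTheory Set Filter Topology
open scoped ENNReal ContDiff

noncomputable section

namespace KohnNirenberg

/-! ### Unbounded operators and sesquilinear forms on a Hilbert space -/

section Abstract

variable {H G : Type*} [NormedAddCommGroup H] [InnerProductSpace ℂ H]
  [NormedAddCommGroup G] [InnerProductSpace ℂ G]

/-- A sesquilinear form on `H` with its domain. Following Mathlib's inner product it is
conjugate-linear in the first variable and linear in the second. -/
structure SesqForm (H : Type*) [NormedAddCommGroup H] [InnerProductSpace ℂ H] where
  /-- the domain of the form -/
  domain : Submodule ℂ H
  /-- the form on its domain -/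
  form : domain →ₗ⋆[ℂ] domain →ₗ[ℂ] ℂ

/-- The sesquilinear form `(u, v) ↦ ⟨A u, A v⟩`. -/
def gramForm {D : Type*} [AddCommGroup D] [Module ℂ D] (A : D →ₗ[ℂ] G) :
    D →ₗ⋆[ℂ] D →ₗ[ℂ] ℂ :=
  LinearMap.mk₂'ₛₗ (starRingEnd ℂ) (RingHom.id ℂ) (fun u v => inner ℂ (A u) (A v))
    (fun u u' v => by rw [map_add, inner_add_left])
    (fun c u v => by rw [map_smul, inner_smul_left, smul_eq_mul])
    (fun u v v' => by rw [map_add, inner_add_right])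
    (fun c u v => by rw [map_smul, inner_smul_right, RingHom.id_apply, smul_eq_mul])

/-- The restriction of a form to a smaller domain. -/
def SesqForm.restrict (Q : SesqForm H) (D : Submodule ℂ H) (h : D ≤ Q.domain) :
    D →ₗ⋆[ℂ] D →ₗ[ℂ] ℂ :=
  LinearMap.mk₂'ₛₗ (starRingEnd ℂ) (RingHom.id ℂ)
    (fun u v => Q.form (Submodule.inclusion h u) (Submodule.inclusion h v))
    (fun u u' v => by simp)
    (fun c u v => by simp)
    (fun u v v' => by simp)
    (fun c u v => by simp)

/-- The `k`-th variational eigenvalue (`k ≥ 1`) of a nonnegative form `Q`: the infimum over all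
`k`-dimensional subspaces `L` of the domain of `sup_{u ∈ L \ {0}} Q(u,u) / ‖u‖²`. -/
def SesqForm.varEigenvalue (Q : SesqForm H) (k : ℕ) : ℝ≥0∞ :=
  ⨅ (L : Submodule ℂ Q.domain) (_ : Module.finrank ℂ L = k),
    ⨆ (u : Q.domain) (_ : u ∈ L ∧ u ≠ 0),
      ENNReal.ofReal ((Q.form u u).re / ‖(u : H)‖ ^ 2)

/-- The graph of the operator associated with a form: `(u, f)` belongs to it when `u ∈ Dom Q` and
`⟨f, v⟩ = Q(u, v)` for every `v ∈ Dom Q`. -/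
def SesqForm.operatorGraph (Q : SesqForm H) : Submodule ℂ (H × H) where
  carrier := {p | ∃ u : Q.domain, (u : H) = p.1 ∧ ∀ v : Q.domain,
    inner ℂ p.2 (v : H) = Q.form u v}
  zero_mem' := ⟨0, by simp, by simp⟩
  add_mem' := by
    rintro p p' ⟨u, hu, h⟩ ⟨u', hu', h'⟩
    exact ⟨u + u', by simp [hu, hu'], fun v => by simp [h, h']⟩
  smul_mem' := by
    rintro c p ⟨u, hu, h⟩
    exact ⟨c • u, by simp [hu], fun v => by simp [h, mul_comm]⟩

/-- The operator associated with a densely defined form `Q`: its domain consists of the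
`u ∈ Dom Q` for which there is `f ∈ H` with `⟨f, v⟩ = Q(u, v)` for every `v ∈ Dom Q`, and it maps
`u` to this `f`, which is unique because `Dom Q` is dense. -/
def SesqForm.operator (Q : SesqForm H) : H →ₗ.[ℂ] H :=
  Q.operatorGraph.toLinearPMap

/-- `R` is the bounded everywhere defined inverse of the operator `T - z`. -/
def IsBoundedInverse (T : H →ₗ.[ℂ] H) (z : ℂ) (R : H →L[ℂ] H) : Prop :=
  (∀ f : H, ∃ u : T.domain, (u : H) = R f ∧ T u - z • (u : H) = f) ∧
    ∀ u : T.domain, R (T u - z • (u : H)) = u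

/-- The spectrum of an unbounded operator: the set of `z` for which `T - z` has no bounded
everywhere defined inverse. -/
def opSpectrum (T : H →ₗ.[ℂ] H) : Set ℂ :=
  {z | ¬ ∃ R : H →L[ℂ] H, IsBoundedInverse T z R}

/-- The eigenspace `{u ∈ Dom T | T u = z u}`. -/
def opEigenspace (T : H →ₗ.[ℂ] H) (z : ℂ) : Submodule ℂ T.domain :=
  LinearMap.ker (T.toFun - z • T.domain.subtype)

/-- `z` is an eigenvalue of `T`. -/
def IsEigenvalue (T : H →ₗ.[ℂ] H) (z : ℂ) : Prop :=
  opEigenspace T z ≠ ⊥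

/-- Purely discrete spectrum: every point of the spectrum is an isolated point of the spectrum
and an eigenvalue of finite multiplicity. -/
def HasPurelyDiscreteSpectrum (T : H →ₗ.[ℂ] H) : Prop :=
  ∀ z ∈ opSpectrum T, IsEigenvalue T z ∧ FiniteDimensional ℂ (opEigenspace T z) ∧
    ∀ᶠ w in 𝓝[≠] z, w ∉ opSpectrum T

end Abstract

/-! ### Weak derivatives on a domain in `ℂⁿ` -/

section Domain

variable {n : ℕ}

/-- Test functions: smooth complex-valued functions with compact support in `Ω`.
The space `ℂⁿ` is modelled by `Fin n → ℂ` with its Lebesgue measure; its norm only enters through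
boundedness and differentiability, which do not depend on the choice of a norm. -/
def IsTest (Ω : Set (Fin n → ℂ)) (φ : (Fin n → ℂ) → ℂ) : Prop :=
  ContDiff ℝ ∞ φ ∧ HasCompactSupport φ ∧ tsupport φ ⊆ Ω

/-- The real coordinate directions of `ℂⁿ`: `(j, 0)` is the direction of `x_j = Re z_j` and
`(j, 1)` is the direction of `y_j = Im z_j`. -/
def realDir (i : Fin n × Fin 2) : Fin n → ℂ :=
  Pi.single i.1 (if i.2 = 0 then 1 else Complex.I)

/-- The partial derivative of a function in the `i`-th real coordinate direction. -/
def realPartial (i : Fin n × Fin 2) (φ : (Fin n → ℂ) → ℂ) (z : Fin n → ℂ) : ℂ :=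
  fderiv ℝ φ z (realDir i)

/-- The derivative `∂φ/∂z̄_j = (∂φ/∂x_j + i ∂φ/∂y_j) / 2`. -/
def dzbar (j : Fin n) (φ : (Fin n → ℂ) → ℂ) (z : Fin n → ℂ) : ℂ :=
  (1 / 2) * (realPartial (j, 0) φ z + Complex.I * realPartial (j, 1) φ z)

/-- `L²(Ω)`, complex-valued. -/
abbrev L2 (Ω : Set (Fin n → ℂ)) := Lp ℂ 2 (volume.restrict Ω)

/-- The space `L²(Ω)^{2n}` of gradients, a Hilbert space. -/
abbrev L2Grad (Ω : Set (Fin n → ℂ)) := PiLp 2 (fun _ : Fin n × Fin 2 => L2 Ω)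

variable {Ω : Set (Fin n → ℂ)} {φ ψ : (Fin n → ℂ) → ℂ}

theorem IsTest.zero : IsTest Ω 0 :=
  ⟨contDiff_const, HasCompactSupport.zero, by simp [tsupport]⟩

theorem IsTest.add (hφ : IsTest Ω φ) (hψ : IsTest Ω ψ) : IsTest Ω (φ + ψ) :=
  ⟨hφ.1.add hψ.1, hφ.2.1.add hψ.2.1,
    (tsupport_add φ ψ).trans (union_subset hφ.2.2 hψ.2.2)⟩

theorem IsTest.smul (c : ℂ) (hφ : IsTest Ω φ) : IsTest Ω (c • φ) :=
  ⟨contDiff_const.smul hφ.1, hφ.2.1.smul_left (f := fun _ => c),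
    (closure_mono (Function.support_const_smul_subset c φ)).trans hφ.2.2⟩

theorem IsTest.differentiable (hφ : IsTest Ω φ) : Differentiable ℝ φ :=
  hφ.1.differentiable (by simp)

theorem IsTest.realPartial_memLp (hφ : IsTest Ω φ) (i : Fin n × Fin 2) :
    MemLp (realPartial i φ) 2 (volume.restrict Ω) := by
  have h : Continuous (realPartial i φ) :=
    (hφ.1.continuous_fderiv (by simp)).clm_apply continuous_const
  exact (h.memLp_of_hasCompactSupport (hφ.2.1.fderiv_apply ℝ (realDir i))).restrict Ω

theorem IsTest.memLp (hφ : IsTest Ω φ) : MemLp φ 2 (volume.restrict Ω) :=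
  (hφ.1.continuous.memLp_of_hasCompactSupport hφ.2.1).restrict Ω

theorem IsTest.dzbar_memLp (hφ : IsTest Ω φ) (j : Fin n) :
    MemLp (dzbar j φ) 2 (volume.restrict Ω) :=
  ((hφ.realPartial_memLp (j, 0)).add
    ((hφ.realPartial_memLp (j, 1)).const_mul Complex.I)).const_mul (1 / 2)

/-- The bilinear pairing `∫_Ω g ψ` of `g ∈ L²(Ω)` with a function `ψ`. -/
def pair (g : L2 Ω) (ψ : (Fin n → ℂ) → ℂ) : ℂ :=
  ∫ z in Ω, g z * ψ z

theorem integrable_pair (g : L2 Ω) (hψ : MemLp ψ 2 (volume.restrict Ω)) :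
    Integrable (fun z => g z * ψ z) (volume.restrict Ω) :=
  (Lp.memLp g).integrable_mul hψ

theorem pair_zero (ψ : (Fin n → ℂ) → ℂ) : pair (0 : L2 Ω) ψ = 0 := by
  have : (fun z => (0 : L2 Ω) z * ψ z) =ᵐ[volume.restrict Ω] fun _ => 0 := by
    filter_upwards [Lp.coeFn_zero ℂ 2 (volume.restrict Ω)] with z hz
    rw [hz]; simp
  rw [pair, integral_congr_ae this, integral_zero]

theorem pair_add (g h : L2 Ω) (hψ : MemLp ψ 2 (volume.restrict Ω)) :
    pair (g + h) ψ = pair g ψ + pair h ψ := by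
  rw [pair, pair, pair, ← integral_add (integrable_pair g hψ) (integrable_pair h hψ)]
  refine integral_congr_ae ?_
  filter_upwards [Lp.coeFn_add g h] with z hz
  simp only [hz, Pi.add_apply, add_mul]

theorem pair_smul (c : ℂ) (g : L2 Ω) (ψ : (Fin n → ℂ) → ℂ) :
    pair (c • g) ψ = c * pair g ψ := by
  rw [pair, pair, ← integral_const_mul]
  refine integral_congr_ae ?_
  filter_upwards [Lp.coeFn_smul c g] with z hz
  simp only [hz, Pi.smul_apply, smul_eq_mul, mul_assoc]

variable (Ω)

/-- The graph of the weak gradient: `(g, G)` with `∫ g ∂_i φ = - ∫ G_i φ` for all real coordinate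
directions `i` and all test functions `φ`. -/
def weakGradGraph : Submodule ℂ (L2 Ω × L2Grad Ω) where
  carrier := {p | ∀ φ, IsTest Ω φ → ∀ i, pair p.1 (realPartial i φ) = - pair (p.2 i) φ}
  zero_mem' := fun φ _ i => by simp [pair_zero]
  add_mem' := by
    intro p p' h h' φ hφ i
    simp only [Prod.fst_add, Prod.snd_add, PiLp.add_apply]
    rw [pair_add _ _ (hφ.realPartial_memLp i), pair_add _ _ hφ.memLp, h φ hφ i, h' φ hφ i]
    ring
  smul_mem' := by
    intro c p h φ hφ i
    simp only [Prod.smul_fst, Prod.smul_snd, PiLp.smul_apply]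
    rw [pair_smul, pair_smul, h φ hφ i]
    ring

/-- The weak gradient `∇` with its maximal domain, the Sobolev space `W¹(Ω)`. -/
def weakGrad : L2 Ω →ₗ.[ℂ] L2Grad Ω :=
  (weakGradGraph Ω).toLinearPMap

/-- The Sobolev space `W¹(Ω)`. -/
def W1 : Submodule ℂ (L2 Ω) :=
  (weakGrad Ω).domain

/-- The pairs `(φ, ∇φ)` with `φ` a test function. -/
def testGradGraph : Submodule ℂ (L2 Ω × L2Grad Ω) where
  carrier := {p | ∃ φ, IsTest Ω φ ∧ p.1 =ᵐ[volume.restrict Ω] φ ∧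
    ∀ i, p.2 i =ᵐ[volume.restrict Ω] realPartial i φ}
  zero_mem' := ⟨0, IsTest.zero, Lp.coeFn_zero _ _ _, fun i => by
    filter_upwards [Lp.coeFn_zero ℂ 2 (volume.restrict Ω)] with z hz
    simpa [realPartial] using hz⟩
  add_mem' := by
    rintro p p' ⟨φ, hφ, h, hi⟩ ⟨φ', hφ', h', hi'⟩
    refine ⟨φ + φ', hφ.add hφ', (Lp.coeFn_add _ _).trans (h.add h'), fun i => ?_⟩
    refine (Lp.coeFn_add _ _).trans (((hi i).add (hi' i)).trans (Eventually.of_forall ?_))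
    intro z
    simp [realPartial, fderiv_add (hφ.differentiable z) (hφ'.differentiable z)]
  smul_mem' := by
    rintro c p ⟨φ, hφ, h, hi⟩
    refine ⟨c • φ, hφ.smul c, (Lp.coeFn_smul _ _).trans (h.const_smul c), fun i => ?_⟩
    refine (Lp.coeFn_smul _ _).trans (((hi i).const_smul c).trans (Eventually.of_forall ?_))
    intro z
    simp [realPartial, fderiv_const_smul (hφ.differentiable z)]

/-- `W¹₀(Ω)`: the closure of the test functions in `W¹(Ω)`. -/
def W10 : Submodule ℂ (L2 Ω) :=
  (W1 Ω) ⊓ (testGradGraph Ω).topologicalClosure.map (LinearMap.fst ℂ (L2 Ω) (L2Grad Ω))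

/-- The form of the Neumann Laplacian on functions: `⟨∇u, ∇v⟩` with domain `W¹(Ω)`. -/
def neumannForm : SesqForm (L2 Ω) where
  domain := W1 Ω
  form := gramForm (weakGrad Ω).toFun

/-- The form of the Dirichlet Laplacian on functions: `⟨∇u, ∇v⟩` with domain `W¹₀(Ω)`. -/
def dirichletForm : SesqForm (L2 Ω) where
  domain := W10 Ω
  form := gramForm ((weakGrad Ω).toFun ∘ₗ Submodule.inclusion inf_le_left)

/-! ### Forms of type `(0, q)` and the Cauchy–Riemann operator -/

/-- `L²_{(0,q)}(Ω)`: a form `u = ∑_{|J| = q} u_J dz̄_J` is given by its coefficients `u_J`, where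
`J` is a set of `q` indices listed in increasing order; `‖u‖² = ∑_J ‖u_J‖²`. -/
abbrev L2Form (q : ℕ) := PiLp 2 (fun _ : {J : Finset (Fin n) // J.card = q} => L2 Ω)

variable {Ω}

/-- The coefficient `u_J` of a `(0, q)`-form (zero unless `|J| = q`). -/
def coeff {q : ℕ} (u : L2Form Ω q) (J : Finset (Fin n)) : L2 Ω :=
  if h : J.card = q then u ⟨J, h⟩ else 0

/-- The sign `ε` in `dz̄_j ∧ dz̄_{L \ {j}} = ε dz̄_L` for `j ∈ L`. -/
def wedgeSign (j : Fin n) (L : Finset (Fin n)) : ℂ :=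
  (-1) ^ (L.filter (fun i => i < j)).card

theorem coeff_zero {q : ℕ} (J : Finset (Fin n)) : coeff (0 : L2Form Ω q) J = 0 := by
  simp [coeff]

theorem coeff_add {q : ℕ} (u v : L2Form Ω q) (J : Finset (Fin n)) :
    coeff (u + v) J = coeff u J + coeff v J := by
  unfold coeff; split <;> simp

theorem coeff_smul {q : ℕ} (c : ℂ) (u : L2Form Ω q) (J : Finset (Fin n)) :
    coeff (c • u) J = c • coeff u J := by
  unfold coeff; split <;> simp

variable (Ω)

/-- The graph of the maximal `∂̄ : L²_{(0,p)}(Ω) → L²_{(0,q)}(Ω)`, where `q = p + 1`: the pairs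
`(u, f)` such that, for every `|L| = q`, the equation
`f_L = ∑_{j ∈ L} ε ∂u_{L \ {j}} / ∂z̄_j` holds in the sense of distributions on `Ω`. -/
def dbarGraph (p q : ℕ) : Submodule ℂ (L2Form Ω p × L2Form Ω q) where
  carrier := {w | ∀ (L : {L : Finset (Fin n) // L.card = q}) (φ : (Fin n → ℂ) → ℂ), IsTest Ω φ →
    ∑ j ∈ L.1, wedgeSign j L.1 * pair (coeff w.1 (L.1.erase j)) (dzbar j φ)
      = - pair (w.2 L) φ}
  zero_mem' := fun L φ _ => by simp [coeff_zero, pair_zero]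
  add_mem' := by
    intro w w' h h' L φ hφ
    simp only [Prod.fst_add, Prod.snd_add, PiLp.add_apply, coeff_add]
    rw [pair_add _ _ hφ.memLp, neg_add, ← h L φ hφ, ← h' L φ hφ, ← Finset.sum_add_distrib]
    refine Finset.sum_congr rfl fun j _ => ?_
    rw [pair_add _ _ (hφ.dzbar_memLp j)]
    ring
  smul_mem' := by
    intro c w h L φ hφ
    simp only [Prod.smul_fst, Prod.smul_snd, PiLp.smul_apply, coeff_smul, pair_smul]
    rw [← mul_neg, ← h L φ hφ, Finset.mul_sum]
    refine Finset.sum_congr rfl fun j _ => ?_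
    ring

/-- The maximally defined Cauchy–Riemann operator
`∂̄ : L²_{(0,p)}(Ω) → L²_{(0,q)}(Ω)`, to be used with `q = p + 1`. -/
def dbar (p q : ℕ) : L2Form Ω p →ₗ.[ℂ] L2Form Ω q :=
  (dbarGraph Ω p q).toLinearPMap

/-- The Hilbert space adjoint `∂̄* : L²_{(0,q)}(Ω) → L²_{(0,p)}(Ω)` of the densely defined operator
`∂̄`, to be used with `q = p + 1`. -/
def dbarStar (p q : ℕ) : L2Form Ω q →ₗ.[ℂ] L2Form Ω p :=
  (dbar Ω p q).adjoint

/-! ### The `∂̄`-Neumann Laplacian and the Kohn–Nirenberg Laplacian -/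

/-- The form of the `∂̄`-Neumann Laplacian on `(0, q)`-forms (`q ≥ 1`):
`Q_q(u, v) = ⟨∂̄u, ∂̄v⟩ + ⟨∂̄*u, ∂̄*v⟩` with domain `Dom(∂̄) ∩ Dom(∂̄*)`. -/
def dbarNeumannForm (q : ℕ) : SesqForm (L2Form Ω q) where
  domain := (dbar Ω q (q + 1)).domain ⊓ (dbarStar Ω (q - 1) q).domain
  form := gramForm ((dbar Ω q (q + 1)).toFun ∘ₗ Submodule.inclusion inf_le_left)
    + gramForm ((dbarStar Ω (q - 1) q).toFun ∘ₗ Submodule.inclusion inf_le_right)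

/-- `W¹_{(0,q)}(Ω)`: the forms with coefficients in `W¹(Ω)`. -/
def W1Form (q : ℕ) : Submodule ℂ (L2Form Ω q) where
  carrier := {u | ∀ J, u J ∈ W1 Ω}
  zero_mem' := fun _ => (W1 Ω).zero_mem
  add_mem' := fun hu hv J => (W1 Ω).add_mem (hu J) (hv J)
  smul_mem' := fun c _ hu J => (W1 Ω).smul_mem c (hu J)

/-- The `J`-th coefficient of a form in `W¹_{(0,q)}(Ω)`, as an element of `W¹(Ω)`. -/
def W1Form.coeff {q : ℕ} (J : {J : Finset (Fin n) // J.card = q}) : W1Form Ω q →ₗ[ℂ] W1 Ω where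
  toFun u := ⟨u.1 J, u.2 J⟩
  map_add' _ _ := rfl
  map_smul' _ _ := rfl

theorem W1_exists {g : L2 Ω} (hg : g ∈ W1 Ω) : ∃ G : L2Grad Ω, (g, G) ∈ weakGradGraph Ω := by
  obtain ⟨p, hp, rfl⟩ := hg
  exact ⟨p.2, hp⟩

theorem pair_dzbar {g : L2 Ω} {G : L2Grad Ω} (h : (g, G) ∈ weakGradGraph Ω)
    {φ : (Fin n → ℂ) → ℂ} (hφ : IsTest Ω φ) (j : Fin n) :
    pair g (dzbar j φ) = - pair ((1 / 2 : ℂ) • (G (j, 0) + Complex.I • G (j, 1))) φ := by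
  have h0 : pair g (realPartial (j, 0) φ) = - pair (G (j, 0)) φ := h φ hφ (j, 0)
  have h1 : pair g (realPartial (j, 1) φ) = - pair (G (j, 1)) φ := h φ hφ (j, 1)
  have key : pair g (dzbar j φ) = (1 / 2) * (pair g (realPartial (j, 0) φ)
      + Complex.I * pair g (realPartial (j, 1) φ)) := by
    unfold pair
    rw [← integral_const_mul, ← integral_add (integrable_pair g (hφ.realPartial_memLp (j, 0)))
      ((integrable_pair g (hφ.realPartial_memLp (j, 1))).const_mul Complex.I),
      ← integral_const_mul]
    refine integral_congr_ae (Eventually.of_forall fun z => ?_)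
    simp only [dzbar]
    ring
  rw [key, h0, h1, pair_smul, pair_add _ _ hφ.memLp, pair_smul]
  ring

theorem pair_sum {ι : Type*} (s : Finset ι) (g : ι → L2 Ω) (hψ : MemLp ψ 2 (volume.restrict Ω)) :
    pair (∑ i ∈ s, g i) ψ = ∑ i ∈ s, pair (g i) ψ := by
  classical
  induction s using Finset.induction_on with
  | empty => simp [pair_zero]
  | insert a s ha ih => rw [Finset.sum_insert ha, Finset.sum_insert ha, pair_add _ _ hψ, ih]

/-- Forms with coefficients in `W¹(Ω)` belong to the domain of `∂̄`. -/
theorem W1Form_le_dbar_domain (q : ℕ) : W1Form Ω q ≤ (dbar Ω q (q + 1)).domain := by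
  intro u hu
  have hc : ∀ J : Finset (Fin n), ∃ G : L2Grad Ω, (coeff u J, G) ∈ weakGradGraph Ω := by
    intro J
    by_cases h : J.card = q
    · rw [coeff, dif_pos h]
      exact W1_exists Ω (hu ⟨J, h⟩)
    · rw [coeff, dif_neg h]
      exact ⟨0, (weakGradGraph Ω).zero_mem⟩
  choose G hG using hc
  refine ⟨(u, WithLp.toLp 2 fun L => ∑ j ∈ L.1, wedgeSign j L.1 •
    ((1 / 2 : ℂ) • (G (L.1.erase j) (j, 0) + Complex.I • G (L.1.erase j) (j, 1)))), ?_, rfl⟩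
  intro L φ hφ
  simp only
  rw [pair_sum Ω _ _ hφ.memLp, ← Finset.sum_neg_distrib]
  refine Finset.sum_congr rfl fun j _ => ?_
  rw [pair_dzbar Ω (hG _) hφ, pair_smul (wedgeSign j L.1), mul_neg]

/-- The form of the Kohn–Nirenberg Laplacian on `(0, q)`-forms (`q ≥ 1`):
`Q_q^t(u, v) = Q_q(u, v) + t ⟨∇u, ∇v⟩` with domain `W¹_{(0,q)}(Ω) ∩ Dom(∂̄*)`, where the gradient
acts on the coefficients. -/
def kohnNirenbergForm (t : ℝ) (q : ℕ) : SesqForm (L2Form Ω q) where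
  domain := W1Form Ω q ⊓ (dbarStar Ω (q - 1) q).domain
  form :=
    (dbarNeumannForm Ω q).restrict _ (inf_le_inf_right _ (W1Form_le_dbar_domain Ω q))
    + (t : ℂ) • ∑ J, gramForm
        ((weakGrad Ω).toFun ∘ₗ W1Form.coeff Ω J ∘ₗ Submodule.inclusion inf_le_left)

/-- The Kohn–Nirenberg Laplacian `□_q^t` on `L²_{(0,q)}(Ω)`. -/
def kohnNirenbergLaplacian (t : ℝ) (q : ℕ) : L2Form Ω q →ₗ.[ℂ] L2Form Ω q :=
  (kohnNirenbergForm Ω t q).operator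

/-- The boundary of the open set `Ω` is `C¹`-smooth: near each boundary point, `Ω` is the set
where a `C¹` function with nonvanishing differential is negative. -/
def HasC1Boundary : Prop :=
  ∀ p ∈ frontier Ω, ∃ U : Set (Fin n → ℂ), IsOpen U ∧ p ∈ U ∧
    ∃ r : (Fin n → ℂ) → ℝ, ContDiffOn ℝ 1 r U ∧ (∀ z ∈ U, fderiv ℝ r z ≠ 0) ∧
      Ω ∩ U = {z ∈ U | r z < 0}

end Domain

end KohnNirenberg

end

open KohnNirenberg

/-! Everything rests on the identity `Q_q^t(u,u) = ‖∂̄u‖² + ‖∂̄*u‖² + t ∑_J ‖∇u_J‖²`.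

Comparison of eigenvalues. Dropping the gradient term and enlarging the domain gives the bound by
`λ_k^q` (`SesqForm.varEigenvalue_mono`). Keeping only the gradient term leaves `t` times the direct
sum of `n choose q` copies of the Neumann form. That the `k·m`-th variational value of an `m`-fold
sum dominates the `k`-th value of one copy is pure linear algebra (`exists_subspace_of_directSum`),
so no discreteness of the Neumann spectrum is needed on an arbitrary bounded domain. For the
Dirichlet bound, forms with coefficients in `W¹₀` can be integrated by parts without boundary terms:
they lie in `Dom ∂̄*`, where `∂̄*` is the formal adjoint (`dbarStar_of_W10`). Since first
derivatives can be exchanged between the factors of an inner product, the mixed terms of `‖∂̄u‖²`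
and `‖∂̄*u‖²` cancel (`sum_norm_wedge`), leaving a quarter of the gradient form
(`norm_dbar_add_norm_theta`). Using such forms with coefficients from a `k`-dimensional space as
trial space gives the factor `1/4 + t`.

Coercivity. If `j ∈ J`, then `∂̄` of `z̄_j u_J dz̄_{J \ {j}}` contains `± u_J dz̄_J`, and its other
terms involve derivatives of `u_J` times the bounded function `z̄_j`. Pairing `∂̄*u` with this form
bounds `‖u_J‖²` by `‖u‖` times `‖∂̄*u‖ + ‖∇u_J‖` (`norm_sq_coeff_le`). Hence `‖u‖²` is at most a
constant times `‖∂̄*u‖² + ‖∇u‖²`, and `Q_q^t ≥ C min(t,1) ‖u‖²` (`exists_coercive`). The boundary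
plays no role here.

Compactness. A `C¹` boundary gives a local cone condition. Averaging a Sobolev function over small
balls inside the cone controls its `L²` norm by finitely many linear functionals plus a small
multiple of its gradient; this yields Rellich's theorem (`HasC1Boundary.exists_isCompact`).

Spectral theory. The form is `⟨A u, A v⟩` for a closed operator `A` that is bounded below. With `B`
the inverse of `A` on its range, `N = B B*` inverts the associated operator and is compact,
symmetric and positive. The spectrum of the operator consists of reciprocals of nonzero eigenvalues
of `N`, and its lowest eigenvalue is `1/‖N‖` (`compactForm_spectrum`). -/

noncomputable section

namespace KohnNirenberg

/-! ### Eigenvalues of an unbounded operator through its bounded inverse -/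

section BoundedInverse

variable {H : Type*} [NormedAddCommGroup H] [InnerProductSpace ℂ H]
  {T : H →ₗ.[ℂ] H} {N : H →L[ℂ] H}

theorem IsBoundedInverse.mem_eigenspace (hN : IsBoundedInverse T 0 N) {z : ℂ} (u : T.domain)
    (hu : u ∈ opEigenspace T z) : z • N (u : H) = u := by
  have h1 : T u - z • (u : H) = 0 := by
    simpa [opEigenspace] using hu
  have h2 := hN.2 u
  rw [zero_smul, sub_zero, sub_eq_zero.1 h1, map_smul] at h2
  exact h2

open Module.End in
theorem IsBoundedInverse.isEigenvalue (hN : IsBoundedInverse T 0 N) {z : ℂ} (hz : z ≠ 0)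
    (h : HasEigenvalue (N : Module.End ℂ H) z⁻¹) : IsEigenvalue T z := by
  obtain ⟨x, hx⟩ := h.exists_hasEigenvector
  have hNx : N x = z⁻¹ • x := hx.apply_eq_smul
  obtain ⟨u, hu, hTu⟩ := hN.1 (z • x)
  rw [map_smul, hNx, smul_inv_smul₀ hz] at hu
  rw [zero_smul, sub_zero] at hTu
  intro hbot
  have : u ∈ opEigenspace T z := by
    simp [opEigenspace, hTu, hu]
  rw [hbot, Submodule.mem_bot] at this
  apply hx.2
  rw [← hu, this]; simp

end BoundedInverse

/-! ### Spectrum of an operator whose inverse is compact -/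

section CompactInverse

variable {H : Type*} [NormedAddCommGroup H] [InnerProductSpace ℂ H] [CompleteSpace H]

open Module.End in
/-- A nonzero number is an isolated point of the set of eigenvalues of a compact symmetric
operator, or not in that set. -/
theorem eventually_not_hasEigenvalue {N : H →L[ℂ] H} (hc : IsCompactOperator N)
    (hs : N.IsSymmetric) {ζ : ℂ} (hζ : ζ ≠ 0) :
    ∀ᶠ ν in 𝓝[≠] ζ, ¬ HasEigenvalue (N : Module.End ℂ H) ν := by
  -- On the orthogonal complement of the `ζ`-eigenspace, `ζ` is no longer an eigenvalue, so it lies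
  -- in the resolvent set of the compact restriction. That set is open, and every eigenvector for `ν
  -- ≠ ζ` lies in the complement by symmetry.
  set V : Submodule ℂ H := (eigenspace (N : Module.End ℂ H) ζ)ᗮ with hV
  have hinv : ∀ v ∈ V, N v ∈ V := fun v hv =>
    LinearMap.IsSymmetric.invariant_orthogonalComplement_eigenspace hs ζ v hv
  let S : V →L[ℂ] V := N.restrict hinv
  have hSc : IsCompactOperator S := hc.restrict' hinv
  have hSapp : ∀ x : V, ((S x : V) : H) = N x := fun x => rfl
  have hno : ¬ HasEigenvalue (S : Module.End ℂ V) ζ := by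
    intro h
    obtain ⟨x, hx⟩ := h.exists_hasEigenvector
    have h1 : S x = ζ • x := hx.apply_eq_smul
    have h2 : (x : H) ∈ eigenspace (N : Module.End ℂ H) ζ := by
      rw [mem_eigenspace_iff]
      have := congrArg (Subtype.val) h1
      simpa [hSapp] using this
    have h3 : (x : H) = 0 := by
      have := (Submodule.mem_orthogonal _ _).1 x.2 _ h2
      exact inner_self_eq_zero.1 this
    exact hx.2 (Subtype.ext h3)
  have hres : ζ ∈ resolventSet ℂ S := (hSc.hasEigenvalue_or_mem_resolventSet hζ).resolve_left hno
  have hopen := (spectrum.isOpen_resolventSet (𝕜 := ℂ) S).mem_nhds hres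
  have h1 : ∀ᶠ ν in 𝓝[≠] ζ, ν ∈ resolventSet ℂ S := mem_nhdsWithin_of_mem_nhds hopen
  have h0 : ∀ᶠ ν in 𝓝[≠] ζ, ν ≠ 0 := mem_nhdsWithin_of_mem_nhds (isOpen_ne.mem_nhds hζ)
  filter_upwards [h1, h0, self_mem_nhdsWithin] with ν hν hν0 hne hev
  obtain ⟨x, hx⟩ := hev.exists_hasEigenvector
  have hxV : x ∈ V := by
    rw [hV, Submodule.mem_orthogonal]
    intro y hy
    have := hs.orthogonalFamily_eigenspaces (i := ζ) (j := ν) (Ne.symm hne)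
      ⟨y, hy⟩ ⟨x, hx.1⟩
    simpa using this
  have hS : S ⟨x, hxV⟩ = ν • (⟨x, hxV⟩ : V) := Subtype.ext (by
    simpa [hSapp] using hx.apply_eq_smul)
  have : HasEigenvalue (S : Module.End ℂ V) ν :=
    hasEigenvalue_of_hasEigenvector (x := ⟨x, hxV⟩)
      ⟨mem_eigenspace_iff.2 hS, fun h => hx.2 (congrArg Subtype.val h)⟩
  rw [hSc.hasEigenvalue_iff_mem_spectrum hν0] at this
  exact this hν

open Module.End in
/-- The norm of a nonzero compact positive operator is an eigenvalue. -/
theorem hasEigenvalue_norm {N : H →L[ℂ] H} (hc : IsCompactOperator N) (hs : N.IsSymmetric)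
    (hp : ∀ f, 0 ≤ (inner ℂ (N f) f).re) (hN : N ≠ 0) :
    HasEigenvalue (N : Module.End ℂ H) (‖N‖ : ℂ) := by
  have hnt : Nontrivial H := by
    by_contra h
    rw [not_nontrivial_iff_subsingleton] at h
    exact hN (ContinuousLinearMap.ext fun x => Subsingleton.elim _ _)
  -- If `‖N‖` were in the resolvent set, all Rayleigh quotients would stay below `‖N‖ - ε`. They are
  -- nonnegative, so their supremum is `‖N‖` by symmetry, a contradiction.
  rw [hc.hasEigenvalue_iff_mem_spectrum (by simpa using hN)]
  intro hres
  obtain ⟨ε, hε, h⟩ := N.rayleighQuotient_le_of_norm_mem_resolventSet (𝕜 := ℂ) hres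
  have h1 := N.norm_eq_iSup_rayleighQuotient hs
  have h2 : (⨆ x, |N.rayleighQuotient x|) ≤ ‖N‖ - ε := by
    refine ciSup_le fun x => ?_
    rw [abs_of_nonneg]
    · exact h x
    · exact div_nonneg (hp x) (by positivity)
  linarith

variable {T : H →ₗ.[ℂ] H} {N : H →L[ℂ] H}

open Module.End in
-- If `z⁻¹` is not an eigenvalue of `N`, the Fredholm alternative inverts `z⁻¹ - N`, and `z⁻¹ (z⁻¹ -
-- N)⁻¹ N` is then a bounded inverse of `T - z`.
theorem IsBoundedInverse.hasEigenvalue_of_mem_opSpectrum (hN : IsBoundedInverse T 0 N)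
    (hc : IsCompactOperator N) {z : ℂ} (hz : z ∈ opSpectrum T) :
    z ≠ 0 ∧ HasEigenvalue (N : Module.End ℂ H) z⁻¹ := by
  have hz0 : z ≠ 0 := by
    rintro rfl
    exact hz ⟨N, hN⟩
  refine ⟨hz0, ?_⟩
  refine (hc.hasEigenvalue_or_mem_resolventSet (inv_ne_zero hz0)).resolve_right fun hres => hz ?_
  obtain ⟨S, hS⟩ := hres
  have hS1 : ∀ x, (S : H →L[ℂ] H) x = z⁻¹ • x - N x := fun x => by
    rw [hS]; simp [Algebra.algebraMap_eq_smul_one]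
  have hS2 : ∀ x, (S : H →L[ℂ] H) ((↑S⁻¹ : H →L[ℂ] H) x) = x := fun x => by
    rw [← mul_apply_eq_comp, S.mul_inv, one_apply_eq_self]
  have hS3 : ∀ x, (↑S⁻¹ : H →L[ℂ] H) ((S : H →L[ℂ] H) x) = x := fun x => by
    rw [← mul_apply_eq_comp, S.inv_mul, one_apply_eq_self]
  refine ⟨z⁻¹ • ((↑S⁻¹ : H →L[ℂ] H) ∘L N), fun f => ?_, fun u => ?_⟩
  · set w := z⁻¹ • (↑S⁻¹ : H →L[ℂ] H) (N f) with hw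
    have h1 : z⁻¹ • w - N w = z⁻¹ • N f := by
      rw [← hS1, hw, map_smul, hS2]
    -- A solution of `T w - z w = f` must satisfy `w = N (z w + f)`; reading this backwards puts `w`
    -- into the domain.
    obtain ⟨u, hu, hTu⟩ := hN.1 (z • w + f)
    have h2 : (u : H) = w := by
      rw [hu, map_add, map_smul]
      have : w = z • (z⁻¹ • w) := by rw [smul_inv_smul₀ hz0]
      conv_rhs => rw [this, ← sub_add_cancel (z⁻¹ • w) (N w), h1, smul_add, smul_inv_smul₀ hz0]
      abel
    refine ⟨u, h2, ?_⟩
    rw [zero_smul, sub_zero] at hTu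
    rw [hTu, h2]; abel
  · have h1 := hN.2 u
    rw [zero_smul, sub_zero] at h1
    simp only [smul_apply, ContinuousLinearMap.comp_apply, map_sub, map_smul]
    rw [h1]
    have h2 := hS3 (u : H)
    rw [hS1, map_sub, map_smul] at h2
    rw [smul_comm z z⁻¹, inv_smul_smul₀ hz0, h2]

/-- An operator with a compact self-adjoint inverse has purely discrete spectrum. -/
theorem IsBoundedInverse.hasPurelyDiscreteSpectrum (hN : IsBoundedInverse T 0 N)
    (hc : IsCompactOperator N) (hs : N.IsSymmetric) : HasPurelyDiscreteSpectrum T := by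
  intro z hz
  obtain ⟨hz0, hev⟩ := hN.hasEigenvalue_of_mem_opSpectrum hc hz
  refine ⟨hN.isEigenvalue hz0 hev, ?_, ?_⟩
  · have := ContinuousLinearMap.finite_dimensional_eigenspace hc _ (inv_ne_zero hz0)
    have hmem : ∀ u : opEigenspace T z,
        ((u : T.domain) : H) ∈ Module.End.eigenspace (N : Module.End ℂ H) z⁻¹ := by
      intro u
      rw [Module.End.mem_eigenspace_iff]
      have := hN.mem_eigenspace u.1 u.2
      change N _ = _
      rw [eq_inv_smul_iff₀ hz0, this]
    let f : opEigenspace T z →ₗ[ℂ] Module.End.eigenspace (N : Module.End ℂ H) z⁻¹ :=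
      (T.domain.subtype ∘ₗ (opEigenspace T z).subtype).codRestrict _ hmem
    refine FiniteDimensional.of_injective f fun a b hab => ?_
    have h := congrArg Subtype.val hab
    exact Subtype.ext (Subtype.ext h)
  -- Isolation is transported from `z⁻¹` to `z` by inversion, which is continuous and injective near
  -- `z ≠ 0`.
  · have h1 := eventually_not_hasEigenvalue hc hs (inv_ne_zero hz0)
    have h2 : Tendsto (fun w : ℂ => w⁻¹) (𝓝[≠] z) (𝓝[≠] z⁻¹) := by
      refine tendsto_nhdsWithin_iff.2 ⟨(tendsto_inv₀ hz0).mono_left nhdsWithin_le_nhds, ?_⟩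
      filter_upwards [self_mem_nhdsWithin] with w hw h
      exact hw (inv_injective h)
    filter_upwards [h2.eventually h1] with w hw hspec
    exact hw (hN.hasEigenvalue_of_mem_opSpectrum hc hspec).2

end CompactInverse

/-! ### Operators associated with closed coercive forms -/

section CompactForm

variable {H G : Type*} [NormedAddCommGroup H] [InnerProductSpace ℂ H] [CompleteSpace H]
  [NormedAddCommGroup G] [InnerProductSpace ℂ G]

theorem gramForm_apply {D : Type*} [AddCommGroup D] [Module ℂ D] (A : D →ₗ[ℂ] G) (u v : D) :
    gramForm A u v = inner ℂ (A u) (A v) := rfl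

theorem gramForm_self_re {D : Type*} [AddCommGroup D] [Module ℂ D] (A : D →ₗ[ℂ] G) (u : D) :
    (gramForm A u u).re = ‖A u‖ ^ 2 := by
  rw [gramForm_apply, inner_self_eq_norm_sq_to_K]; norm_cast

variable [CompleteSpace G]

/-- The data of the inverse of the operator associated with a closed coercive form `⟨A u, A v⟩`. -/
theorem exists_factorization (D : Submodule ℂ H) (A : D →ₗ[ℂ] G)
    (hclosed : IsClosed {p : H × G | ∃ u : D, (u : H) = p.1 ∧ A u = p.2})
    {c : ℝ} (hc : 0 < c) (hcoer : ∀ u : D, c * ‖(u : H)‖ ^ 2 ≤ ‖A u‖ ^ 2) :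
    ∃ N : H →L[ℂ] H, N.IsSymmetric ∧ (∀ f, 0 ≤ (inner ℂ (N f) f).re) ∧
      (∀ u : D, ‖(u : H)‖ ^ 2 ≤ ‖N‖ * ‖A u‖ ^ 2) ∧
      (∀ f, ∃ u : D, (u : H) = N f ∧ ∀ v : D, inner ℂ f (v : H) = inner ℂ (A u) (A v)) ∧
      ((∃ K : Set H, IsCompact K ∧ ∀ u : D, ‖A u‖ ≤ 1 → (u : H) ∈ K) → IsCompactOperator N) := by
  have hinj : Function.Injective A := by
    rw [injective_iff_map_eq_zero]
    intro u hu
    have := hcoer u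
    rw [hu, norm_zero] at this
    have h2 : ‖(u : H)‖ ^ 2 = 0 := by nlinarith [sq_nonneg ‖(u : H)‖]
    simpa using h2
  let R : Submodule ℂ G := LinearMap.range A
  let e : D ≃ₗ[ℂ] R := LinearEquiv.ofInjective A hinj
  have he : ∀ u, ((e u : R) : G) = A u := fun u => rfl
  have hnorm : ∀ u : D, ‖(u : H)‖ ≤ (√c)⁻¹ * ‖A u‖ := by
    intro u
    rw [inv_mul_eq_div, le_div_iff₀ (Real.sqrt_pos.2 hc)]
    refine le_of_sq_le_sq ?_ (norm_nonneg _)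
    rw [mul_pow, Real.sq_sqrt hc.le]
    linarith [hcoer u]
  let B : R →L[ℂ] H := (D.subtype ∘ₗ e.symm.toLinearMap).mkContinuous (√c)⁻¹ (fun r => by
    have := hnorm (e.symm r)
    rw [← he, e.apply_symm_apply] at this
    exact this)
  have hB : ∀ u : D, B (e u) = u := fun u => by
    change ((e.symm (e u) : D) : H) = u
    rw [e.symm_apply_apply]
  -- Coercivity makes preimages of a convergent sequence Cauchy, and the closed graph then puts the
  -- limit in the range. Completeness of the range is what gives `B` a Hilbert space adjoint.
  have hRclosed : IsClosed (R : Set G) := by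
    rw [← isSeqClosed_iff_isClosed]
    intro g g₀ hg hlim
    choose u hu using hg
    have hcau : CauchySeq (fun k => (u k : H)) := by
      refine Metric.cauchySeq_iff'.2 fun ε hε => ?_
      obtain ⟨M, hM⟩ := Metric.cauchySeq_iff'.1 hlim.cauchySeq (√c * ε) (by positivity)
      refine ⟨M, fun k hk => ?_⟩
      have h1 := hM k hk
      rw [dist_eq_norm, ← hu k, ← hu M, ← map_sub] at h1
      have h2 := hnorm (u k - u M)
      rw [dist_eq_norm]
      calc ‖(u k : H) - u M‖ ≤ (√c)⁻¹ * ‖A (u k - u M)‖ := h2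
        _ < (√c)⁻¹ * (√c * ε) := by gcongr
        _ = ε := by field_simp
    obtain ⟨u₀, hu₀⟩ := cauchySeq_tendsto_of_complete hcau
    have : (u₀, g₀) ∈ {p : H × G | ∃ u : D, (u : H) = p.1 ∧ A u = p.2} :=
      hclosed.mem_of_tendsto (hu₀.prodMk_nhds hlim)
        (Eventually.of_forall fun k => ⟨u k, rfl, hu k⟩)
    obtain ⟨w, -, hw⟩ := this
    exact ⟨w, hw⟩
  have : CompleteSpace R := hRclosed.completeSpace_coe
  have hadj : ∀ f, inner ℂ (B (ContinuousLinearMap.adjoint B f)) f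
      = ((‖ContinuousLinearMap.adjoint B f‖ ^ 2 : ℝ) : ℂ) := fun f => by
    rw [← ContinuousLinearMap.adjoint_inner_right, inner_self_eq_norm_sq_to_K]; norm_cast
  -- If `A u = B* f`, then `⟨A u, A v⟩ = ⟨f, B A v⟩ = ⟨f, v⟩`, so `u = B B* f` is the weak solution.
  refine ⟨B ∘L ContinuousLinearMap.adjoint B, ?_, ?_, ?_, ?_, ?_⟩
  · intro x y
    change inner ℂ (B (ContinuousLinearMap.adjoint B x)) y
      = inner ℂ x (B (ContinuousLinearMap.adjoint B y))
    rw [← ContinuousLinearMap.adjoint_inner_right, ContinuousLinearMap.adjoint_inner_left B]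
  · intro f
    change 0 ≤ (inner ℂ (B (ContinuousLinearMap.adjoint B f)) f).re
    rw [hadj]
    exact Complex.zero_le_real.2 (sq_nonneg _) |>.1
  · intro u
    -- `‖B B*‖ = ‖B‖²` turns `‖u‖ = ‖B A u‖ ≤ ‖B‖ ‖A u‖` into the sharp bound with constant `‖N‖`.
    have h1 := ContinuousLinearMap.norm_adjoint_comp_self (ContinuousLinearMap.adjoint B)
    rw [ContinuousLinearMap.adjoint_adjoint] at h1
    rw [h1, LinearIsometryEquiv.norm_map, ← pow_two, ← mul_pow]
    refine pow_le_pow_left₀ (norm_nonneg _) ?_ 2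
    have := B.le_opNorm (e u)
    rwa [hB] at this
  · intro f
    refine ⟨e.symm (ContinuousLinearMap.adjoint B f), rfl, fun v => ?_⟩
    rw [← he, ← he, e.apply_symm_apply, ← Submodule.coe_inner,
      ContinuousLinearMap.adjoint_inner_left, hB]
  · rintro ⟨K, hK, hKA⟩
    have : IsCompactOperator B := by
      rw [IsCompactOperator]
      refine ⟨K, hK, ?_⟩
      refine mem_of_superset (Metric.closedBall_mem_nhds 0 one_pos) fun r hr => ?_
      have hr' : ‖r‖ ≤ 1 := by simpa using hr
      have := hKA (e.symm r) (by
        rw [← he, e.apply_symm_apply]; exact hr')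
      exact this
    exact this.comp_clm _

/-- The spectral theory of the operator associated with a closed coercive form with compact form
domain. -/
theorem compactForm_spectrum [Nontrivial H] (Q : SesqForm H) (A : Q.domain →ₗ[ℂ] G)
    (hQ : Q.form = gramForm A) (hdense : Dense (Q.domain : Set H))
    (hclosed : IsClosed {p : H × G | ∃ u : Q.domain, (u : H) = p.1 ∧ A u = p.2})
    {c : ℝ} (hc : 0 < c) (hcoer : ∀ u : Q.domain, c * ‖(u : H)‖ ^ 2 ≤ ‖A u‖ ^ 2)
    (hcomp : ∃ K : Set H, IsCompact K ∧ ∀ u : Q.domain, ‖A u‖ ≤ 1 → (u : H) ∈ K) :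
    HasPurelyDiscreteSpectrum Q.operator ∧
    (∃ μ : ℝ, IsLeast {ν : ℝ | IsEigenvalue Q.operator (ν : ℂ)} μ ∧
      Q.varEigenvalue 1 = ENNReal.ofReal μ ∧ c ≤ μ) ∧
    ∃ N : H →L[ℂ] H, IsBoundedInverse Q.operator 0 N ∧ IsCompactOperator N ∧
      ∀ u, ‖N u‖ ≤ 1 / c * ‖u‖ := by
  obtain ⟨N, hsymm, hpos, hnorm, hrep, hNc⟩ := exists_factorization Q.domain A hclosed hc hcoer
  have hNc := hNc hcomp
  -- Density of the form domain makes the relation single-valued, so that `Q.operator` really has it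
  -- as its graph.
  have hgraph : ∀ p ∈ Q.operatorGraph, p.1 = 0 → p.2 = 0 := by
    rintro p ⟨u, hu, h⟩ hp
    refine hdense.eq_zero_of_inner_left (𝕜 := ℂ) fun v hv => ?_
    have hu0 : u = 0 := Subtype.ext (hu.trans hp)
    rw [h ⟨v, hv⟩, hu0, map_zero, LinearMap.zero_apply]
  have hmem : ∀ u : Q.operator.domain, ((u : H), Q.operator u) ∈ Q.operatorGraph := fun u =>
    Submodule.mem_graph_toLinearPMap hgraph u
  have huniq : ∀ p ∈ Q.operatorGraph, N p.2 = p.1 := by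
    rintro p ⟨u, hu, h⟩
    obtain ⟨w, hw, hw'⟩ := hrep p.2
    have h1 : A (w - u) = 0 := by
      have h2 : inner ℂ (A (w - u)) (A (w - u)) = 0 := by
        rw [map_sub, inner_sub_left, ← map_sub, ← hw', h, hQ, gramForm_apply, sub_self]
      exact inner_self_eq_zero.1 h2
    have h2 := hcoer (w - u)
    rw [h1, norm_zero] at h2
    have h3 : ‖((w - u : Q.domain) : H)‖ ^ 2 = 0 := by
      nlinarith [sq_nonneg ‖((w - u : Q.domain) : H)‖]
    have h4 : (w : H) - u = 0 := by simpa using h3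
    rw [← hw, ← hu, sub_eq_zero.1 h4]
  have hex : ∀ f, ∃ u : Q.operator.domain, (u : H) = N f ∧ Q.operator u = f := by
    intro f
    obtain ⟨w, hw, hw'⟩ := hrep f
    have hg : ((N f, f) : H × H) ∈ Q.operatorGraph := ⟨w, hw, fun v => by
      rw [hw', hQ, gramForm_apply]⟩
    have hg2 : ((N f, f) : H × H) ∈ Q.operator.graph := by
      rw [SesqForm.operator, Submodule.toLinearPMap_graph_eq _ hgraph]
      exact hg
    obtain ⟨u, hu1, hu2⟩ := (LinearPMap.mem_graph_iff _).1 hg2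
    exact ⟨u, hu1, hu2⟩
  have hinv : IsBoundedInverse Q.operator 0 N := by
    refine ⟨fun f => ?_, fun u => ?_⟩
    · obtain ⟨u, hu, hu'⟩ := hex f
      exact ⟨u, hu, by rw [hu', zero_smul, sub_zero]⟩
    · rw [zero_smul, sub_zero]
      exact huniq _ (hmem u)
  have hN0 : N ≠ 0 := by
    intro h
    obtain ⟨f, hf⟩ := exists_ne (0 : H)
    obtain ⟨u, hu, hu'⟩ := hex f
    have : u = 0 := Subtype.ext (by rw [hu, h]; rfl)
    rw [this, LinearPMap.map_zero] at hu'
    exact hf hu'.symm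
  have hNpos : 0 < ‖N‖ := norm_pos_iff.2 hN0
  have hQre : ∀ u, (Q.form u u).re = ‖A u‖ ^ 2 := fun u => by rw [hQ, gramForm_self_re]
  have hevQ : ∀ ν : ℝ, IsEigenvalue Q.operator (ν : ℂ) →
      ∃ u : Q.domain, u ≠ 0 ∧ ‖A u‖ ^ 2 = ν * ‖(u : H)‖ ^ 2 := by
    intro ν hν
    obtain ⟨u, hu, hu0⟩ := (Submodule.ne_bot_iff _).1 hν
    obtain ⟨w, hw, h⟩ := hmem u
    have hTu : Q.operator u = (ν : ℂ) • (u : H) := by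
      have : Q.operator u - (ν : ℂ) • (u : H) = 0 := by simpa [opEigenspace] using hu
      exact sub_eq_zero.1 this
    refine ⟨w, fun hw0 => hu0 (Subtype.ext ?_), ?_⟩
    · simpa [hw0] using hw.symm
    · rw [← hQre, ← h w]
      simp only at hw ⊢
      rw [hTu, hw, inner_smul_left, inner_self_eq_norm_sq_to_K]
      simp only [Complex.conj_ofReal, Complex.coe_algebraMap]
      norm_cast
  -- The bottom of the spectrum is `1/‖N‖`: it is attained because `‖N‖` is an eigenvalue of `N`,
  -- and it bounds the form from below by `hlow`.
  have hmuev : IsEigenvalue Q.operator ((‖N‖⁻¹ : ℝ) : ℂ) := by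
    refine hinv.isEigenvalue (by simpa using hN0) ?_
    have := hasEigenvalue_norm hNc hsymm hpos hN0
    simpa using this
  have hcmu : c ≤ ‖N‖⁻¹ := by
    obtain ⟨u, hu0, hu⟩ := hevQ _ hmuev
    have h1 := hcoer u
    rw [hu] at h1
    have h2 : 0 < ‖(u : H)‖ ^ 2 := by
      have : (u : H) ≠ 0 := by simpa using hu0
      positivity
    exact le_of_mul_le_mul_right h1 h2
  have hlow : ∀ u : Q.domain, ‖N‖⁻¹ * ‖(u : H)‖ ^ 2 ≤ ‖A u‖ ^ 2 := fun u => by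
    rw [inv_mul_le_iff₀ hNpos]
    exact hnorm u
  refine ⟨hinv.hasPurelyDiscreteSpectrum hNc hsymm, ⟨‖N‖⁻¹, ⟨hmuev, ?_⟩, ?_, hcmu⟩,
    N, hinv, hNc, fun u => ?_⟩
  · intro ν hν
    obtain ⟨u, hu0, hu⟩ := hevQ ν hν
    have h1 := hlow u
    rw [hu] at h1
    have h2 : 0 < ‖(u : H)‖ ^ 2 := by
      have : (u : H) ≠ 0 := by simpa using hu0
      positivity
    exact le_of_mul_le_mul_right h1 h2
  -- The line through the eigenvector is the optimal one-dimensional trial space; `hlow` applied to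
  -- any nonzero vector gives the other inequality.
  · apply le_antisymm
    · obtain ⟨u, hu0, hu⟩ := hevQ _ hmuev
      refine iInf₂_le_of_le (ℂ ∙ u) (finrank_span_singleton hu0) ?_
      refine iSup₂_le fun w hw => ?_
      obtain ⟨⟨a, rfl⟩, hw0⟩ := (And.imp_left Submodule.mem_span_singleton.1 hw)
      refine ENNReal.ofReal_le_ofReal ?_
      rw [hQre, map_smul, norm_smul, mul_pow, hu]
      have ha : a ≠ 0 := fun h => hw0 (by rw [h, zero_smul])
      have hu1 : (u : H) ≠ 0 := by simpa using hu0
      rw [Submodule.coe_smul, norm_smul, mul_pow, mul_left_comm, mul_div_assoc, div_self, mul_one]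
      have := norm_pos_iff.2 ha
      have := norm_pos_iff.2 hu1
      positivity
    · refine le_iInf₂ fun L hL => ?_
      have : Nontrivial L := Module.nontrivial_of_finrank_pos (R := ℂ) (by omega)
      obtain ⟨w, hw⟩ := exists_ne (0 : L)
      have hw0 : (w : Q.domain) ≠ 0 := by simpa using hw
      refine le_iSup₂_of_le (w : Q.domain) ⟨w.2, hw0⟩ ?_
      refine ENNReal.ofReal_le_ofReal ?_
      have hw1 : ((w : Q.domain) : H) ≠ 0 := by simpa using hw0
      have := norm_pos_iff.2 hw1
      rw [hQre, le_div_iff₀ (by positivity)]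
      exact hlow _
  · refine (N.le_opNorm u).trans ?_
    gcongr
    rw [one_div]
    exact (le_inv_comm₀ hc hNpos).1 hcmu

end CompactForm

/-! ### Test functions, weak gradients and `W¹₀` -/

section Sobolev

variable {n : ℕ} {Ω : Set (Fin n → ℂ)} {φ ψ : (Fin n → ℂ) → ℂ}

/-! ### Test functions -/

theorem IsTest.mono {U : Set (Fin n → ℂ)} (hφ : IsTest U φ) (h : U ⊆ Ω) : IsTest Ω φ :=
  ⟨hφ.1, hφ.2.1, hφ.2.2.trans h⟩

theorem IsTest.conj (hφ : IsTest Ω φ) : IsTest Ω (fun z => starRingEnd ℂ (φ z)) := by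
  refine ⟨Complex.conjCLE.contDiff.comp hφ.1, hφ.2.1.comp_left (g := starRingEnd ℂ) (map_zero _), ?_⟩
  exact (closure_mono (Function.support_comp_subset (map_zero _) φ)).trans hφ.2.2

theorem IsTest.realPartial_conj (hφ : IsTest Ω φ) (i : Fin n × Fin 2) (z : Fin n → ℂ) :
    realPartial i (fun z => starRingEnd ℂ (φ z)) z = starRingEnd ℂ (realPartial i φ z) := by
  have h := Complex.conjCLE.hasFDerivAt.comp z (hφ.differentiable z).hasFDerivAt
  have h2 : fderiv ℝ (fun z => starRingEnd ℂ (φ z)) z = _ := h.fderiv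
  rw [realPartial, h2]
  rfl

theorem IsTest.integral_eq (hφ : IsTest Ω φ) (g : (Fin n → ℂ) → ℂ) :
    ∫ z in Ω, g z * φ z = ∫ z, g z * φ z := by
  refine setIntegral_eq_integral_of_forall_compl_eq_zero fun z hz => ?_
  rw [image_eq_zero_of_notMem_tsupport (fun h => hz (hφ.2.2 h)), mul_zero]

theorem IsTest.continuous_realPartial (hφ : IsTest Ω φ) (i : Fin n × Fin 2) :
    Continuous (realPartial i φ) :=
  (hφ.1.continuous_fderiv (by simp)).clm_apply continuous_const

theorem IsTest.contDiff_realPartial (hφ : IsTest Ω φ) (i : Fin n × Fin 2) :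
    ContDiff ℝ ∞ (realPartial i φ) :=
  (hφ.1.fderiv_right (m := ∞) (by simp)).clm_apply contDiff_const

theorem IsTest.realPartial (hφ : IsTest Ω φ) (i : Fin n × Fin 2) : IsTest Ω (realPartial i φ) :=
  ⟨hφ.contDiff_realPartial i, hφ.2.1.fderiv_apply ℝ (realDir i),
    (tsupport_fderiv_apply_subset ℝ (realDir i)).trans hφ.2.2⟩

/-- Moving the conjugation onto `ψ` makes Hilbert space tools available for the bilinear pairing,
above all its continuity in `g`. -/
theorem pair_eq_inner (hψ : MemLp ψ 2 (volume.restrict Ω)) (g : L2 Ω) :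
    pair g ψ = inner ℂ (hψ.star.toLp) g := by
  rw [L2.inner_def, pair]
  refine integral_congr_ae ?_
  filter_upwards [hψ.star.coeFn_toLp] with z hz
  rw [hz]
  simp [RCLike.inner_apply]

theorem continuous_pair (hψ : MemLp ψ 2 (volume.restrict Ω)) :
    Continuous fun g : L2 Ω => pair g ψ := by
  simp only [pair_eq_inner hψ]
  exact continuous_const.inner continuous_id

/-- An element of `L²(Ω)` is determined by its pairings with test functions. -/
theorem eq_zero_of_pair (hΩ : IsOpen Ω) {g : L2 Ω} (h : ∀ φ, IsTest Ω φ → pair g φ = 0) :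
    g = 0 := by
  rw [Lp.eq_zero_iff_ae_eq_zero]
  have hloc : LocallyIntegrableOn (g : (Fin n → ℂ) → ℂ) Ω volume := by
    apply locallyIntegrableOn_of_locallyIntegrable_restrict
    exact (Lp.memLp g).locallyIntegrable (by norm_num)
  -- The fundamental lemma of the calculus of variations needs only real-valued test functions,
  -- which are complex test functions after coercion.
  have := hΩ.ae_eq_zero_of_integral_contDiff_smul_eq_zero hloc fun θ hθ hc hs => by
    have ht : IsTest Ω (fun z => (θ z : ℂ)) := by
      refine ⟨Complex.ofRealCLM.contDiff.comp hθ, hc.comp_left (g := Complex.ofReal) rfl, ?_⟩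
      exact (closure_mono (Function.support_comp_subset Complex.ofReal_zero θ)).trans hs
    have h1 := h _ ht
    rw [pair, ht.integral_eq] at h1
    rw [← h1]
    refine integral_congr_ae (Eventually.of_forall fun z => ?_)
    simp [mul_comm]
  rw [EventuallyEq, ae_restrict_iff' hΩ.measurableSet]
  exact this

/-! ### The weak gradient -/

/-- This single-valuedness is what makes `weakGrad` an operator with graph `weakGradGraph`. -/
theorem weakGradGraph_snd_eq_zero (hΩ : IsOpen Ω) (p : L2 Ω × L2Grad Ω) (hp : p ∈ weakGradGraph Ω)
    (h0 : p.1 = 0) : p.2 = 0 := by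
  ext1 i
  refine eq_zero_of_pair hΩ fun φ hφ => ?_
  have := hp φ hφ i
  rw [h0, pair_zero] at this
  exact neg_eq_zero.1 this.symm

theorem weakGrad_mem (hΩ : IsOpen Ω) (u : W1 Ω) :
    ((u : L2 Ω), weakGrad Ω u) ∈ weakGradGraph Ω :=
  Submodule.mem_graph_toLinearPMap (weakGradGraph_snd_eq_zero hΩ) u

theorem weakGradGraph_unique (hΩ : IsOpen Ω) {g : L2 Ω} {G G' : L2Grad Ω}
    (h : (g, G) ∈ weakGradGraph Ω) (h' : (g, G') ∈ weakGradGraph Ω) : G = G' := by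
  have := weakGradGraph_snd_eq_zero hΩ _ ((weakGradGraph Ω).sub_mem h h') (sub_self _)
  exact sub_eq_zero.1 this

theorem mem_W1 {g : L2 Ω} {G : L2Grad Ω} (h : (g, G) ∈ weakGradGraph Ω) : g ∈ W1 Ω :=
  ⟨(g, G), h, rfl⟩

theorem isClosed_weakGradGraph : IsClosed (weakGradGraph Ω : Set (L2 Ω × L2Grad Ω)) := by
  have : (weakGradGraph Ω : Set (L2 Ω × L2Grad Ω)) = ⋂ (φ : (Fin n → ℂ) → ℂ) (_ : IsTest Ω φ)
      (i : Fin n × Fin 2), {p | pair p.1 (KohnNirenberg.realPartial i φ) = - pair (p.2 i) φ} := by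
    ext p
    simp only [mem_iInter]
    rfl
  rw [this]
  refine isClosed_iInter fun φ => isClosed_iInter fun hφ => isClosed_iInter fun i => ?_
  refine isClosed_eq ((continuous_pair (hφ.realPartial_memLp i)).comp continuous_fst) ?_
  refine ((continuous_pair hφ.memLp).comp ?_).neg
  exact (PiLp.continuous_apply 2 _ i).comp continuous_snd

/-- Integration by parts for test functions. -/
theorem IsTest.integral_mul_realPartial (hφ : IsTest Ω φ) (hψ : IsTest Ω ψ) (i : Fin n × Fin 2) :
    ∫ z in Ω, φ z * KohnNirenberg.realPartial i ψ z
      = - ∫ z in Ω, KohnNirenberg.realPartial i φ z * ψ z := by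
  rw [(hψ.realPartial i).integral_eq, hψ.integral_eq]
  refine integral_mul_fderiv_eq_neg_fderiv_mul_of_integrable ?_ ?_ ?_
    (fun x _ => hφ.differentiable x) (fun x _ => hψ.differentiable x)
  · exact ((hφ.continuous_realPartial i).mul hψ.1.continuous).integrable_of_hasCompactSupport
      hψ.2.1.mul_left
  · exact (hφ.1.continuous.mul (hψ.continuous_realPartial i)).integrable_of_hasCompactSupport
      (hψ.realPartial i).2.1.mul_left
  · exact (hφ.1.continuous.mul hψ.1.continuous).integrable_of_hasCompactSupport hψ.2.1.mul_left

theorem testGradGraph_le : testGradGraph Ω ≤ weakGradGraph Ω := by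
  rintro p ⟨φ, hφ, h, hi⟩ ψ hψ i
  have h1 : pair p.1 (KohnNirenberg.realPartial i ψ)
      = ∫ z in Ω, φ z * KohnNirenberg.realPartial i ψ z :=
    integral_congr_ae (h.mono fun z hz => by simp only [hz])
  have h2 : pair (p.2 i) ψ = ∫ z in Ω, KohnNirenberg.realPartial i φ z * ψ z :=
    integral_congr_ae ((hi i).mono fun z hz => by simp only [hz])
  rw [h1, h2, hφ.integral_mul_realPartial hψ]

/-- Weak gradients survive `L²` limits, so the second entry of a pair in the closure is the weak
gradient of the first. -/
theorem closure_testGradGraph_le :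
    (testGradGraph Ω).topologicalClosure ≤ weakGradGraph Ω :=
  Submodule.topologicalClosure_minimal _ testGradGraph_le isClosed_weakGradGraph

theorem IsTest.mem_testGradGraph (hφ : IsTest Ω φ) :
    (hφ.memLp.toLp, WithLp.toLp 2 fun i => (hφ.realPartial_memLp i).toLp) ∈ testGradGraph Ω :=
  ⟨φ, hφ, hφ.memLp.coeFn_toLp, fun i => (hφ.realPartial_memLp i).coeFn_toLp⟩

theorem W10_exists {g : L2 Ω} (hg : g ∈ W10 Ω) :
    ∃ G : L2Grad Ω, (g, G) ∈ (testGradGraph Ω).topologicalClosure := by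
  obtain ⟨p, hp, rfl⟩ := hg.2
  exact ⟨p.2, hp⟩

theorem mem_W10 {g : L2 Ω} {G : L2Grad Ω} (h : (g, G) ∈ (testGradGraph Ω).topologicalClosure) :
    g ∈ W10 Ω :=
  ⟨mem_W1 (closure_testGradGraph_le h), ⟨(g, G), h, rfl⟩⟩

theorem IsTest.mem_W10 (hφ : IsTest Ω φ) : hφ.memLp.toLp ∈ W10 Ω :=
  KohnNirenberg.mem_W10 (Submodule.le_topologicalClosure _ hφ.mem_testGradGraph)

/-- Second derivatives of test functions commute: `⟨∂_i φ, ∂_k ψ⟩ = ⟨∂_k φ, ∂_i ψ⟩`. -/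
theorem IsTest.integral_conj_realPartial (hφ : IsTest Ω φ) (hψ : IsTest Ω ψ)
    (i k : Fin n × Fin 2) :
    ∫ z in Ω, KohnNirenberg.realPartial i φ z * KohnNirenberg.realPartial k ψ z
      = ∫ z in Ω, KohnNirenberg.realPartial k φ z * KohnNirenberg.realPartial i ψ z := by
  rw [(hφ.realPartial i).integral_mul_realPartial hψ, (hφ.realPartial k).integral_mul_realPartial hψ]
  congr 1
  refine integral_congr_ae (Eventually.of_forall fun z => ?_)
  simp only
  congr 1
  have hd : Differentiable ℝ (fderiv ℝ φ) :=
    (hφ.1.fderiv_right (m := ∞) (by simp)).differentiable (by simp)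
  have hs : IsSymmSndFDerivAt ℝ φ z :=
    (hφ.1.contDiffAt).isSymmSndFDerivAt (by
      simpa using (WithTop.coe_le_coe.2 le_top : ((2 : ℕ∞) : WithTop ℕ∞) ≤ ((⊤ : ℕ∞) : WithTop ℕ∞)))
  have key : ∀ a b : Fin n × Fin 2,
      KohnNirenberg.realPartial a (KohnNirenberg.realPartial b φ) z
        = fderiv ℝ (fderiv ℝ φ) z (realDir a) (realDir b) := by
    intro a b
    have h1 : HasFDerivAt (KohnNirenberg.realPartial b φ)
        ((ContinuousLinearMap.apply ℝ ℂ (realDir b)).comp (fderiv ℝ (fderiv ℝ φ) z)) z :=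
      (ContinuousLinearMap.apply ℝ ℂ (realDir b)).hasFDerivAt.comp z (hd z).hasFDerivAt
    rw [KohnNirenberg.realPartial, h1.fderiv]
    rfl
  rw [key, key]
  exact hs _ _

/-- For test functions, two integrations by parts and the symmetry of second derivatives give the
exchange; both sides are continuous in each pair, so it passes to the closure one variable at a
time. This is where vanishing at the boundary enters. -/
theorem inner_testGrad_comm {p p' : L2 Ω × L2Grad Ω}
    (hp : p ∈ (testGradGraph Ω).topologicalClosure)
    (hp' : p' ∈ (testGradGraph Ω).topologicalClosure) (i k : Fin n × Fin 2) :
    inner ℂ (p.2 i) (p'.2 k) = inner ℂ (p.2 k) (p'.2 i) := by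
  have hcont : ∀ i, Continuous fun p : L2 Ω × L2Grad Ω => p.2 i := fun i =>
    (PiLp.continuous_apply 2 _ i).comp continuous_snd
  have h1 : ∀ a ∈ testGradGraph Ω, ∀ b ∈ testGradGraph Ω,
      inner ℂ (a.2 i) (b.2 k) = inner ℂ (a.2 k) (b.2 i) := by
    rintro a ⟨φ, hφ, -, ha⟩ b ⟨ψ, hψ, -, hb⟩
    have key : ∀ i k, inner ℂ (a.2 i) (b.2 k)
        = ∫ z in Ω, KohnNirenberg.realPartial i (fun z => starRingEnd ℂ (φ z)) z
          * KohnNirenberg.realPartial k ψ z := by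
      intro i k
      rw [L2.inner_def]
      refine integral_congr_ae ?_
      filter_upwards [ha i, hb k] with z h1 h2
      rw [h1, h2, hφ.realPartial_conj, RCLike.inner_apply, mul_comm]
    rw [key, key, hφ.conj.integral_conj_realPartial hψ]
  have h2 : ∀ a ∈ testGradGraph Ω, ∀ b ∈ (testGradGraph Ω).topologicalClosure,
      inner ℂ (a.2 i) (b.2 k) = inner ℂ (a.2 k) (b.2 i) := by
    intro a ha
    have hcl : IsClosed {b : L2 Ω × L2Grad Ω | inner ℂ (a.2 i) (b.2 k) = inner ℂ (a.2 k) (b.2 i)} :=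
      isClosed_eq (continuous_const.inner (hcont k)) (continuous_const.inner (hcont i))
    exact fun b hb => closure_minimal (h1 a ha) hcl hb
  have hcl : IsClosed {a : L2 Ω × L2Grad Ω | inner ℂ (a.2 i) (p'.2 k) = inner ℂ (a.2 k) (p'.2 i)} :=
    isClosed_eq ((hcont i).inner continuous_const) ((hcont k).inner continuous_const)
  exact closure_minimal (fun a ha => h2 a ha p' hp') hcl hp

theorem eq_zero_of_inner_W10 (hΩ : IsOpen Ω) {g : L2 Ω} (h : ∀ w ∈ W10 Ω, inner ℂ w g = 0) :
    g = 0 := by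
  refine eq_zero_of_pair hΩ fun φ hφ => ?_
  have := h _ hφ.conj.mem_W10
  rw [pair_eq_inner hφ.memLp]
  exact this

end Sobolev

/-! ### Combinatorics of increasing multi-indices -/

section Wedge

variable {n : ℕ}

/-- Sums over pairs `j ∈ L`, `|L| = q + 1`, as sums over pairs `j ∉ A`, `|A| = q`. -/
theorem sum_mem_eq_sum_compl {M : Type*} [AddCommMonoid M] (q : ℕ)
    (F : Fin n → Finset (Fin n) → M) :
    ∑ L ∈ Finset.powersetCard (q + 1) Finset.univ, ∑ j ∈ L, F j L
      = ∑ A ∈ Finset.powersetCard q Finset.univ, ∑ j ∈ Aᶜ, F j (insert j A) := by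
  rw [Finset.sum_sigma', Finset.sum_sigma']
  refine Finset.sum_bij' (fun x _ => ⟨x.1.erase x.2, x.2⟩) (fun x _ => ⟨insert x.2 x.1, x.2⟩)
    ?_ ?_ ?_ ?_ ?_
  · rintro ⟨L, j⟩ h
    simp only [Finset.mem_sigma, Finset.mem_powersetCard_univ] at h
    simp [Finset.card_erase_of_mem h.2, h.1]
  · rintro ⟨A, j⟩ h
    simp only [Finset.mem_sigma, Finset.mem_powersetCard_univ, Finset.mem_compl] at h
    simp [Finset.card_insert_of_notMem h.2, h.1]
  · rintro ⟨L, j⟩ h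
    simp only [Finset.mem_sigma] at h
    simp [Finset.insert_erase h.2]
  · rintro ⟨A, j⟩ h
    simp only [Finset.mem_sigma, Finset.mem_compl] at h
    simp [Finset.erase_insert h.2]
  · rintro ⟨L, j⟩ h
    simp only [Finset.mem_sigma] at h
    simp [Finset.insert_erase h.2]

theorem wedgeSign_sq (j : Fin n) (L : Finset (Fin n)) : wedgeSign j L * wedgeSign j L = 1 := by
  rw [wedgeSign, ← mul_pow]; simp

theorem conj_wedgeSign (j : Fin n) (L : Finset (Fin n)) :
    starRingEnd ℂ (wedgeSign j L) = wedgeSign j L := by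
  simp [wedgeSign]

theorem wedgeSign_insert_self (j : Fin n) (A : Finset (Fin n)) :
    wedgeSign j (insert j A) = wedgeSign j A := by
  rw [wedgeSign, wedgeSign, Finset.filter_insert, if_neg (lt_irrefl j)]

theorem wedgeSign_insert (j k : Fin n) (A : Finset (Fin n)) (hj : j ∉ A) :
    wedgeSign k (insert j A) = (if j < k then -1 else 1) * wedgeSign k A := by
  rw [wedgeSign, wedgeSign, Finset.filter_insert]
  split_ifs with h
  · rw [Finset.card_insert_of_notMem (by simp [hj]), pow_succ]; ring
  · ring

/-- Wedging with `dz̄_j` anticommutes with removing `dz̄_k`: exactly one of `j < k` and `k < j`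
contributes a sign. This minus sign drives the cancellation in `sum_norm_wedge`. -/
theorem wedgeSign_mul (j k : Fin n) (A : Finset (Fin n)) (hk : k ∈ A) (hj : j ∉ A) :
    wedgeSign j (insert j A) * wedgeSign k (insert j A)
      = - (wedgeSign k A * wedgeSign j (insert j (A.erase k))) := by
  have hjk : j ≠ k := fun h => hj (h ▸ hk)
  have h1 : wedgeSign j A = (if k < j then -1 else 1) * wedgeSign j (A.erase k) := by
    conv_lhs => rw [← Finset.insert_erase hk]
    exact wedgeSign_insert k j _ (by simp)
  rw [wedgeSign_insert_self, wedgeSign_insert_self, wedgeSign_insert j k A hj, h1]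
  rcases lt_or_gt_of_ne hjk with h | h
  · rw [if_pos h, if_neg (not_lt_of_gt h)]; ring
  · rw [if_pos h, if_neg (not_lt_of_gt h)]; ring

/-- The algebra behind the identity `‖∂̄u‖² + ‖ϑu‖² = ∑ ‖∂u_J/∂z̄_j‖²` for forms `u` for which
`⟨∂_j u_A, ∂_k u_B⟩ = ⟨∂̄_k u_A, ∂̄_j u_B⟩`. -/
theorem sum_norm_wedge {V : Type*} [NormedAddCommGroup V] [InnerProductSpace ℂ V]
    (D E : Fin n → Finset (Fin n) → V)
    (h : ∀ j k A B, inner ℂ (E j A) (E k B) = inner ℂ (D k A) (D j B)) (p : ℕ) :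
    ∑ L ∈ Finset.powersetCard (p + 2) Finset.univ,
        ‖∑ j ∈ L, wedgeSign j L • D j (L.erase j)‖ ^ 2
      + ∑ K ∈ Finset.powersetCard p Finset.univ,
        ‖∑ j ∈ Kᶜ, wedgeSign j (insert j K) • E j (insert j K)‖ ^ 2
      = ∑ A ∈ Finset.powersetCard (p + 1) Finset.univ, ∑ j, ‖D j A‖ ^ 2 := by
  have hsq : ∀ x : V, ((‖x‖ ^ 2 : ℝ) : ℂ) = inner ℂ x x := fun x => by
    rw [inner_self_eq_norm_sq_to_K]; norm_cast
  rw [← Complex.ofReal_inj]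
  push_cast
  simp only [← Complex.ofReal_pow, hsq]
  have e1 : ∀ L : Finset (Fin n), inner ℂ (∑ j ∈ L, wedgeSign j L • D j (L.erase j))
      (∑ j ∈ L, wedgeSign j L • D j (L.erase j)) = ∑ j ∈ L, ∑ k ∈ L,
        wedgeSign j L * wedgeSign k L * inner ℂ (D j (L.erase j)) (D k (L.erase k)) := by
    intro L
    rw [sum_inner]
    refine Finset.sum_congr rfl fun j _ => ?_
    rw [inner_sum]
    refine Finset.sum_congr rfl fun k _ => ?_
    rw [inner_smul_left, inner_smul_right, conj_wedgeSign]; ring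
  have e2 : ∀ K : Finset (Fin n), inner ℂ (∑ j ∈ Kᶜ, wedgeSign j (insert j K) • E j (insert j K))
      (∑ j ∈ Kᶜ, wedgeSign j (insert j K) • E j (insert j K)) = ∑ k ∈ Kᶜ, ∑ j ∈ Kᶜ,
        wedgeSign k (insert k K) * wedgeSign j (insert j K)
          * inner ℂ (D j (insert k K)) (D k (insert j K)) := by
    intro L
    rw [sum_inner]
    refine Finset.sum_congr rfl fun j _ => ?_
    rw [inner_sum]
    refine Finset.sum_congr rfl fun k _ => ?_
    rw [inner_smul_left, inner_smul_right, conj_wedgeSign, h]; ring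
  simp only [e1, e2]
  rw [sum_mem_eq_sum_compl (p + 1) (fun j L => ∑ k ∈ L,
        wedgeSign j L * wedgeSign k L * inner ℂ (D j (L.erase j)) (D k (L.erase k)))]
  have e3 : ∑ K ∈ Finset.powersetCard p Finset.univ, ∑ k ∈ Kᶜ, ∑ j ∈ Kᶜ,
        wedgeSign k (insert k K) * wedgeSign j (insert j K)
          * inner ℂ (D j (insert k K)) (D k (insert j K))
      = ∑ A ∈ Finset.powersetCard (p + 1) Finset.univ, ∑ k ∈ A, ∑ j ∈ (A.erase k)ᶜ,
        wedgeSign k A * wedgeSign j (insert j (A.erase k))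
          * inner ℂ (D j A) (D k (insert j (A.erase k))) := by
    rw [sum_mem_eq_sum_compl p (fun k A => ∑ j ∈ (A.erase k)ᶜ,
        wedgeSign k A * wedgeSign j (insert j (A.erase k))
          * inner ℂ (D j A) (D k (insert j (A.erase k))))]
    refine Finset.sum_congr rfl fun K _ => Finset.sum_congr rfl fun k hk => ?_
    rw [Finset.erase_insert (Finset.mem_compl.1 hk)]
  rw [e3, ← Finset.sum_add_distrib]
  refine Finset.sum_congr rfl fun A _ => ?_
  -- For fixed `A`, the `∂̄` part supplies the diagonal terms with `j ∉ A` and, in `e5`, the adjoint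
  -- part those with `j ∈ A`; the remaining double sums are equal with opposite signs.
  have e4 : ∀ j ∈ Aᶜ, ∑ k ∈ insert j A, wedgeSign j (insert j A) * wedgeSign k (insert j A)
        * inner ℂ (D j ((insert j A).erase j)) (D k ((insert j A).erase k))
      = inner ℂ (D j A) (D j A) - ∑ k ∈ A, wedgeSign k A * wedgeSign j (insert j (A.erase k))
          * inner ℂ (D j A) (D k (insert j (A.erase k))) := by
    intro j hj
    have hj' := Finset.mem_compl.1 hj
    rw [Finset.sum_insert hj', Finset.erase_insert hj', wedgeSign_sq, one_mul, sub_eq_add_neg,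
      ← Finset.sum_neg_distrib]
    congr 1
    refine Finset.sum_congr rfl fun k hk => ?_
    have hjk : k ≠ j := fun h => hj' (h ▸ hk)
    rw [wedgeSign_mul j k A hk hj', Finset.erase_insert_of_ne hjk.symm]
    ring
  have e5 : ∀ k ∈ A, ∑ j ∈ (A.erase k)ᶜ, wedgeSign k A * wedgeSign j (insert j (A.erase k))
          * inner ℂ (D j A) (D k (insert j (A.erase k)))
      = inner ℂ (D k A) (D k A) + ∑ j ∈ Aᶜ, wedgeSign k A * wedgeSign j (insert j (A.erase k))
          * inner ℂ (D j A) (D k (insert j (A.erase k))) := by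
    intro k hk
    rw [Finset.compl_erase, Finset.sum_insert (by simpa using hk), Finset.insert_erase hk,
      wedgeSign_sq, one_mul]
  rw [Finset.sum_congr rfl e4, Finset.sum_congr rfl e5, Finset.sum_sub_distrib,
    Finset.sum_add_distrib, Finset.sum_comm (s := A) (t := Aᶜ),
    ← Finset.sum_add_sum_compl A (fun j => inner ℂ (D j A) (D j A))]
  ring

theorem sum_subtype_card {M : Type*} [AddCommMonoid M] (q : ℕ) (F : Finset (Fin n) → M) :
    ∑ J : {J : Finset (Fin n) // J.card = q}, F J.1 = ∑ J ∈ Finset.powersetCard q Finset.univ, F J :=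
  (Finset.sum_subtype _ (fun _ => Finset.mem_powersetCard_univ) F).symm

end Wedge

/-! ### The Cauchy–Riemann operator and its adjoint -/

section Dbar

variable {n : ℕ} {Ω : Set (Fin n → ℂ)} {φ ψ : (Fin n → ℂ) → ℂ}

/-- The `∂/∂z̄_j` derivative read off a gradient. -/
def gradBar (G : L2Grad Ω) (j : Fin n) : L2 Ω :=
  (1 / 2 : ℂ) • (G (j, 0) + Complex.I • G (j, 1))

/-- The `∂/∂z_j` derivative read off a gradient. -/
def gradHol (G : L2Grad Ω) (j : Fin n) : L2 Ω :=
  (1 / 2 : ℂ) • (G (j, 0) - Complex.I • G (j, 1))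

theorem coeff_coe {q : ℕ} (u : L2Form Ω q) (J : {J : Finset (Fin n) // J.card = q}) :
    coeff u J.1 = u J := by
  rw [coeff, dif_pos J.2]

theorem dbarGraph_snd_eq_zero (hΩ : IsOpen Ω) {p q : ℕ} (w : L2Form Ω p × L2Form Ω q)
    (hw : w ∈ dbarGraph Ω p q) (h0 : w.1 = 0) : w.2 = 0 := by
  ext1 L
  refine eq_zero_of_pair hΩ fun φ hφ => ?_
  have := hw L φ hφ
  simp only [h0, coeff_zero, pair_zero, mul_zero, Finset.sum_const_zero] at this
  exact neg_eq_zero.1 this.symm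

theorem dbar_mem (hΩ : IsOpen Ω) {p q : ℕ} (u : (dbar Ω p q).domain) :
    ((u : L2Form Ω p), dbar Ω p q u) ∈ dbarGraph Ω p q :=
  Submodule.mem_graph_toLinearPMap (dbarGraph_snd_eq_zero hΩ) u

theorem dbarGraph_unique (hΩ : IsOpen Ω) {p q : ℕ} {u : L2Form Ω p} {f f' : L2Form Ω q}
    (h : (u, f) ∈ dbarGraph Ω p q) (h' : (u, f') ∈ dbarGraph Ω p q) : f = f' :=
  sub_eq_zero.1 (dbarGraph_snd_eq_zero hΩ _ ((dbarGraph Ω p q).sub_mem h h') (sub_self _))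

theorem continuous_coeff {q : ℕ} (J : Finset (Fin n)) :
    Continuous fun u : L2Form Ω q => coeff u J := by
  by_cases h : J.card = q
  · simp only [coeff, dif_pos h]
    exact PiLp.continuous_apply 2 _ _
  · simp only [coeff, dif_neg h]
    exact continuous_const

theorem isClosed_dbarGraph {p q : ℕ} :
    IsClosed (dbarGraph Ω p q : Set (L2Form Ω p × L2Form Ω q)) := by
  have : (dbarGraph Ω p q : Set (L2Form Ω p × L2Form Ω q)) =
      ⋂ (L : {L : Finset (Fin n) // L.card = q}) (φ : (Fin n → ℂ) → ℂ) (_ : IsTest Ω φ),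
      {w | ∑ j ∈ L.1, wedgeSign j L.1 * pair (coeff w.1 (L.1.erase j)) (dzbar j φ)
        = - pair (w.2 L) φ} := by
    ext p
    simp only [mem_iInter]
    rfl
  rw [this]
  refine isClosed_iInter fun L => isClosed_iInter fun φ => isClosed_iInter fun hφ => ?_
  refine isClosed_eq ?_ ?_
  · refine continuous_finsetSum _ fun j _ => continuous_const.mul ?_
    exact (continuous_pair (hφ.dzbar_memLp j)).comp ((continuous_coeff _).comp continuous_fst)
  · refine ((continuous_pair hφ.memLp).comp ?_).neg
    exact (PiLp.continuous_apply 2 _ L).comp continuous_snd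

/-- The Cauchy–Riemann operator on forms with coefficients in `W¹(Ω)`. -/
theorem dbarGraph_of_grad {q : ℕ} {u : L2Form Ω q} {G : Finset (Fin n) → L2Grad Ω}
    (hG : ∀ J, (coeff u J, G J) ∈ weakGradGraph Ω) (r : ℕ) :
    (u, WithLp.toLp 2 fun L : {L : Finset (Fin n) // L.card = r} =>
      ∑ j ∈ L.1, wedgeSign j L.1 • gradBar (G (L.1.erase j)) j) ∈ dbarGraph Ω q r := by
  intro L φ hφ
  simp only
  rw [pair_sum Ω _ _ hφ.memLp, ← Finset.sum_neg_distrib]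
  refine Finset.sum_congr rfl fun j _ => ?_
  rw [pair_dzbar Ω (hG _) hφ, pair_smul (wedgeSign j L.1), mul_neg]
  rfl

theorem IsTest.dzbar_conj (hφ : IsTest Ω φ) (j : Fin n) (z : Fin n → ℂ) :
    dzbar j (fun z => starRingEnd ℂ (φ z)) z
      = starRingEnd ℂ ((1 / 2) * (KohnNirenberg.realPartial (j, 0) φ z
        - Complex.I * KohnNirenberg.realPartial (j, 1) φ z)) := by
  rw [dzbar, hφ.realPartial_conj, hφ.realPartial_conj]
  simp only [map_mul, map_sub, Complex.conj_I, map_div₀, map_one, map_ofNat]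
  ring

theorem continuous_gradHol (j : Fin n) : Continuous fun G : L2Grad Ω => gradHol G j := by
  unfold gradHol
  have h : ∀ i, Continuous fun G : L2Grad Ω => G i := fun i => PiLp.continuous_apply 2 _ i
  exact ((h (j, 0)).sub ((h (j, 1)).const_smul Complex.I)).const_smul (1 / 2 : ℂ)

/-- The distributional equation for `∂̄` tested against `conj φ`: the conjugation turns `∂/∂z̄_j`
into `∂/∂z_j`, whence `gradHol`. Both sides are continuous in `(φ, ∇φ)`, which extends the formula
from test functions to `W¹₀`. -/
theorem inner_dbar_of_W10 {p q : ℕ} {w : L2Form Ω p × L2Form Ω q} (hw : w ∈ dbarGraph Ω p q)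
    {g : L2 Ω} {G : L2Grad Ω} (hg : (g, G) ∈ (testGradGraph Ω).topologicalClosure)
    (L : {L : Finset (Fin n) // L.card = q}) :
    inner ℂ g (w.2 L)
      = - ∑ j ∈ L.1, wedgeSign j L.1 * inner ℂ (gradHol G j) (coeff w.1 (L.1.erase j)) := by
  have hcl : IsClosed {a : L2 Ω × L2Grad Ω | inner ℂ a.1 (w.2 L)
      = - ∑ j ∈ L.1, wedgeSign j L.1 * inner ℂ (gradHol a.2 j) (coeff w.1 (L.1.erase j))} := by
    refine isClosed_eq (continuous_fst.inner continuous_const) ?_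
    refine (continuous_finsetSum _ fun j _ => continuous_const.mul ?_).neg
    exact ((continuous_gradHol j).comp continuous_snd).inner continuous_const
  refine closure_minimal ?_ hcl hg
  rintro a ⟨φ, hφ, h, hi⟩
  have h1 : inner ℂ a.1 (w.2 L) = pair (w.2 L) (fun z => starRingEnd ℂ (φ z)) := by
    rw [L2.inner_def, pair]
    refine integral_congr_ae ?_
    filter_upwards [h] with z hz
    rw [hz, RCLike.inner_apply]
  have h2 : ∀ j v, inner ℂ (gradHol a.2 j) v
      = pair v (dzbar j (fun z => starRingEnd ℂ (φ z))) := by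
    intro j v
    rw [L2.inner_def, pair]
    refine integral_congr_ae ?_
    filter_upwards [hi (j, 0), hi (j, 1),
      Lp.coeFn_smul (1 / 2 : ℂ) (a.2 (j, 0) - Complex.I • a.2 (j, 1)),
      Lp.coeFn_sub (a.2 (j, 0)) (Complex.I • a.2 (j, 1)),
      Lp.coeFn_smul Complex.I (a.2 (j, 1))] with z h0 h1 h2 h3 h4
    rw [gradHol, h2, Pi.smul_apply, h3, Pi.sub_apply, h4, Pi.smul_apply, h0, h1, hφ.dzbar_conj,
      RCLike.inner_apply]
    rfl
  change inner ℂ a.1 (w.2 L)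
      = - ∑ j ∈ L.1, wedgeSign j L.1 * inner ℂ (gradHol a.2 j) (coeff w.1 (L.1.erase j))
  simp only [h1, h2]
  rw [hw L _ hφ.conj, neg_neg]

/-- The formal adjoint of `∂̄` applied to a form whose coefficients have the gradients `G`. -/
def thetaOf (G : Finset (Fin n) → L2Grad Ω) (p : ℕ) : L2Form Ω p :=
  WithLp.toLp 2 fun K => - ∑ j ∈ K.1ᶜ, wedgeSign j (insert j K.1) • gradHol (G (insert j K.1)) j

/-- Summing the componentwise integration by parts over `L` and regrouping the pairs `(L, j)` with
`j ∈ L` as pairs `(K, j)` with `j ∉ K` collects the coefficients of the formal adjoint. -/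
theorem inner_thetaOf {p : ℕ} {w : L2Form Ω p × L2Form Ω (p + 1)}
    (hw : w ∈ dbarGraph Ω p (p + 1)) {u : L2Form Ω (p + 1)} {G : Finset (Fin n) → L2Grad Ω}
    (hG : ∀ J, (coeff u J, G J) ∈ (testGradGraph Ω).topologicalClosure) :
    inner ℂ (thetaOf G p) w.1 = inner ℂ u w.2 := by
  rw [PiLp.inner_apply, PiLp.inner_apply]
  have h1 : ∀ L : {L : Finset (Fin n) // L.card = p + 1}, inner ℂ (u L) (w.2 L)
      = - ∑ j ∈ L.1, wedgeSign j L.1 * inner ℂ (gradHol (G L.1) j) (coeff w.1 (L.1.erase j)) := by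
    intro L
    have h := hG L.1
    rw [coeff_coe] at h
    exact inner_dbar_of_W10 hw h L
  have h2 : ∀ K : {K : Finset (Fin n) // K.card = p}, inner ℂ (thetaOf G p K) (w.1 K)
      = - ∑ j ∈ K.1ᶜ, wedgeSign j (insert j K.1)
        * inner ℂ (gradHol (G (insert j K.1)) j) (coeff w.1 K.1) := by
    intro K
    rw [coeff_coe]
    simp only [thetaOf, inner_neg_left, sum_inner, inner_smul_left, conj_wedgeSign]
  simp only [h1, h2]
  rw [sum_subtype_card p (fun K => - ∑ j ∈ Kᶜ, wedgeSign j (insert j K)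
        * inner ℂ (gradHol (G (insert j K)) j) (coeff w.1 K)),
    sum_subtype_card (p + 1) (fun L => - ∑ j ∈ L, wedgeSign j L
      * inner ℂ (gradHol (G L) j) (coeff w.1 (L.erase j))),
    Finset.sum_neg_distrib, Finset.sum_neg_distrib,
    sum_mem_eq_sum_compl p (fun j L => wedgeSign j L
      * inner ℂ (gradHol (G L) j) (coeff w.1 (L.erase j)))]
  congr 1
  refine Finset.sum_congr rfl fun K _ => Finset.sum_congr rfl fun j hj => ?_
  rw [Finset.erase_insert (Finset.mem_compl.1 hj)]

theorem exists_closure_grad {q : ℕ} {u : L2Form Ω q} (hu : ∀ J, u J ∈ W10 Ω) :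
    ∃ G : Finset (Fin n) → L2Grad Ω,
      ∀ J, (coeff u J, G J) ∈ (testGradGraph Ω).topologicalClosure := by
  have hc : ∀ J : Finset (Fin n), ∃ G : L2Grad Ω,
      (coeff u J, G) ∈ (testGradGraph Ω).topologicalClosure := by
    intro J
    by_cases h : J.card = q
    · rw [coeff, dif_pos h]
      exact W10_exists (hu ⟨J, h⟩)
    · rw [coeff, dif_neg h]
      exact ⟨0, Submodule.zero_mem _⟩
  exact ⟨fun J => (hc J).choose, fun J => (hc J).choose_spec⟩

/-- A subspace containing all forms with coefficients in `W¹₀(Ω)` is dense. -/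
theorem dense_of_W10_le (hΩ : IsOpen Ω) {q : ℕ} {S : Submodule ℂ (L2Form Ω q)}
    (h : ∀ u : L2Form Ω q, (∀ J, u J ∈ W10 Ω) → u ∈ S) : Dense (S : Set (L2Form Ω q)) := by
  classical
  rw [Submodule.dense_iff_topologicalClosure_eq_top, Submodule.topologicalClosure_eq_top_iff,
    Submodule.eq_bot_iff]
  intro v hv
  ext1 J
  refine eq_zero_of_inner_W10 hΩ fun w hw => ?_
  -- Forms with a single nonzero coefficient suffice to test `v` one component at a time.
  have h1 : (WithLp.toLp 2 (Pi.single J w) : L2Form Ω q) ∈ S := by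
    refine h _ fun J' => ?_
    by_cases hJ : J' = J
    · subst hJ; simpa using hw
    · simp [hJ]
  have h2 := (Submodule.mem_orthogonal _ _).1 hv _ h1
  rw [PiLp.inner_apply, Finset.sum_eq_single J] at h2
  · simpa using h2
  · intro J' _ hJ
    simp [hJ]
  · simp

theorem dense_dbar_domain (hΩ : IsOpen Ω) (q : ℕ) :
    Dense ((dbar Ω q (q + 1)).domain : Set (L2Form Ω q)) :=
  dense_of_W10_le hΩ fun _ hu => W1Form_le_dbar_domain Ω q fun J => (hu J).1

theorem inner_dbarStar (hΩ : IsOpen Ω) {p : ℕ} (u : (dbarStar Ω p (p + 1)).domain)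
    {w : L2Form Ω p × L2Form Ω (p + 1)} (hw : w ∈ dbarGraph Ω p (p + 1)) :
    inner ℂ (dbarStar Ω p (p + 1) u) w.1 = inner ℂ (u : L2Form Ω (p + 1)) w.2 := by
  have h1 : w.1 ∈ (dbar Ω p (p + 1)).domain := ⟨w, hw, rfl⟩
  have h2 := LinearPMap.adjoint_isFormalAdjoint (dense_dbar_domain hΩ p) u ⟨w.1, h1⟩
  rw [dbarGraph_unique hΩ (dbar_mem hΩ ⟨w.1, h1⟩) hw] at h2
  exact h2

/-- With `W¹₀` coefficients there is no boundary condition to check: the formal adjoint satisfies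
the adjoint identity against the whole maximal domain of `∂̄`. -/
theorem dbarStar_of_W10 (hΩ : IsOpen Ω) {p : ℕ} {u : L2Form Ω (p + 1)}
    {G : Finset (Fin n) → L2Grad Ω}
    (hG : ∀ J, (coeff u J, G J) ∈ (testGradGraph Ω).topologicalClosure) :
    ∃ h : u ∈ (dbarStar Ω p (p + 1)).domain, dbarStar Ω p (p + 1) ⟨u, h⟩ = thetaOf G p := by
  have key : ∀ x : (dbar Ω p (p + 1)).domain,
      inner ℂ (thetaOf G p) (x : L2Form Ω p) = inner ℂ u (dbar Ω p (p + 1) x) := fun x =>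
    inner_thetaOf (dbar_mem hΩ x) hG
  have h := LinearPMap.mem_adjoint_domain_of_exists u ⟨_, key⟩
  exact ⟨h, LinearPMap.adjoint_apply_eq (dense_dbar_domain hΩ p) ⟨u, h⟩ key⟩

end Dbar

/-! ### Variational eigenvalues of direct sums -/

section DirectSum

variable {H G : Type*} [NormedAddCommGroup H] [InnerProductSpace ℂ H]
  [NormedAddCommGroup G] [InnerProductSpace ℂ G] [CompleteSpace G]

/-- The form `‖A u‖²` on a finite-dimensional space is diagonal in some orthonormal basis. -/
theorem exists_diagonal_basis {F : Type*} [NormedAddCommGroup F] [InnerProductSpace ℂ F]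
    [FiniteDimensional ℂ F] (A : F →ₗ[ℂ] G) :
    ∃ (N : ℕ) (b : OrthonormalBasis (Fin N) ℂ F) (l : Fin N → ℝ),
      ∀ u, ‖A u‖ ^ 2 = ∑ i, l i * ‖b.repr u i‖ ^ 2 := by
  have : CompleteSpace F := FiniteDimensional.complete ℂ F
  let A' : F →L[ℂ] G := LinearMap.toContinuousLinearMap A
  let T : F →ₗ[ℂ] F := (ContinuousLinearMap.adjoint A' ∘L A').toLinearMap
  have hTA : ∀ u v, inner ℂ (T u) v = inner ℂ (A u) (A v) := fun u v =>
    ContinuousLinearMap.adjoint_inner_left A' v (A' u)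
  have hT : T.IsSymmetric := by
    intro u v
    rw [hTA, ← inner_conj_symm u (T v), hTA, inner_conj_symm]
  refine ⟨_, hT.eigenvectorBasis rfl, hT.eigenvalues rfl, fun u => ?_⟩
  have h1 : ((‖A u‖ ^ 2 : ℝ) : ℂ) = inner ℂ (T u) u := by
    rw [hTA, inner_self_eq_norm_sq_to_K]; norm_cast
  rw [← Complex.ofReal_inj, h1, ← (hT.eigenvectorBasis rfl).repr.inner_map_map, PiLp.inner_apply]
  push_cast
  refine Finset.sum_congr rfl fun i _ => ?_
  rw [hT.eigenvectorBasis_apply_self_apply, RCLike.inner_apply, map_mul]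
  simp only [Complex.coe_algebraMap, Complex.conj_ofReal]
  rw [mul_left_comm, Complex.mul_conj']

/-- If `∑ ‖A u_J‖² ≤ s ∑ ‖u_J‖²` on a subspace of dimension `k · m` of the `m`-fold direct sum,
then `‖A u‖² ≤ s ‖u‖²` on a subspace of dimension `k`. -/
theorem exists_subspace_of_directSum {ι : Type*} [Fintype ι] (D : Submodule ℂ H) (A : D →ₗ[ℂ] G)
    (S : Submodule ℂ (ι → D)) [FiniteDimensional ℂ S] {k : ℕ} (hι : 0 < Fintype.card ι)
    (hS : Module.finrank ℂ S = k * Fintype.card ι) {s : ℝ}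
    (hs : ∀ u ∈ S, ∑ J, ‖A (u J)‖ ^ 2 ≤ s * ∑ J, ‖(u J : H)‖ ^ 2) :
    ∃ L : Submodule ℂ D, Module.finrank ℂ L = k ∧ ∀ u ∈ L, ‖A u‖ ^ 2 ≤ s * ‖(u : H)‖ ^ 2 := by
  classical
  -- All components of elements of `S` live in this finite-dimensional space, on which the form can
  -- be diagonalised. The vectors of the required `L` are spanned by eigenvectors with `l i ≤ s`,
  -- provided there are at least `k` of them.
  let F : Submodule ℂ D := ⨆ J, S.map (LinearMap.proj J)
  have hF : ∀ u ∈ S, ∀ J, u J ∈ F := fun u hu J =>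
    Submodule.mem_iSup_of_mem J ⟨u, hu, rfl⟩
  have hFfin : FiniteDimensional ℂ F := Submodule.finiteDimensional_iSup _
  obtain ⟨N, b, l, hb⟩ := exists_diagonal_basis (F := F) (A ∘ₗ F.subtype)
  have hnorm : ∀ u : F, ‖((u : D) : H)‖ ^ 2 = ∑ i, ‖b.repr u i‖ ^ 2 := fun u => by
    change ‖u‖ ^ 2 = _
    rw [← b.repr.norm_map, EuclideanSpace.norm_sq_eq]
  let I : Finset (Fin N) := Finset.univ.filter fun i => l i ≤ s
  by_cases hk : k ≤ I.card
  · obtain ⟨I', hI', hcard⟩ := Finset.exists_subset_card_eq hk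
    let P : Submodule ℂ F := Submodule.span ℂ (Set.range fun i : I' => b i)
    refine ⟨P.map F.subtype, ?_, ?_⟩
    · rw [Submodule.finrank_map_subtype_eq, finrank_span_eq_card]
      · rw [Fintype.card_coe, hcard]
      · exact b.orthonormal.linearIndependent.comp _ Subtype.val_injective
    · rintro _ ⟨u, hu, rfl⟩
      have hz : ∀ i ∉ I', b.repr u i = 0 := by
        intro i hi
        have hle : P ≤ LinearMap.ker ((EuclideanSpace.proj i).toLinearMap ∘ₗ
            (b.repr.toLinearEquiv : F →ₗ[ℂ] EuclideanSpace ℂ (Fin N))) := by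
          rw [Submodule.span_le]
          rintro _ ⟨j, rfl⟩
          have hij : i ≠ j := fun h => hi (h ▸ j.2)
          simp [b.repr_self, hij]
        exact hle hu
      have h1 := hb u
      change ‖A u‖ ^ 2 ≤ s * ‖((u : D) : H)‖ ^ 2
      rw [hnorm, Finset.mul_sum]
      refine h1.trans_le (Finset.sum_le_sum fun i _ => ?_)
      by_cases hi : i ∈ I'
      · have := (Finset.mem_filter.1 (hI' hi)).2
        gcongr
      · rw [hz i hi]; simp
  · exfalso
    push Not at hk
    -- With fewer than `k` small eigenvalues, recording the corresponding coordinates of all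
    -- components cannot be injective on `S`. A nonzero kernel element uses only eigenvalues above
    -- `s`, so its energy strictly exceeds `s` times its squared norm.
    let Φ : S →ₗ[ℂ] (ι × I → ℂ) :=
      { toFun := fun u x => b.repr ⟨u.1 x.1, hF u.1 u.2 x.1⟩ x.2
        map_add' := fun u v => by
          ext x
          have : (⟨(u + v).1 x.1, hF _ (u + v).2 x.1⟩ : F)
            = ⟨u.1 x.1, hF u.1 u.2 x.1⟩ + ⟨v.1 x.1, hF v.1 v.2 x.1⟩ := rfl
          rw [this, map_add]; rfl
        map_smul' := fun c u => by
          ext x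
          have : (⟨(c • u).1 x.1, hF _ (c • u).2 x.1⟩ : F)
            = c • ⟨u.1 x.1, hF u.1 u.2 x.1⟩ := rfl
          rw [this, map_smul]; rfl }
    have hlt : Module.finrank ℂ (ι × I → ℂ) < Module.finrank ℂ S := by
      rw [hS, Module.finrank_fintype_fun_eq_card, Fintype.card_prod, Fintype.card_coe, mul_comm]
      exact Nat.mul_lt_mul_of_pos_right hk hι
    obtain ⟨u, hu, hu0⟩ := (Submodule.ne_bot_iff _).1 (LinearMap.ker_ne_bot_of_finrank_lt hlt)
    have hzero : ∀ J i, l i ≤ s → b.repr ⟨u.1 J, hF u.1 u.2 J⟩ i = 0 := by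
      intro J i hi
      have h : Φ u = 0 := LinearMap.mem_ker.1 hu
      have := congrFun h (J, ⟨i, Finset.mem_filter.2 ⟨Finset.mem_univ _, hi⟩⟩)
      exact this
    obtain ⟨J, hJ⟩ : ∃ J, u.1 J ≠ 0 := by
      by_contra! h
      exact hu0 (Subtype.ext (funext h))
    have hle : ∀ J i, s * ‖b.repr ⟨u.1 J, hF u.1 u.2 J⟩ i‖ ^ 2
        ≤ l i * ‖b.repr ⟨u.1 J, hF u.1 u.2 J⟩ i‖ ^ 2 := by
      intro J i
      by_cases hi : l i ≤ s
      · rw [hzero J i hi]; simp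
      · push Not at hi
        gcongr
    have hlt2 : ∑ J, s * ‖(u.1 J : H)‖ ^ 2 < ∑ J, ‖A (u.1 J)‖ ^ 2 := by
      have hexp : ∀ J, s * ‖(u.1 J : H)‖ ^ 2
          = ∑ i, s * ‖b.repr ⟨u.1 J, hF u.1 u.2 J⟩ i‖ ^ 2 := fun J => by
        rw [← Finset.mul_sum, ← hnorm]
      have hexp2 : ∀ J, ‖A (u.1 J)‖ ^ 2
          = ∑ i, l i * ‖b.repr ⟨u.1 J, hF u.1 u.2 J⟩ i‖ ^ 2 := fun J => hb ⟨u.1 J, hF u.1 u.2 J⟩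
      refine Finset.sum_lt_sum (fun J _ => ?_) ⟨J, Finset.mem_univ _, ?_⟩
      · rw [hexp, hexp2]
        exact Finset.sum_le_sum fun i _ => hle J i
      · rw [hexp, hexp2]
        obtain ⟨i, hi⟩ : ∃ i, b.repr ⟨u.1 J, hF u.1 u.2 J⟩ i ≠ 0 := by
          by_contra! h
          apply hJ
          have h0 : b.repr ⟨u.1 J, hF u.1 u.2 J⟩ = 0 := by ext i; exact h i
          have := (map_eq_zero_iff _ b.repr.injective).1 h0
          exact congrArg Subtype.val this
        refine Finset.sum_lt_sum (fun i _ => hle J i) ⟨i, Finset.mem_univ _, ?_⟩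
        have hsl : s < l i := by
          by_contra! h
          exact hi (hzero J i h)
        have := norm_pos_iff.2 hi
        gcongr
    rw [← Finset.mul_sum] at hlt2
    exact absurd (hs u.1 u.2) (not_le.2 hlt2)

/-- Clearing the denominator in a finite supremum of Rayleigh quotients gives a real quadratic
inequality, which also covers `u = 0`. -/
theorem le_toReal_mul_of_iSup {Q : SesqForm H} {L : Submodule ℂ Q.domain}
    (hfin : (⨆ (u : Q.domain) (_ : u ∈ L ∧ u ≠ 0),
      ENNReal.ofReal ((Q.form u u).re / ‖(u : H)‖ ^ 2)) ≠ ⊤) (u : Q.domain) (hu : u ∈ L) :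
    (Q.form u u).re ≤ (⨆ (u : Q.domain) (_ : u ∈ L ∧ u ≠ 0),
      ENNReal.ofReal ((Q.form u u).re / ‖(u : H)‖ ^ 2)).toReal * ‖(u : H)‖ ^ 2 := by
  by_cases h0 : u = 0
  · rw [h0]; simp
  · have h1 := le_iSup₂_of_le (f := fun (u : Q.domain) (_ : u ∈ L ∧ u ≠ 0) =>
      ENNReal.ofReal ((Q.form u u).re / ‖(u : H)‖ ^ 2)) u ⟨hu, h0⟩ le_rfl
    have h2 := (ENNReal.ofReal_le_iff_le_toReal hfin).1 h1
    have h3 : (u : H) ≠ 0 := by simpa using h0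
    have := norm_pos_iff.2 h3
    rwa [div_le_iff₀ (by positivity)] at h2

theorem iSup_le_ofReal {Q : SesqForm H} {L : Submodule ℂ Q.domain} {s : ℝ}
    (h : ∀ u ∈ L, (Q.form u u).re ≤ s * ‖(u : H)‖ ^ 2) :
    (⨆ (u : Q.domain) (_ : u ∈ L ∧ u ≠ 0),
      ENNReal.ofReal ((Q.form u u).re / ‖(u : H)‖ ^ 2)) ≤ ENNReal.ofReal s := by
  refine iSup₂_le fun u hu => ENNReal.ofReal_le_ofReal ?_
  have h3 : (u : H) ≠ 0 := by simpa using hu.2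
  have := norm_pos_iff.2 h3
  rw [div_le_iff₀ (by positivity)]
  exact h u hu.1

/-- Variational eigenvalues decrease when the form domain grows and the form decreases. -/
theorem SesqForm.varEigenvalue_mono {Q Q' : SesqForm H} (h : Q'.domain ≤ Q.domain)
    (hle : ∀ u : Q'.domain, (Q.form (Submodule.inclusion h u) (Submodule.inclusion h u)).re
      ≤ (Q'.form u u).re) (k : ℕ) : Q.varEigenvalue k ≤ Q'.varEigenvalue k := by
  refine le_iInf₂ fun L hL => ?_
  refine iInf₂_le_of_le (L.map (Submodule.inclusion h)) ?_ ?_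
  · rw [← hL]
    exact (Submodule.equivMapOfInjective _ (Submodule.inclusion_injective h) L).finrank_eq.symm
  · refine iSup₂_le ?_
    rintro _ ⟨⟨u, hu, rfl⟩, hu0⟩
    refine le_iSup₂_of_le u ⟨hu, fun h0 => hu0 (by rw [h0, map_zero])⟩ ?_
    refine ENNReal.ofReal_le_ofReal ?_
    have := hle u
    simp only [Submodule.coe_inclusion]
    gcongr

end DirectSum

/-! ### Comparison of the variational eigenvalues -/

section Comparison

variable {n : ℕ} {Ω : Set (Fin n → ℂ)}

theorem inner_gradHol {p p' : L2 Ω × L2Grad Ω}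
    (hp : p ∈ (testGradGraph Ω).topologicalClosure)
    (hp' : p' ∈ (testGradGraph Ω).topologicalClosure) (j k : Fin n) :
    inner ℂ (gradHol p.2 j) (gradHol p'.2 k) = inner ℂ (gradBar p.2 k) (gradBar p'.2 j) := by
  have h := inner_testGrad_comm hp hp'
  simp only [gradHol, gradBar, inner_smul_left, inner_smul_right, inner_add_left, inner_add_right,
    inner_sub_left, inner_sub_right, Complex.conj_I]
  rw [h (j, 0) (k, 0), h (j, 0) (k, 1), h (j, 1) (k, 0), h (j, 1) (k, 1)]
  ring

/-- In `|∂_x u + i ∂_y u|²` the mixed terms carry opposite factors `i` and `-i` and cancel after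
`inner_testGrad_comm`; the `1/4` is the square of the `1/2` in `∂/∂z̄`. -/
theorem sum_norm_gradBar {p : L2 Ω × L2Grad Ω} (hp : p ∈ (testGradGraph Ω).topologicalClosure) :
    ∑ j, ‖gradBar p.2 j‖ ^ 2 = 1 / 4 * ‖p.2‖ ^ 2 := by
  have hj : ∀ j, ‖gradBar p.2 j‖ ^ 2 = 1 / 4 * (‖p.2 (j, 0)‖ ^ 2 + ‖p.2 (j, 1)‖ ^ 2) := by
    intro j
    have h := inner_testGrad_comm hp hp (j, 0) (j, 1)
    have hsq : ∀ x : L2 Ω, ((‖x‖ ^ 2 : ℝ) : ℂ) = inner ℂ x x := fun x => by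
      rw [inner_self_eq_norm_sq_to_K]; norm_cast
    rw [← Complex.ofReal_inj]
    push_cast
    simp only [← Complex.ofReal_pow, hsq]
    simp only [gradBar, inner_smul_left, inner_smul_right, inner_add_left, inner_add_right,
      Complex.conj_I]
    rw [h]
    simp only [map_div₀, map_one, map_ofNat]
    linear_combination (-(1 / 4) * inner ℂ (p.2 (j, 1)) (p.2 (j, 1))) * Complex.I_mul_I
  rw [PiLp.norm_sq_eq_of_L2, Fintype.sum_prod_type, Finset.mul_sum]
  refine Finset.sum_congr rfl fun j _ => ?_
  rw [hj, Fin.sum_univ_two]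

/-- On forms with coefficients in `W¹₀(Ω)`, the form `Q_q` is a quarter of the gradient form. -/
theorem norm_dbar_add_norm_theta {p : ℕ} {u : L2Form Ω (p + 1)} {G : Finset (Fin n) → L2Grad Ω}
    (hG : ∀ J, (coeff u J, G J) ∈ (testGradGraph Ω).topologicalClosure) :
    ‖(WithLp.toLp 2 fun L : {L : Finset (Fin n) // L.card = p + 2} =>
      ∑ j ∈ L.1, wedgeSign j L.1 • gradBar (G (L.1.erase j)) j : L2Form Ω (p + 2))‖ ^ 2
      + ‖thetaOf G p‖ ^ 2
      = 1 / 4 * ∑ J : {J : Finset (Fin n) // J.card = p + 1}, ‖G J.1‖ ^ 2 := by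
  have h := sum_norm_wedge (fun j J => gradBar (G J) j) (fun j J => gradHol (G J) j)
    (fun j k A B => inner_gradHol (hG A) (hG B) j k) p
  beta_reduce at h
  rw [PiLp.norm_sq_eq_of_L2, PiLp.norm_sq_eq_of_L2]
  simp only [thetaOf, norm_neg]
  rw [sum_subtype_card (p + 2)
      (fun L => ‖∑ j ∈ L, wedgeSign j L • gradBar (G (L.erase j)) j‖ ^ 2),
    sum_subtype_card p
      (fun K => ‖∑ j ∈ Kᶜ, wedgeSign j (insert j K) • gradHol (G (insert j K)) j‖ ^ 2),
    h, sum_subtype_card (p + 1) (fun J => ‖G J‖ ^ 2), Finset.mul_sum]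
  have h3 : ∀ J, ∑ j, ‖gradBar (G J) j‖ ^ 2 = 1 / 4 * ‖G J‖ ^ 2 := fun J =>
    sum_norm_gradBar (p := (coeff u J, G J)) (hG J)
  exact Finset.sum_congr rfl fun J _ => h3 J

theorem add_smul_sum_apply {D ι : Type*} [AddCommGroup D] [Module ℂ D] [Fintype ι]
    (a : D →ₗ⋆[ℂ] D →ₗ[ℂ] ℂ) (c : ι → D →ₗ⋆[ℂ] D →ₗ[ℂ] ℂ) (t : ℂ) (u v : D) :
    (a + t • ∑ J, c J) u v = a u v + t * ∑ J, c J u v := by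
  simp [LinearMap.sum_apply]

theorem kohnNirenbergForm_self_re (t : ℝ) (q : ℕ) (u : (kohnNirenbergForm Ω t q).domain) :
    ((kohnNirenbergForm Ω t q).form u u).re
      = ‖dbar Ω q (q + 1) ⟨u, W1Form_le_dbar_domain Ω q u.2.1⟩‖ ^ 2
        + ‖dbarStar Ω (q - 1) q ⟨u, u.2.2⟩‖ ^ 2
        + t * ∑ J, ‖weakGrad Ω ⟨u.1 J, u.2.1 J⟩‖ ^ 2 := by
  have h1 : (kohnNirenbergForm Ω t q).form u u
      = inner ℂ (dbar Ω q (q + 1) ⟨u, W1Form_le_dbar_domain Ω q u.2.1⟩)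
          (dbar Ω q (q + 1) ⟨u, W1Form_le_dbar_domain Ω q u.2.1⟩)
        + inner ℂ (dbarStar Ω (q - 1) q ⟨u, u.2.2⟩) (dbarStar Ω (q - 1) q ⟨u, u.2.2⟩)
        + (t : ℂ) * ∑ J, inner ℂ (weakGrad Ω ⟨u.1 J, u.2.1 J⟩) (weakGrad Ω ⟨u.1 J, u.2.1 J⟩) :=
    add_smul_sum_apply _ _ _ _ _
  have h2 : (kohnNirenbergForm Ω t q).form u u
      = ((‖dbar Ω q (q + 1) ⟨u, W1Form_le_dbar_domain Ω q u.2.1⟩‖ ^ 2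
        + ‖dbarStar Ω (q - 1) q ⟨u, u.2.2⟩‖ ^ 2
        + t * ∑ J, ‖weakGrad Ω ⟨u.1 J, u.2.1 J⟩‖ ^ 2 : ℝ) : ℂ) := by
    rw [h1]
    simp only [inner_self_eq_norm_sq_to_K]
    push_cast
    rfl
  rw [h2, Complex.ofReal_re]

theorem dbarNeumannForm_self_re (q : ℕ) (u : (dbarNeumannForm Ω q).domain) :
    ((dbarNeumannForm Ω q).form u u).re
      = ‖dbar Ω q (q + 1) ⟨u, u.2.1⟩‖ ^ 2 + ‖dbarStar Ω (q - 1) q ⟨u, u.2.2⟩‖ ^ 2 := by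
  have h1 : (dbarNeumannForm Ω q).form u u
      = inner ℂ (dbar Ω q (q + 1) ⟨u, u.2.1⟩) (dbar Ω q (q + 1) ⟨u, u.2.1⟩)
        + inner ℂ (dbarStar Ω (q - 1) q ⟨u, u.2.2⟩) (dbarStar Ω (q - 1) q ⟨u, u.2.2⟩) := rfl
  rw [h1]
  simp only [inner_self_eq_norm_sq_to_K]
  norm_cast

theorem neumannForm_self_re (u : (neumannForm Ω).domain) :
    ((neumannForm Ω).form u u).re = ‖weakGrad Ω u‖ ^ 2 :=
  gramForm_self_re _ _

theorem dirichletForm_self_re (u : (dirichletForm Ω).domain) :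
    ((dirichletForm Ω).form u u).re = ‖weakGrad Ω ⟨u, u.2.1⟩‖ ^ 2 :=
  gramForm_self_re _ _

theorem varEigenvalue_dbarNeumann_le {t : ℝ} (ht : 0 < t) (q k : ℕ) :
    (dbarNeumannForm Ω q).varEigenvalue k ≤ (kohnNirenbergForm Ω t q).varEigenvalue k := by
  refine SesqForm.varEigenvalue_mono
    (inf_le_inf_right _ (W1Form_le_dbar_domain Ω q)) (fun u => ?_) k
  rw [kohnNirenbergForm_self_re, dbarNeumannForm_self_re]
  exact le_add_of_nonneg_right (by positivity)

theorem card_multiIndex (q : ℕ) :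
    Fintype.card {J : Finset (Fin n) // J.card = q} = n.choose q := by
  rw [Fintype.card_finset_len, Fintype.card_fin]

theorem norm_sq_L2Form {q : ℕ} (u : L2Form Ω q) : ‖u‖ ^ 2 = ∑ J, ‖u J‖ ^ 2 :=
  PiLp.norm_sq_eq_of_L2 _ u

/-- Reading off coefficients embeds a trial space into a direct sum of copies of `W¹(Ω)`. The
gradient term alone bounds the Neumann energy there by `s / t`, and the direct sum lemma extracts a
`k`-dimensional space of functions. -/
theorem mul_varEigenvalue_neumann_le {t : ℝ} (ht : 0 < t) {q k : ℕ} (hk : 1 ≤ k) (hqn : q ≤ n) :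
    ENNReal.ofReal t * (neumannForm Ω).varEigenvalue k
      ≤ (kohnNirenbergForm Ω t q).varEigenvalue (k * n.choose q) := by
  have hch : 0 < n.choose q := Nat.choose_pos hqn
  refine le_iInf₂ fun L hL => ?_
  by_cases hfin : (⨆ (u : (kohnNirenbergForm Ω t q).domain) (_ : u ∈ L ∧ u ≠ 0),
      ENNReal.ofReal (((kohnNirenbergForm Ω t q).form u u).re / ‖(u : L2Form Ω q)‖ ^ 2)) = ⊤
  · rw [hfin]; exact le_top
  set s := (⨆ (u : (kohnNirenbergForm Ω t q).domain) (_ : u ∈ L ∧ u ≠ 0),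
      ENNReal.ofReal (((kohnNirenbergForm Ω t q).form u u).re / ‖(u : L2Form Ω q)‖ ^ 2)) with hs
  let Φ : (kohnNirenbergForm Ω t q).domain →ₗ[ℂ]
      ({J : Finset (Fin n) // J.card = q} → W1 Ω) :=
    LinearMap.pi fun J => W1Form.coeff Ω J ∘ₗ Submodule.inclusion inf_le_left
  have hΦ : ∀ u J, ((Φ u J : W1 Ω) : L2 Ω) = (u : L2Form Ω q) J := fun u J => rfl
  have hinj : Function.Injective Φ := by
    intro u v huv
    apply Subtype.ext
    ext1 J
    rw [← hΦ, ← hΦ, huv]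
  have hfd : FiniteDimensional ℂ L := FiniteDimensional.of_finrank_pos (by
    rw [hL]; positivity)
  have hrank : Module.finrank ℂ (L.map Φ)
      = k * Fintype.card {J : Finset (Fin n) // J.card = q} := by
    rw [← (Submodule.equivMapOfInjective Φ hinj L).finrank_eq, hL, card_multiIndex]
  obtain ⟨L', hL', h⟩ := exists_subspace_of_directSum (W1 Ω) (weakGrad Ω).toFun (L.map Φ)
    (by rw [card_multiIndex]; exact hch) hrank (s := s.toReal / t) (by
      rintro _ ⟨u, hu, rfl⟩
      have h1 := le_toReal_mul_of_iSup hfin u hu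
      rw [kohnNirenbergForm_self_re, norm_sq_L2Form (u : L2Form Ω q)] at h1
      rw [div_mul_eq_mul_div, le_div_iff₀ ht, mul_comm]
      exact le_trans (le_add_of_nonneg_left (add_nonneg (sq_nonneg _) (sq_nonneg _))) h1)
  calc ENNReal.ofReal t * (neumannForm Ω).varEigenvalue k
      ≤ ENNReal.ofReal t * ENNReal.ofReal (s.toReal / t) := by
        gcongr
        refine iInf₂_le_of_le L' hL' (iSup_le_ofReal fun u hu => ?_)
        rw [neumannForm_self_re]
        exact h u hu
    _ = s := by
        rw [← ENNReal.ofReal_mul ht.le, mul_div_cancel₀ _ ht.ne', ENNReal.ofReal_toReal hfin]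

theorem weakGrad_eq (hΩ : IsOpen Ω) {g : L2 Ω} (hg : g ∈ W1 Ω) {G : L2Grad Ω}
    (h : (g, G) ∈ weakGradGraph Ω) : weakGrad Ω ⟨g, hg⟩ = G :=
  weakGradGraph_unique hΩ (weakGrad_mem hΩ ⟨g, hg⟩) h

theorem dbar_eq (hΩ : IsOpen Ω) {p q : ℕ} {u : L2Form Ω p} (hu : u ∈ (dbar Ω p q).domain)
    {f : L2Form Ω q} (h : (u, f) ∈ dbarGraph Ω p q) : dbar Ω p q ⟨u, hu⟩ = f :=
  dbarGraph_unique hΩ (dbar_mem hΩ ⟨u, hu⟩) h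

theorem kohnNirenbergForm_of_W10 (hΩ : IsOpen Ω) (t : ℝ) {p : ℕ} {u : L2Form Ω (p + 1)}
    (hu : ∀ J, u J ∈ W10 Ω) :
    ∃ h : u ∈ (kohnNirenbergForm Ω t (p + 1)).domain,
      ((kohnNirenbergForm Ω t (p + 1)).form ⟨u, h⟩ ⟨u, h⟩).re
        = (1 / 4 + t) * ∑ J, ‖weakGrad Ω ⟨u J, (hu J).1⟩‖ ^ 2 := by
  obtain ⟨G, hG⟩ := exists_closure_grad hu
  obtain ⟨hdom, hstar⟩ := dbarStar_of_W10 hΩ hG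
  refine ⟨⟨fun J => (hu J).1, hdom⟩, ?_⟩
  have hG' : ∀ J : {J : Finset (Fin n) // J.card = p + 1},
      weakGrad Ω ⟨u J, (hu J).1⟩ = G J.1 := fun J => by
    refine weakGrad_eq hΩ _ ?_
    have := closure_testGradGraph_le (hG J.1)
    rwa [coeff_coe] at this
  rw [kohnNirenbergForm_self_re]
  simp only [hG']
  have h1 := dbar_eq hΩ (W1Form_le_dbar_domain Ω (p + 1) fun J => (hu J).1)
    (dbarGraph_of_grad (fun J => closure_testGradGraph_le (hG J)) (p + 1 + 1))
  have h2 := norm_dbar_add_norm_theta hG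
  rw [h1]
  change _ + ‖dbarStar Ω p (p + 1) ⟨u, hdom⟩‖ ^ 2 + _ = _
  rw [hstar, h2]
  ring

/-- Letting every coefficient range independently over a Dirichlet trial space `L` of dimension `k`
gives a space of forms of dimension `k` times the number of multi-indices, with the Rayleigh bound
scaled by `1/4 + t`. -/
theorem varEigenvalue_le_mul_dirichlet (hΩ : IsOpen Ω) {t : ℝ} (ht : 0 < t) {p k : ℕ}
    (hk : 1 ≤ k) :
    (kohnNirenbergForm Ω t (p + 1)).varEigenvalue (k * n.choose (p + 1))
      ≤ ENNReal.ofReal (1 / 4 + t) * (dirichletForm Ω).varEigenvalue k := by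
  have hc : 0 < 1 / 4 + t := by positivity
  have hc0 : ENNReal.ofReal (1 / 4 + t) ≠ 0 := by simpa using hc
  rw [← ENNReal.div_le_iff' hc0 ENNReal.ofReal_ne_top]
  refine le_iInf₂ fun L hL => ?_
  rw [ENNReal.div_le_iff' hc0 ENNReal.ofReal_ne_top]
  by_cases hfin : (⨆ (u : (dirichletForm Ω).domain) (_ : u ∈ L ∧ u ≠ 0),
      ENNReal.ofReal (((dirichletForm Ω).form u u).re / ‖(u : L2 Ω)‖ ^ 2)) = ⊤
  · rw [hfin, ENNReal.mul_top hc0]; exact le_top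
  set s := (⨆ (u : (dirichletForm Ω).domain) (_ : u ∈ L ∧ u ≠ 0),
      ENNReal.ofReal (((dirichletForm Ω).form u u).re / ‖(u : L2 Ω)‖ ^ 2)) with hs
  have hdom : ∀ x : {J : Finset (Fin n) // J.card = p + 1} → L,
      (WithLp.toLp 2 fun J => ((x J : (dirichletForm Ω).domain) : L2 Ω) : L2Form Ω (p + 1))
        ∈ (kohnNirenbergForm Ω t (p + 1)).domain := fun x =>
    (kohnNirenbergForm_of_W10 (p := p) hΩ t
      (u := WithLp.toLp 2 fun J => ((x J : (dirichletForm Ω).domain) : L2 Ω))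
      fun J => (x J : (dirichletForm Ω).domain).2).1
  let Ψ : ({J : Finset (Fin n) // J.card = p + 1} → L) →ₗ[ℂ]
      (kohnNirenbergForm Ω t (p + 1)).domain :=
    { toFun := fun x => ⟨_, hdom x⟩
      map_add' := fun x y => rfl
      map_smul' := fun c x => rfl }
  have hinj : Function.Injective Ψ := by
    intro x y hxy
    have h1 := congrArg (fun w : (kohnNirenbergForm Ω t (p + 1)).domain => w.1) hxy
    funext J
    exact Subtype.ext (Subtype.ext (congrArg (fun w : L2Form Ω (p + 1) => w J) h1))
  have hfd : FiniteDimensional ℂ L := FiniteDimensional.of_finrank_pos (by omega)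
  refine iInf₂_le_of_le (LinearMap.range Ψ) ?_ ?_
  · rw [LinearMap.finrank_range_of_inj hinj, Module.finrank_pi_fintype, Finset.sum_const, hL,
      Finset.card_univ, card_multiIndex, smul_eq_mul, mul_comm]
  · rw [← ENNReal.ofReal_toReal hfin, ← ENNReal.ofReal_mul hc.le]
    refine iSup_le_ofReal ?_
    rintro _ ⟨x, rfl⟩
    obtain ⟨h, hval⟩ := kohnNirenbergForm_of_W10 (p := p) hΩ t
      (u := WithLp.toLp 2 fun J => ((x J : (dirichletForm Ω).domain) : L2 Ω))
      fun J => (x J : (dirichletForm Ω).domain).2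
    change ((kohnNirenbergForm Ω t (p + 1)).form ⟨_, h⟩ ⟨_, h⟩).re ≤ _
    rw [hval, mul_assoc]
    change _ ≤ (1 / 4 + t) * (s.toReal * ‖(WithLp.toLp 2 fun J =>
      ((x J : (dirichletForm Ω).domain) : L2 Ω) : L2Form Ω (p + 1))‖ ^ 2)
    rw [norm_sq_L2Form, Finset.mul_sum (a := s.toReal)]
    gcongr with J
    have := le_toReal_mul_of_iSup hfin (x J) (x J).2
    rwa [dirichletForm_self_re] at this

end Comparison

/-! ### Coercivity -/

section Coercive

variable {n : ℕ} {Ω : Set (Fin n → ℂ)} {φ ψ : (Fin n → ℂ) → ℂ}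

theorem realDir_apply (k : Fin n × Fin 2) (j : Fin n) :
    realDir k j = if k.1 = j then (if k.2 = 0 then 1 else Complex.I) else 0 := by
  rw [realDir, Pi.single_apply]
  simp only [eq_comm]

/-- Multiplication by `z̄_j` on `L²(Ω)` for a bounded set `Ω`. -/
theorem exists_mulConj (hΩ : IsOpen Ω) {R : ℝ} (hR : ∀ z ∈ Ω, ‖z‖ ≤ R) (j : Fin n) (g : L2 Ω) :
    ∃ g' : L2 Ω, ‖g'‖ ≤ R * ‖g‖ ∧
      ∀ ψ, pair g' ψ = pair g (fun z => starRingEnd ℂ (z j) * ψ z) := by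
  have hbd : ∀ᵐ z ∂(volume.restrict Ω), ‖starRingEnd ℂ (z j) * g z‖ ≤ R * ‖g z‖ := by
    filter_upwards [ae_restrict_mem hΩ.measurableSet] with z hz
    rw [norm_mul, RCLike.norm_conj]
    gcongr
    exact (norm_le_pi_norm z j).trans (hR z hz)
  have hmeas : AEStronglyMeasurable (fun z => starRingEnd ℂ (z j) * g z) (volume.restrict Ω) :=
    (Complex.continuous_conj.comp (continuous_apply j)).aestronglyMeasurable.mul
      (Lp.aestronglyMeasurable g)
  have hmem : MemLp (fun z => starRingEnd ℂ (z j) * g z) 2 (volume.restrict Ω) :=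
    (Lp.memLp g).of_le_mul hmeas hbd
  refine ⟨hmem.toLp, ?_, fun ψ => ?_⟩
  · refine Lp.norm_le_mul_norm_of_ae_le_mul ?_
    filter_upwards [hmem.coeFn_toLp, hbd] with z h1 h2
    rwa [h1]
  · refine integral_congr_ae ?_
    filter_upwards [hmem.coeFn_toLp] with z h1
    rw [h1]; ring

theorem IsTest.conj_mul (hφ : IsTest Ω φ) (j : Fin n) :
    IsTest Ω (fun z => starRingEnd ℂ (z j) * φ z) := by
  refine ⟨?_, hφ.2.1.mul_left, (closure_mono ?_).trans hφ.2.2⟩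
  · exact (Complex.conjCLE.contDiff.comp (contDiff_apply ℝ ℂ j)).mul hφ.1
  · exact Function.support_mul_subset_right _ _

theorem IsTest.realPartial_conj_mul (hφ : IsTest Ω φ) (j : Fin n) (k : Fin n × Fin 2)
    (z : Fin n → ℂ) :
    KohnNirenberg.realPartial k (fun z => starRingEnd ℂ (z j) * φ z) z
      = starRingEnd ℂ (z j) * KohnNirenberg.realPartial k φ z
        + starRingEnd ℂ (realDir k j) * φ z := by
  have h1 : HasFDerivAt (fun z : Fin n → ℂ => starRingEnd ℂ (z j))
      (Complex.conjCLE.toContinuousLinearMap ∘L ContinuousLinearMap.proj (R := ℝ) j) z :=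
    (Complex.conjCLE.toContinuousLinearMap ∘L
      ContinuousLinearMap.proj (R := ℝ) (φ := fun _ : Fin n => ℂ) j).hasFDerivAt
  have h2 := h1.mul (hφ.differentiable z).hasFDerivAt
  have h3 : fderiv ℝ (fun z => starRingEnd ℂ (z j) * φ z) z = _ := h2.fderiv
  rw [KohnNirenberg.realPartial, h3]
  simp [KohnNirenberg.realPartial, mul_comm]

theorem IsTest.dzbar_conj_mul (hφ : IsTest Ω φ) (j k : Fin n) (z : Fin n → ℂ) :
    dzbar k (fun z => starRingEnd ℂ (z j) * φ z) z
      = starRingEnd ℂ (z j) * dzbar k φ z + (if k = j then 1 else 0) * φ z := by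
  rw [dzbar, dzbar, hφ.realPartial_conj_mul, hφ.realPartial_conj_mul, realDir_apply, realDir_apply]
  by_cases h : k = j
  · simp only [h, if_true, map_one, one_ne_zero, if_false, Complex.conj_I]
    linear_combination (-(1 / 2) * φ z) * Complex.I_mul_I
  · simp only [h, if_false, map_zero]
    ring

/-- The `∂/∂z̄_k` derivative of `z̄_j g`. -/
theorem pair_mulConj_dzbar {g g' : L2 Ω} {G : L2Grad Ω} (h : (g, G) ∈ weakGradGraph Ω) (j : Fin n)
    (hg' : ∀ ψ, pair g' ψ = pair g (fun z => starRingEnd ℂ (z j) * ψ z)) (k : Fin n) {d : L2 Ω}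
    (hd : ∀ ψ, pair d ψ = pair (gradBar G k) (fun z => starRingEnd ℂ (z j) * ψ z))
    (hφ : IsTest Ω φ) :
    pair g' (dzbar k φ) = - pair (d + (if k = j then 1 else 0 : ℂ) • g) φ := by
  have h1 := pair_dzbar Ω h (hφ.conj_mul j) k
  have h2 : pair g (dzbar k fun z => starRingEnd ℂ (z j) * φ z)
      = pair g (fun z => starRingEnd ℂ (z j) * dzbar k φ z)
        + (if k = j then 1 else 0) * pair g φ := by
    have hm : MemLp (fun z => starRingEnd ℂ (z j) * dzbar k φ z) 2 (volume.restrict Ω) := by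
      have h3 : MemLp (fun z => (if k = j then 1 else 0 : ℂ) * φ z) 2 (volume.restrict Ω) :=
        hφ.memLp.const_mul _
      have h4 := ((hφ.conj_mul j).dzbar_memLp k).sub h3
      refine h4.congr_norm ?_ ?_
      · refine h4.1.congr (Eventually.of_forall fun z => ?_)
        simp [hφ.dzbar_conj_mul]
      · refine Eventually.of_forall fun z => ?_
        simp [hφ.dzbar_conj_mul]
    unfold pair
    rw [← integral_const_mul, ← integral_add (integrable_pair g hm)
      ((integrable_pair g hφ.memLp).const_mul _)]
    refine integral_congr_ae (Eventually.of_forall fun z => ?_)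
    simp only [hφ.dzbar_conj_mul]
    ring
  rw [pair_add _ _ hφ.memLp, pair_smul, hg', hd]
  rw [h2] at h1
  change _ = - pair (gradBar G k) _ at h1
  linear_combination h1

theorem norm_gradBar_le (G : L2Grad Ω) (j : Fin n) : ‖gradBar G j‖ ≤ ‖G‖ := by
  have h : ∀ i, ‖G i‖ ≤ ‖G‖ := fun i => PiLp.norm_apply_le G i
  calc ‖gradBar G j‖ ≤ 1 / 2 * (‖G (j, 0)‖ + ‖G (j, 1)‖) := by
        rw [gradBar, norm_smul]
        gcongr
        · simp
        · refine (norm_add_le _ _).trans ?_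
          rw [norm_smul, Complex.norm_I, one_mul]
    _ ≤ ‖G‖ := by linarith [h (j, 0), h (j, 1)]

/-- Each coefficient of a form in the domain of `∂̄*` is controlled by `∂̄*u` and its gradient. -/
theorem norm_sq_coeff_le (hΩ : IsOpen Ω) {R : ℝ} (hR0 : 0 ≤ R) (hR : ∀ z ∈ Ω, ‖z‖ ≤ R) {p : ℕ}
    (u : (dbarStar Ω p (p + 1)).domain) (J : {J : Finset (Fin n) // J.card = p + 1})
    {G : L2Grad Ω} (hG : (u.1 J, G) ∈ weakGradGraph Ω) :
    ‖u.1 J‖ ^ 2 ≤ R * ‖(u : L2Form Ω (p + 1))‖ * (‖dbarStar Ω p (p + 1) u‖ + n * ‖G‖) := by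
  classical
  obtain ⟨j₀, hj₀⟩ : J.1.Nonempty := Finset.card_pos.1 (by rw [J.2]; omega)
  obtain ⟨g', hg'n, hg'⟩ := exists_mulConj hΩ hR j₀ (u.1 J)
  choose d hdn hd using fun k => exists_mulConj hΩ hR j₀ (gradBar G k)
  set K₀ := J.1.erase j₀ with hK₀
  have hK₀c : K₀.card = p := by rw [hK₀, Finset.card_erase_of_mem hj₀, J.2]; rfl
  -- The multiplier form `v = z̄_{j₀} u_J dz̄_{K₀}`, and below `f = ∂̄v`. Differentiating `z̄_{j₀}`
  -- produces the undifferentiated `u_J` in the term `j = j₀` of `e`.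
  let v : L2Form Ω p := WithLp.toLp 2 fun K => if K.1 = K₀ then g' else 0
  let e : Fin n → L2 Ω := fun k => d k + (if k = j₀ then 1 else 0 : ℂ) • u.1 J
  let f : L2Form Ω (p + 1) := WithLp.toLp 2 fun L =>
    ∑ j ∈ L.1, if L.1.erase j = K₀ then wedgeSign j L.1 • e j else 0
  have hcv : ∀ K : Finset (Fin n), coeff v K = if K = K₀ then g' else 0 := by
    intro K
    by_cases hK : K.card = p
    · rw [coeff, dif_pos hK]
    · rw [coeff, dif_neg hK, if_neg]
      rintro rfl
      exact hK hK₀c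
  have hvf : (v, f) ∈ dbarGraph Ω p (p + 1) := by
    intro L φ hφ
    simp only [f, hcv]
    rw [pair_sum Ω _ _ hφ.memLp, ← Finset.sum_neg_distrib]
    refine Finset.sum_congr rfl fun j _ => ?_
    split_ifs with h
    · rw [pair_mulConj_dzbar hG j₀ hg' j (hd j) hφ, pair_smul, mul_neg]
    · rw [pair_zero, pair_zero, mul_zero, neg_zero]
  have hvn : ‖v‖ = ‖g'‖ := by
    have : ‖v‖ ^ 2 = ‖g'‖ ^ 2 := by
      rw [norm_sq_L2Form, Finset.sum_eq_single ⟨K₀, hK₀c⟩]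
      · simp [v]
      · intro K _ hK
        have : K.1 ≠ K₀ := fun h => hK (Subtype.ext h)
        simp [v, this]
      · simp
    exact (sq_eq_sq₀ (norm_nonneg _) (norm_nonneg _)).1 this
  have hfu : inner ℂ u.1 f
      = ∑ j ∈ K₀ᶜ, wedgeSign j (insert j K₀) * inner ℂ (coeff u.1 (insert j K₀)) (e j) := by
    rw [PiLp.inner_apply]
    have h1 : ∀ L : {L : Finset (Fin n) // L.card = p + 1}, inner ℂ (u.1 L) (f L)
        = ∑ j ∈ L.1, if L.1.erase j = K₀ then
          wedgeSign j L.1 * inner ℂ (coeff u.1 L.1) (e j) else 0 := by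
      intro L
      rw [coeff_coe]
      simp only [f, inner_sum]
      refine Finset.sum_congr rfl fun j _ => ?_
      split_ifs
      · rw [inner_smul_right]
      · rw [inner_zero_right]
    simp only [h1]
    rw [sum_subtype_card (p + 1) (fun L => ∑ j ∈ L, if L.erase j = K₀ then
          wedgeSign j L * inner ℂ (coeff u.1 L) (e j) else 0),
      sum_mem_eq_sum_compl p (fun j L => if L.erase j = K₀ then
          wedgeSign j L * inner ℂ (coeff u.1 L) (e j) else 0),
      Finset.sum_eq_single K₀]
    · refine Finset.sum_congr rfl fun j hj => ?_
      rw [if_pos (Finset.erase_insert (Finset.mem_compl.1 hj))]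
    · intro A _ hA
      refine Finset.sum_eq_zero fun j hj => ?_
      rw [if_neg]
      rwa [Finset.erase_insert (Finset.mem_compl.1 hj)]
    · intro h
      exact absurd (Finset.mem_powersetCard_univ.2 hK₀c) h
  have hins : insert j₀ K₀ = J.1 := Finset.insert_erase hj₀
  -- Only sets `L = K₀ ∪ {j}` contribute. The one with `j = j₀` is `J` itself, which isolates
  -- `‖u_J‖²` up to sign.
  have hsplit : inner ℂ u.1 f = wedgeSign j₀ J.1 * inner ℂ (u.1 J) (u.1 J)
      + ∑ j ∈ K₀ᶜ, wedgeSign j (insert j K₀) * inner ℂ (coeff u.1 (insert j K₀)) (d j) := by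
    rw [hfu]
    simp only [e, inner_add_right, inner_smul_right, mul_add]
    rw [Finset.sum_add_distrib, add_comm]
    congr 1
    rw [Finset.sum_eq_single j₀]
    · rw [hins, coeff_coe]; simp
    · intro j _ hj; simp [hj]
    · intro h; simp [hK₀] at h
  have hmain := inner_dbarStar hΩ u hvf
  simp only at hmain
  rw [hsplit] at hmain
  have hsgn : ∀ j (L : Finset (Fin n)), ‖wedgeSign j L‖ = 1 := fun j L => by simp [wedgeSign]
  have hJn : ‖u.1 J‖ ≤ ‖u.1‖ := PiLp.norm_apply_le u.1 J
  have hcn : ∀ A, ‖coeff u.1 A‖ ≤ ‖u.1‖ := by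
    intro A
    rw [coeff]
    split_ifs with h
    · exact PiLp.norm_apply_le u.1 _
    · simp
  have hsum : ‖∑ j ∈ K₀ᶜ, wedgeSign j (insert j K₀) * inner ℂ (coeff u.1 (insert j K₀)) (d j)‖
      ≤ n * (‖u.1‖ * (R * ‖G‖)) := by
    have hterm : ∀ j ∈ K₀ᶜ, ‖wedgeSign j (insert j K₀)
        * inner ℂ (coeff u.1 (insert j K₀)) (d j)‖ ≤ ‖u.1‖ * (R * ‖G‖) := by
      intro j _
      rw [norm_mul, hsgn, one_mul]
      refine (norm_inner_le_norm _ _).trans ?_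
      gcongr
      · exact hcn _
      · exact (hdn j).trans (by gcongr; exact norm_gradBar_le G j)
    refine (norm_sum_le_of_le _ hterm).trans ?_
    rw [Finset.sum_const, nsmul_eq_mul]
    gcongr
    exact_mod_cast (Finset.card_le_univ _).trans_eq (Fintype.card_fin n)
  have hin : ‖inner ℂ (dbarStar Ω p (p + 1) u) v‖ ≤ ‖dbarStar Ω p (p + 1) u‖ * (R * ‖u.1‖) := by
    refine (norm_inner_le_norm _ _).trans ?_
    rw [hvn]
    gcongr
    exact hg'n.trans (by gcongr)
  have hnorm : ‖wedgeSign j₀ J.1 * inner ℂ (u.1 J) (u.1 J)‖ = ‖u.1 J‖ ^ 2 := by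
    rw [norm_mul, hsgn, one_mul, inner_self_eq_norm_sq_to_K]
    simp
  calc ‖u.1 J‖ ^ 2 = ‖wedgeSign j₀ J.1 * inner ℂ (u.1 J) (u.1 J)‖ := hnorm.symm
    _ = ‖inner ℂ (dbarStar Ω p (p + 1) u) v
        - ∑ j ∈ K₀ᶜ, wedgeSign j (insert j K₀) * inner ℂ (coeff u.1 (insert j K₀)) (d j)‖ := by
        rw [hmain]; congr 1; ring
    _ ≤ ‖dbarStar Ω p (p + 1) u‖ * (R * ‖u.1‖) + n * (‖u.1‖ * (R * ‖G‖)) :=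
        (norm_sub_le _ _).trans (add_le_add hin hsum)
    _ = _ := by ring

theorem coercive_arith {B t d a S x : ℝ} (ht : 0 < t) (hd : 0 ≤ d) (ha : 0 ≤ a) (hS : 0 ≤ S)
    (h : x ≤ (B ^ 2 + 1) * (a + S)) :
    1 / (B ^ 2 + 1) * min t 1 * x ≤ d + a + t * S := by
  have hmin : 0 < min t 1 := lt_min ht one_pos
  calc 1 / (B ^ 2 + 1) * min t 1 * x
      ≤ 1 / (B ^ 2 + 1) * min t 1 * ((B ^ 2 + 1) * (a + S)) := by gcongr
    _ = min t 1 * a + min t 1 * S := by field_simp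
    _ ≤ 1 * a + t * S := by
        gcongr
        · exact min_le_right _ _
        · exact min_le_left _ _
    _ ≤ d + a + t * S := by linarith

/-- The form `Q_q^t` is coercive on `L²`, with a constant proportional to `min t 1`. -/
theorem exists_coercive (hΩ : IsOpen Ω) (hb : Bornology.IsBounded Ω) (p : ℕ) :
    ∃ C : ℝ, 0 < C ∧ ∀ t : ℝ, 0 < t → ∀ u : (kohnNirenbergForm Ω t (p + 1)).domain,
      C * min t 1 * ‖(u : L2Form Ω (p + 1))‖ ^ 2
        ≤ ((kohnNirenbergForm Ω t (p + 1)).form u u).re := by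
  obtain ⟨R, hRpos, hR⟩ := hb.exists_pos_norm_le
  set m : ℝ := ((Fintype.card {J : Finset (Fin n) // J.card = p + 1} : ℕ) : ℝ) with hm
  set B : ℝ := R * (m * (1 + n)) with hB
  have hm0 : 0 ≤ m := Nat.cast_nonneg _
  have hB0 : 0 ≤ B := by positivity
  -- `B` comes from summing `norm_sq_coeff_le` over the `m` multi-indices, with `‖∂̄*u‖` and each
  -- `‖∇u_J‖` at most `X`. The `+ 1` keeps the constant finite when `B = 0`.
  refine ⟨1 / (B ^ 2 + 1), by positivity, fun t ht u => ?_⟩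
  rw [kohnNirenbergForm_self_re]
  set a := ‖dbarStar Ω (p + 1 - 1) (p + 1) ⟨u, u.2.2⟩‖ with ha
  set b : {J : Finset (Fin n) // J.card = p + 1} → ℝ :=
    fun J => ‖weakGrad Ω ⟨u.1 J, u.2.1 J⟩‖ with hbdef
  set X := √(a ^ 2 + ∑ J, b J ^ 2) with hX
  have hX2 : X ^ 2 = a ^ 2 + ∑ J, b J ^ 2 := Real.sq_sqrt (by positivity)
  have hX0 : 0 ≤ X := Real.sqrt_nonneg _
  have haX : a ≤ X := Real.le_sqrt_of_sq_le (le_add_of_nonneg_right (by positivity))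
  have hbX : ∀ J, b J ≤ X := fun J => Real.le_sqrt_of_sq_le
    ((Finset.single_le_sum (f := fun J => b J ^ 2) (fun J _ => sq_nonneg _)
      (Finset.mem_univ J)).trans (le_add_of_nonneg_left (sq_nonneg _)))
  have h1 : ‖(u : L2Form Ω (p + 1))‖ ^ 2 ≤ ‖(u : L2Form Ω (p + 1))‖ * (B * X) := by
    rw [norm_sq_L2Form]
    have hJ : ∀ J ∈ Finset.univ, ‖u.1 J‖ ^ 2
        ≤ R * ‖(u : L2Form Ω (p + 1))‖ * (X + n * X) := by
      intro J _
      refine (norm_sq_coeff_le hΩ hRpos.le hR ⟨u.1, u.2.2⟩ J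
        (weakGrad_mem hΩ ⟨u.1 J, u.2.1 J⟩)).trans ?_
      gcongr
      · exact haX
      · exact hbX J
    refine (Finset.sum_le_sum hJ).trans_eq ?_
    rw [Finset.sum_const, nsmul_eq_mul, Finset.card_univ, ← hm, hB]
    ring
  have h2 : ‖(u : L2Form Ω (p + 1))‖ ≤ B * X := by
    by_cases h0 : ‖(u : L2Form Ω (p + 1))‖ = 0
    · rw [h0]; positivity
    · have h0' : 0 < ‖(u : L2Form Ω (p + 1))‖ := lt_of_le_of_ne (norm_nonneg _) (Ne.symm h0)
      rw [pow_two] at h1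
      exact le_of_mul_le_mul_left h1 h0'
  have h3 : ‖(u : L2Form Ω (p + 1))‖ ^ 2 ≤ (B ^ 2 + 1) * X ^ 2 := by
    calc ‖(u : L2Form Ω (p + 1))‖ ^ 2 ≤ (B * X) ^ 2 := by gcongr
      _ ≤ (B ^ 2 + 1) * X ^ 2 := by nlinarith [sq_nonneg X]
  rw [hX2] at h3
  exact coercive_arith ht (sq_nonneg _) (sq_nonneg _) (Finset.sum_nonneg fun J _ => sq_nonneg _) h3

end Coercive

/-! ### Translations of Sobolev functions -/

section Translate

variable {n : ℕ} {Ω W : Set (Fin n → ℂ)} {φ ψ : (Fin n → ℂ) → ℂ}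

/-- The real coordinates of a vector of `ℂⁿ`. -/
def realCoord (h : Fin n → ℂ) (i : Fin n × Fin 2) : ℝ :=
  if i.2 = 0 then (h i.1).re else (h i.1).im

theorem sum_realCoord (h : Fin n → ℂ) : ∑ i, realCoord h i • realDir i = h := by
  ext k
  rw [Finset.sum_apply, Fintype.sum_prod_type, Finset.sum_eq_single k]
  · rw [Fin.sum_univ_two]
    simp [realCoord, realDir_apply]
  · intro j _ hj
    simp [realDir_apply, hj]
  · simp

theorem abs_realCoord_le (h : Fin n → ℂ) (i : Fin n × Fin 2) : |realCoord h i| ≤ ‖h‖ := by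
  refine le_trans ?_ (norm_le_pi_norm h i.1)
  rw [realCoord]
  split_ifs
  · exact Complex.abs_re_le_norm _
  · exact Complex.abs_im_le_norm _

theorem IsTest.translate (hφ : IsTest W φ) {a : Fin n → ℂ} (ha : ∀ x ∈ W, x + a ∈ Ω) :
    IsTest Ω (fun z => φ (z - a)) := by
  refine ⟨hφ.1.comp (contDiff_id.sub contDiff_const),
    hφ.2.1.comp_isClosedEmbedding (Homeomorph.subRight a).isClosedEmbedding, ?_⟩
  have h1 : tsupport (fun z => φ (z - a)) ⊆ (fun z => z - a) ⁻¹' tsupport φ :=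
    closure_minimal (fun z hz => subset_tsupport _ hz)
      ((isClosed_tsupport φ).preimage (continuous_id.sub continuous_const))
  intro z hz
  have := ha _ (hφ.2.2 (h1 hz))
  simpa using this

theorem norm_pair_le (hψ : MemLp ψ 2 (volume.restrict Ω)) (g : L2 Ω) :
    ‖pair g ψ‖ ≤ ‖g‖ * (eLpNorm ψ 2 (volume.restrict Ω)).toReal := by
  rw [pair_eq_inner hψ, mul_comm]
  refine (norm_inner_le_norm _ _).trans_eq ?_
  rw [Lp.norm_toLp]
  congr 2
  exact eLpNorm_congr_norm_ae (Eventually.of_forall fun z => by simp)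

theorem IsTest.eLpNorm_translate_le (hφ : IsTest W φ) (a : Fin n → ℂ) :
    eLpNorm (fun z => φ (z - a)) 2 (volume.restrict Ω) ≤ eLpNorm φ 2 (volume.restrict W) := by
  calc eLpNorm (fun z => φ (z - a)) 2 (volume.restrict Ω)
      ≤ eLpNorm (fun z => φ (z - a)) 2 volume := eLpNorm_mono_measure _ Measure.restrict_le_self
    _ = eLpNorm φ 2 volume :=
        eLpNorm_comp_measurePreserving (g := φ) hφ.1.continuous.aestronglyMeasurable
          (measurePreserving_sub_right volume a)
    _ = eLpNorm φ 2 (volume.restrict W) :=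
        (eLpNorm_restrict_eq_of_support_subset ((subset_tsupport φ).trans hφ.2.2)).symm

theorem pair_sum_right {ι : Type*} (s : Finset ι) (c : ι → ℂ) (f : ι → (Fin n → ℂ) → ℂ) (g : L2 Ω)
    (hf : ∀ i ∈ s, MemLp (f i) 2 (volume.restrict Ω)) :
    pair g (fun z => ∑ i ∈ s, c i * f i z) = ∑ i ∈ s, c i * pair g (f i) := by
  unfold pair
  simp only [← integral_const_mul]
  rw [← integral_finsetSum _ fun i hi => (integrable_pair g (hf i hi)).const_mul _]
  refine integral_congr_ae (Eventually.of_forall fun z => ?_)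
  simp only [Finset.mul_sum]
  exact Finset.sum_congr rfl fun i _ => by ring

/-- Differentiation under the integral: the derivative of `φ` is bounded, and `g` is integrable
because `Ω` has finite volume. -/
theorem hasDerivAt_pair_translate (hb : volume Ω ≠ ⊤) (g : L2 Ω) (hφ : IsTest W φ)
    (h : Fin n → ℂ) (s : ℝ) :
    HasDerivAt (fun s : ℝ => pair g fun z => φ (z - s • h))
      (pair g fun z => - fderiv ℝ φ (z - s • h) h) s := by
  have : IsFiniteMeasure (volume.restrict Ω) := ⟨by simpa using hb.lt_top⟩
  have hgi : Integrable g (volume.restrict Ω) := (Lp.memLp g).integrable (by norm_num)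
  have hdc : Continuous (fderiv ℝ φ) := hφ.1.continuous_fderiv (by simp)
  obtain ⟨C, hC⟩ := (hφ.2.1.fderiv ℝ).exists_bound_of_continuous hdc
  have hmeas : ∀ ψ : (Fin n → ℂ) → ℂ, Continuous ψ →
      AEStronglyMeasurable (fun z => g z * ψ z) (volume.restrict Ω) := fun ψ hψ =>
    (Lp.aestronglyMeasurable g).mul hψ.aestronglyMeasurable
  have hsub : ∀ s : ℝ, Continuous fun z : Fin n → ℂ => z - s • h := fun s =>
    continuous_id.sub continuous_const
  refine (hasDerivAt_integral_of_dominated_loc_of_deriv_le (s := univ) (x₀ := s)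
    (μ := volume.restrict Ω) (F := fun s z => g z * φ (z - s • h))
    (F' := fun s z => g z * - fderiv ℝ φ (z - s • h) h)
    (bound := fun z => ‖g z‖ * (C * ‖h‖)) univ_mem ?_ ?_ ?_ ?_ ?_ ?_).2
  · exact Eventually.of_forall fun s => hmeas _ (hφ.1.continuous.comp (hsub s))
  · obtain ⟨C', hC'⟩ := hφ.2.1.exists_bound_of_continuous hφ.1.continuous
    refine Integrable.mono' (hgi.norm.mul_const C') (hmeas _ (hφ.1.continuous.comp (hsub s))) ?_
    refine Eventually.of_forall fun z => ?_
    rw [norm_mul]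
    gcongr
    exact hC' _
  · exact hmeas _ ((hdc.comp (hsub s)).clm_apply continuous_const).neg
  · refine Eventually.of_forall fun z s _ => ?_
    rw [norm_mul, norm_neg]
    gcongr
    exact (ContinuousLinearMap.le_opNorm _ _).trans (by gcongr; exact hC _)
  · exact hgi.norm.mul_const _
  · refine Eventually.of_forall fun z s _ => ?_
    have h1 : HasDerivAt (fun s : ℝ => z - s • h) (-h) s := by
      simpa using ((hasDerivAt_id s).smul_const h).const_sub z
    have h2 := (hφ.differentiable (z - s • h)).hasFDerivAt.comp_hasDerivAt s h1
    have h3 := h2.const_mul (g z)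
    simpa using h3

/-- While `s` runs through `[0,1]`, the translate of `φ` stays a test function on `Ω`, so its
directional derivative can be moved onto `g` as the weak gradient. The mean value inequality
integrates the bound; `2 * n` counts the real coordinates of `h`. -/
theorem norm_pair_translate_sub_le (hb : volume Ω ≠ ⊤)
    {g : L2 Ω} {G : L2Grad Ω} (hg : (g, G) ∈ weakGradGraph Ω) (hφ : IsTest W φ) {h : Fin n → ℂ}
    (hh : ∀ x ∈ W, ∀ s ∈ Icc (0 : ℝ) 1, x + s • h ∈ Ω) :
    ‖pair g (fun z => φ (z - h)) - pair g φ‖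
      ≤ 2 * n * ‖h‖ * ‖G‖ * (eLpNorm φ 2 (volume.restrict W)).toReal := by
  set N := (eLpNorm φ 2 (volume.restrict W)).toReal with hN
  have hderiv : ∀ s ∈ Ico (0 : ℝ) 1, ‖pair g fun z => - fderiv ℝ φ (z - s • h) h‖
      ≤ 2 * n * ‖h‖ * ‖G‖ * N := by
    intro s hs
    have ht : IsTest Ω fun z => φ (z - s • h) :=
      hφ.translate fun x hx => hh x hx s ⟨hs.1, hs.2.le⟩
    have h1 : (fun z => - fderiv ℝ φ (z - s • h) h)
        = fun z => ∑ i, (-(realCoord h i : ℂ)) * realPartial i (fun z => φ (z - s • h)) z := by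
      funext z
      have hfd : fderiv ℝ (fun z => φ (z - s • h)) z = fderiv ℝ φ (z - s • h) :=
        fderiv_comp_sub (s • h)
      conv_lhs => rw [← sum_realCoord h]
      rw [map_sum, ← Finset.sum_neg_distrib]
      refine Finset.sum_congr rfl fun i _ => ?_
      rw [sum_realCoord, map_smul, realPartial, hfd, Complex.real_smul, neg_mul]
    rw [h1, pair_sum_right _ _ _ _ fun i _ => ht.realPartial_memLp i]
    have hterm : ∀ i ∈ Finset.univ, ‖-(realCoord h i : ℂ)
        * pair g (realPartial i fun z => φ (z - s • h))‖ ≤ ‖h‖ * (‖G‖ * N) := by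
      intro i _
      rw [norm_mul, norm_neg, Complex.norm_real, Real.norm_eq_abs]
      have e : pair g (realPartial i fun z => φ (z - s • h))
          = - pair (G i) fun z => φ (z - s • h) := hg _ ht i
      rw [e, norm_neg]
      gcongr
      · exact abs_realCoord_le h i
      · refine (norm_pair_le ht.memLp _).trans ?_
        exact mul_le_mul (PiLp.norm_apply_le G i)
          (ENNReal.toReal_mono hφ.memLp.eLpNorm_ne_top (hφ.eLpNorm_translate_le _))
          ENNReal.toReal_nonneg (norm_nonneg _)
    refine (norm_sum_le_of_le _ hterm).trans_eq ?_
    rw [Finset.sum_const, nsmul_eq_mul, Finset.card_univ, Fintype.card_prod, Fintype.card_fin,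
      Fintype.card_fin]
    push_cast
    ring
  have := norm_image_sub_le_of_norm_deriv_le_segment_01'
    (fun s _ => (hasDerivAt_pair_translate hb g hφ h s).hasDerivWithinAt) hderiv
  simpa using this

theorem dense_test (hW : IsOpen W) :
    Dense (((testGradGraph W).map (LinearMap.fst ℂ (L2 W) (L2Grad W)) : Submodule ℂ (L2 W)) :
      Set (L2 W)) := by
  rw [Submodule.dense_iff_topologicalClosure_eq_top, Submodule.topologicalClosure_eq_top_iff,
    Submodule.eq_bot_iff]
  intro v hv
  refine eq_zero_of_pair hW fun φ hφ => ?_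
  rw [pair_eq_inner hφ.memLp]
  exact (Submodule.mem_orthogonal _ _).1 hv _ ⟨_, hφ.conj.mem_testGradGraph, rfl⟩

/-- The norm in `L²(W)` is determined by pairings with test functions. -/
theorem norm_le_of_pair (hW : IsOpen W) {k : L2 W} {c : ℝ} (hc0 : 0 ≤ c)
    (h : ∀ φ, IsTest W φ → ‖pair k φ‖ ≤ c * (eLpNorm φ 2 (volume.restrict W)).toReal) :
    ‖k‖ ≤ c := by
  have hc : ∀ ψ : L2 W, ‖inner ℂ ψ k‖ ≤ c * ‖ψ‖ := by
    have hcl : IsClosed {ψ : L2 W | ‖inner ℂ ψ k‖ ≤ c * ‖ψ‖} :=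
      isClosed_le (continuous_id.inner continuous_const).norm (continuous_const.mul continuous_norm)
    intro ψ
    refine closure_minimal ?_ hcl (dense_test hW ψ)
    rintro _ ⟨p, ⟨φ, hφ, hp, -⟩, rfl⟩
    have h1 : p.1 = hφ.memLp.toLp := Lp.ext (hp.trans hφ.memLp.coeFn_toLp.symm)
    -- Pairing with `conj φ` is the inner product with `φ`, so the hypothesis is applied to the
    -- conjugate test function.
    have h2 : p.1 = hφ.conj.memLp.star.toLp := by
      refine Lp.ext (hp.trans (EventuallyEq.trans ?_ hφ.conj.memLp.star.coeFn_toLp.symm))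
      exact Eventually.of_forall fun z => by simp
    have h3 := h _ hφ.conj
    rw [pair_eq_inner hφ.conj.memLp] at h3
    change ‖inner ℂ p.1 k‖ ≤ c * ‖p.1‖
    rw [show ‖p.1‖ = (eLpNorm (fun z => starRingEnd ℂ (φ z)) 2 (volume.restrict W)).toReal by
      rw [h1, Lp.norm_toLp]
      congr 1
      exact eLpNorm_congr_norm_ae (Eventually.of_forall fun z => by simp)]
    rw [h2]
    exact h3
  by_cases h0 : ‖k‖ = 0
  · rwa [h0]
  · have h1 := hc k
    rw [inner_self_eq_norm_sq_to_K] at h1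
    have h2 : ‖k‖ * ‖k‖ ≤ c * ‖k‖ := by
      simpa [pow_two] using h1
    exact le_of_mul_le_mul_right h2 (lt_of_le_of_ne (norm_nonneg _) (Ne.symm h0))

theorem lintegral_enorm_sq_eq {α : Type*} [MeasurableSpace α] {μ : Measure α} {f : α → ℂ} :
    ∫⁻ x, ‖f x‖ₑ ^ 2 ∂μ = eLpNorm f 2 μ ^ 2 := by
  have := eLpNorm_nnreal_pow_eq_lintegral (f := f) (p := 2) (μ := μ) two_ne_zero
  simpa using this.symm

/-- The difference quotient estimate for Sobolev functions. -/
theorem lintegral_translate_sub_le (hb : volume Ω ≠ ⊤) (hW : IsOpen W)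
    {g : L2 Ω} {G : L2Grad Ω} (hg : (g, G) ∈ weakGradGraph Ω) {h : Fin n → ℂ}
    (hh : ∀ x ∈ W, ∀ s ∈ Icc (0 : ℝ) 1, x + s • h ∈ Ω) :
    ∫⁻ x in W, ‖g (x + h) - g x‖ₑ ^ 2 ≤ ENNReal.ofReal ((2 * n * ‖h‖ * ‖G‖) ^ 2) := by
  have hWΩ : W ⊆ Ω := fun x hx => by simpa using hh x hx 0 (by simp)
  have hWh : ∀ x ∈ W, x + h ∈ Ω := fun x hx => by simpa using hh x hx 1 (by simp)
  have hm1 : MemLp g 2 (volume.restrict W) :=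
    (Lp.memLp g).mono_measure (Measure.restrict_mono hWΩ le_rfl)
  have hm2 : MemLp (fun x => g (x + h)) 2 (volume.restrict W) := by
    have hS : MeasurableSet ((fun y => y - h) ⁻¹' W) :=
      (hW.preimage (continuous_id.sub continuous_const)).measurableSet
    have hp := (measurePreserving_add_right volume h).restrict_preimage hS
    have he : (fun x => x + h) ⁻¹' ((fun y => y - h) ⁻¹' W) = W := by ext x; simp
    rw [he] at hp
    have hsub : (fun y => y - h) ⁻¹' W ⊆ Ω := fun y hy => by simpa using hWh _ hy
    exact ((Lp.memLp g).mono_measure (Measure.restrict_mono hsub le_rfl)).comp_measurePreserving hp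
  have hm : MemLp (fun x => g (x + h) - g x) 2 (volume.restrict W) := hm2.sub hm1
  -- By duality it is enough to pair the difference with test functions on `W`, where a change of
  -- variables moves the shift onto `φ`.
  have hk : ‖hm.toLp‖ ≤ 2 * n * ‖h‖ * ‖G‖ := by
    refine norm_le_of_pair hW (by positivity) fun φ hφ => ?_
    refine le_of_eq_of_le ?_ (norm_pair_translate_sub_le hb hg hφ hh)
    congr 1
    have h1 : pair hm.toLp φ = ∫ x in W, (g (x + h) * φ x - g x * φ x) := by
      refine integral_congr_ae ?_
      filter_upwards [hm.coeFn_toLp] with x hx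
      rw [hx, sub_mul]
    have h2 : ∫ x in W, g (x + h) * φ x = pair g fun z => φ (z - h) := by
      rw [hφ.integral_eq fun x => g (x + h), pair,
        (hφ.translate hWh).integral_eq]
      simpa using integral_add_right_eq_self (μ := volume) (fun z => g z * φ (z - h)) h
    have h3 : ∫ x in W, g x * φ x = pair g φ := by
      rw [hφ.integral_eq, pair, (hφ.mono hWΩ).integral_eq]
    have hi2 : Integrable (fun x => g (x + h) * φ x) (volume.restrict W) :=
      hm2.integrable_mul hφ.memLp
    have hi1 : Integrable (fun x => g x * φ x) (volume.restrict W) := hm1.integrable_mul hφ.memLp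
    rw [h1, integral_sub hi2 hi1, h2, h3]
  rw [lintegral_enorm_sq_eq, ENNReal.ofReal_pow (by positivity)]
  gcongr
  rw [Lp.norm_toLp] at hk
  exact (ENNReal.le_ofReal_iff_toReal_le hm.eLpNorm_ne_top (by positivity)).2 hk

end Translate

/-! ### Rellich's theorem -/

section Rellich

variable {n : ℕ} {Ω W : Set (Fin n → ℂ)}

/-- Write `a` as the average of `f` plus the average of `a - f`, and apply Jensen's inequality to
the second. -/
theorem norm_sq_le_average {α : Type*} [MeasurableSpace α] {μ : Measure α} {B : Set α}
    (h0 : μ B ≠ 0) (ht : μ B ≠ ⊤) {f : α → ℂ} (hf : MemLp f 2 (μ.restrict B)) (a : ℂ) :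
    ‖a‖ ^ 2 ≤ 2 * ‖⨍ y in B, f y ∂μ‖ ^ 2 + 2 * ⨍ y in B, ‖a - f y‖ ^ 2 ∂μ := by
  have : IsFiniteMeasure (μ.restrict B) := ⟨by simpa using ht.lt_top⟩
  have hconst : MemLp (fun _ : α => a) 2 (μ.restrict B) := memLp_const a
  have hd : MemLp (fun y => a - f y) 2 (μ.restrict B) := hconst.sub hf
  have hconv : ConvexOn ℝ univ fun z : ℂ => ‖z‖ ^ 2 :=
    (convexOn_norm convex_univ).pow (fun _ _ => norm_nonneg _) 2
  have hJ : ‖⨍ y in B, (a - f y) ∂μ‖ ^ 2 ≤ ⨍ y in B, ‖a - f y‖ ^ 2 ∂μ :=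
    hconv.map_set_average_le (by fun_prop) isClosed_univ h0 ht
      (Eventually.of_forall fun _ => mem_univ _) (hd.integrable (by norm_num))
      ((memLp_two_iff_integrable_sq_norm hd.1).1 hd)
  have hsub : ⨍ y in B, (a - f y) ∂μ = a - ⨍ y in B, f y ∂μ := by
    rw [setAverage_eq, setAverage_eq, integral_sub (integrable_const a) (hf.integrable (by norm_num)),
      smul_sub, setIntegral_const, smul_smul, inv_mul_cancel₀, one_smul]
    exact (ENNReal.toReal_pos h0 ht).ne'
  have htri : ‖a‖ ≤ ‖⨍ y in B, f y ∂μ‖ + ‖⨍ y in B, (a - f y) ∂μ‖ := by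
    have : a = (⨍ y in B, f y ∂μ) + ⨍ y in B, (a - f y) ∂μ := by rw [hsub]; ring
    calc ‖a‖ = ‖(⨍ y in B, f y ∂μ) + ⨍ y in B, (a - f y) ∂μ‖ := by rw [← this]
      _ ≤ _ := norm_add_le _ _
  calc ‖a‖ ^ 2 ≤ (‖⨍ y in B, f y ∂μ‖ + ‖⨍ y in B, (a - f y) ∂μ‖) ^ 2 := by gcongr
    _ ≤ 2 * ‖⨍ y in B, f y ∂μ‖ ^ 2 + 2 * ‖⨍ y in B, (a - f y) ∂μ‖ ^ 2 := by
        nlinarith [sq_nonneg (‖⨍ y in B, f y ∂μ‖ - ‖⨍ y in B, (a - f y) ∂μ‖)]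
    _ ≤ _ := by gcongr

theorem pair_indicator (g : L2 Ω) {B : Set (Fin n → ℂ)} (hB : MeasurableSet B)
    (hBΩ : B ⊆ Ω) : pair g (B.indicator fun _ => 1) = ∫ y in B, g y := by
  have h : ∀ z, g z * B.indicator (fun _ => (1 : ℂ)) z = B.indicator g z := by
    intro z
    by_cases hz : z ∈ B <;> simp [hz]
  rw [pair]
  simp only [h]
  rw [setIntegral_indicator hB, inter_eq_right.2 hBΩ]

/-- If all the averages of a Sobolev function over finitely many small balls are small, then the
function is small in `L²(W)`. -/
theorem exists_averages_bound (hb : Bornology.IsBounded Ω) (hW : IsOpen W)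
    {h₀ : Fin n → ℂ} {r : ℝ} (hr : 0 < r)
    (hh : ∀ x ∈ W, ∀ z ∈ Metric.ball h₀ (2 * r), ∀ s ∈ Icc (0 : ℝ) 1, x + s • z ∈ Ω) :
    ∃ (ι : Type) (_ : Fintype ι) (B : ι → Set (Fin n → ℂ)) (c : ℝ), 0 ≤ c ∧
      (∀ i, MeasurableSet (B i)) ∧ (∀ i, volume (B i) ≠ ⊤) ∧
      ∀ g G, (g, G) ∈ weakGradGraph Ω → ∫⁻ x in W, ‖g x‖ₑ ^ 2 ≤ ENNReal.ofReal
        (c * ∑ i, ‖pair g ((B i).indicator fun _ => 1)‖ ^ 2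
          + 2 * 2 ^ Module.finrank ℝ (Fin n → ℂ) * (2 * n * (‖h₀‖ + 2 * r) * ‖G‖) ^ 2) := by
  have hWΩ : W ⊆ Ω := fun x hx => by
    simpa using hh x hx h₀ (Metric.mem_ball_self (by positivity)) 0 (by simp)
  have hΩfin : volume Ω ≠ ⊤ := hb.measure_lt_top.ne
  have hWfin : volume W ≠ ⊤ := (hb.subset hWΩ).measure_lt_top.ne
  obtain ⟨T, hT, hcov⟩ := Metric.totallyBounded_iff.1
    ((hb.subset hWΩ).isCompact_closure.totallyBounded.subset subset_closure) r hr
  -- Only centres whose ball meets `W` are kept: a point of `W` in the ball is what places the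
  -- shifted ball `B y` inside `Ω`.
  have : Finite {y // y ∈ T ∧ ∃ x ∈ W, x ∈ Metric.ball y r} :=
    (hT.subset fun y hy => hy.1 : {y | y ∈ T ∧ ∃ x ∈ W, x ∈ Metric.ball y r}.Finite).to_subtype
  let B : {y // y ∈ T ∧ ∃ x ∈ W, x ∈ Metric.ball y r} → Set (Fin n → ℂ) :=
    fun y => Metric.ball (y.1 + h₀) r
  have hsub : ∀ y : {y // y ∈ T ∧ ∃ x ∈ W, x ∈ Metric.ball y r}, ∀ x ∈ Metric.ball y.1 r,
      B y ⊆ Metric.ball (x + h₀) (2 * r) := by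
    intro y x hx w hw
    rw [Metric.mem_ball, dist_eq_norm] at hx hw ⊢
    calc ‖w - (x + h₀)‖ = ‖(w - (y.1 + h₀)) - (x - y.1)‖ := by congr 1; abel
      _ ≤ ‖w - (y.1 + h₀)‖ + ‖x - y.1‖ := norm_sub_le _ _
      _ < 2 * r := by linarith
  have hmemz : ∀ x w : Fin n → ℂ, w ∈ Metric.ball (x + h₀) (2 * r) →
      w - x ∈ Metric.ball h₀ (2 * r) := by
    intro x w hw
    rw [Metric.mem_ball, dist_eq_norm] at hw ⊢
    rwa [sub_sub]
  have hBΩ : ∀ y, B y ⊆ Ω := by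
    intro y w hw
    obtain ⟨x, hxW, hx⟩ := y.2.2
    simpa using hh x hxW (w - x) (hmemz x w (hsub y x hx hw)) 1 (by simp)
  set V := volume (Metric.ball (0 : Fin n → ℂ) r) with hV
  have hBV : ∀ y, volume (B y) = V := fun y => Measure.addHaar_ball_center _ _ _
  have hV0 : V ≠ 0 := (Metric.measure_ball_pos _ _ hr).ne'
  have hVt : V ≠ ⊤ := measure_ball_lt_top.ne
  have hv : 0 < V.toReal := ENNReal.toReal_pos hV0 hVt
  refine ⟨_, Fintype.ofFinite _, B, 2 * (volume W).toReal * (V.toReal⁻¹) ^ 2, by positivity,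
    fun y => measurableSet_ball, fun y => by rw [hBV]; exact hVt, fun g G hg => ?_⟩
  let _ := Fintype.ofFinite {y // y ∈ T ∧ ∃ x ∈ W, x ∈ Metric.ball y r}
  set S := ∑ y, ‖pair g ((B y).indicator fun _ => 1)‖ ^ 2 with hS
  have hgm : Measurable g := (Lp.stronglyMeasurable g).measurable
  -- For `x` in the covering ball around `y`, compare `g x` with the average over `B y`, which lies
  -- in `x + ball h₀ (2 r)`. Integrating over `x` and swapping the integrals leaves `L²` norms of
  -- differences under translations `z` with `x + s z ∈ Ω`.
  have hpoint : ∀ x ∈ W, ‖g x‖ₑ ^ 2 ≤ ENNReal.ofReal (2 * (V.toReal⁻¹) ^ 2 * S)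
      + ENNReal.ofReal (2 * V.toReal⁻¹)
        * ∫⁻ z in Metric.ball h₀ (2 * r), ‖g (x + z) - g x‖ₑ ^ 2 := by
    intro x hx
    obtain ⟨y₀, hy₀T, hxy⟩ := mem_iUnion₂.1 (hcov hx)
    let y : {y // y ∈ T ∧ ∃ x ∈ W, x ∈ Metric.ball y r} := ⟨y₀, hy₀T, x, hx, hxy⟩
    have hmem : MemLp g 2 (volume.restrict (B y)) :=
      (Lp.memLp g).mono_measure (Measure.restrict_mono (hBΩ y) le_rfl)
    have h1 := norm_sq_le_average (μ := volume) (B := B y) (by rw [hBV]; exact hV0)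
      (by rw [hBV]; exact hVt) hmem (g x)
    have hreal : volume.real (B y) = V.toReal := by rw [Measure.real, hBV]
    rw [setAverage_eq, setAverage_eq, hreal, ← pair_indicator g measurableSet_ball (hBΩ y),
      norm_smul, mul_pow, Real.norm_eq_abs, sq_abs, smul_eq_mul] at h1
    have h2 : ‖pair g ((B y).indicator fun _ => 1)‖ ^ 2 ≤ S :=
      Finset.single_le_sum (f := fun y => ‖pair g ((B y).indicator fun _ => 1)‖ ^ 2)
        (fun _ _ => sq_nonneg _) (Finset.mem_univ y)
    have : IsFiniteMeasure (volume.restrict (B y)) :=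
      ⟨by simpa [hBV] using hVt.lt_top⟩
    have hdm : MemLp (fun w => g x - g w) 2 (volume.restrict (B y)) := (memLp_const _).sub hmem
    have h3 : ENNReal.ofReal (∫ w in B y, ‖g x - g w‖ ^ 2)
        ≤ ∫⁻ z in Metric.ball h₀ (2 * r), ‖g (x + z) - g x‖ₑ ^ 2 := by
      rw [ofReal_integral_eq_lintegral_ofReal ((memLp_two_iff_integrable_sq_norm hdm.1).1 hdm)
        (Eventually.of_forall fun _ => sq_nonneg _)]
      have hpre : (fun z => x + z) ⁻¹' Metric.ball (x + h₀) (2 * r) = Metric.ball h₀ (2 * r) := by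
        ext z; simp [Metric.mem_ball, dist_eq_norm]
      calc ∫⁻ w in B y, ENNReal.ofReal (‖g x - g w‖ ^ 2)
          ≤ ∫⁻ w in Metric.ball (x + h₀) (2 * r), ‖g w - g x‖ₑ ^ 2 := by
            refine (lintegral_mono_set (hsub y x hxy)).trans_eq ?_
            refine lintegral_congr fun w => ?_
            rw [norm_sub_rev, ENNReal.ofReal_pow (norm_nonneg _), ofReal_norm]
        _ = ∫⁻ z in Metric.ball h₀ (2 * r), ‖g (x + z) - g x‖ₑ ^ 2 := by
            rw [← hpre]
            exact ((measurePreserving_add_left volume x).setLIntegral_comp_preimage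
              measurableSet_ball ((hgm.sub_const _).enorm.pow_const 2)).symm
    calc ‖g x‖ₑ ^ 2 = ENNReal.ofReal (‖g x‖ ^ 2) := by
          rw [ENNReal.ofReal_pow (norm_nonneg _), ofReal_norm]
      _ ≤ ENNReal.ofReal (2 * (V.toReal⁻¹) ^ 2 * S
            + 2 * V.toReal⁻¹ * ∫ w in B y, ‖g x - g w‖ ^ 2) := by
          refine ENNReal.ofReal_le_ofReal (h1.trans ?_)
          rw [← mul_assoc, ← mul_assoc]
          gcongr
      _ ≤ _ := by
          refine ENNReal.ofReal_add_le.trans ?_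
          gcongr
          rw [ENNReal.ofReal_mul (by positivity)]
          gcongr
  have hS0 : 0 ≤ S := Finset.sum_nonneg fun _ _ => sq_nonneg _
  have hz : ∀ z ∈ Metric.ball h₀ (2 * r), ∫⁻ x in W, ‖g (x + z) - g x‖ₑ ^ 2
      ≤ ENNReal.ofReal ((2 * n * (‖h₀‖ + 2 * r) * ‖G‖) ^ 2) := by
    intro z hz
    refine (lintegral_translate_sub_le hΩfin hW hg fun x hx s hs => hh x hx z hz s hs).trans ?_
    refine ENNReal.ofReal_le_ofReal ?_
    have : ‖z‖ ≤ ‖h₀‖ + 2 * r := by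
      rw [Metric.mem_ball, dist_eq_norm] at hz
      calc ‖z‖ = ‖h₀ + (z - h₀)‖ := by congr 1; abel
        _ ≤ ‖h₀‖ + ‖z - h₀‖ := norm_add_le _ _
        _ ≤ _ := by linarith
    gcongr
  have hmeas2 : Measurable fun p : (Fin n → ℂ) × (Fin n → ℂ) => ‖g (p.1 + p.2) - g p.1‖ₑ ^ 2 :=
    ((hgm.comp (measurable_fst.add measurable_snd)).sub (hgm.comp measurable_fst)).enorm.pow_const 2
  -- Doubling the radius costs a dimensional factor only; this cancels `V`, so the gradient
  -- coefficient depends on `r` just through the length of the translations.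
  have hball : volume (Metric.ball h₀ (2 * r))
      = ENNReal.ofReal (2 ^ Module.finrank ℝ (Fin n → ℂ)) * V := by
    rw [Measure.addHaar_ball_mul_of_pos _ _ two_pos]
  calc ∫⁻ x in W, ‖g x‖ₑ ^ 2
      ≤ ∫⁻ x in W, (ENNReal.ofReal (2 * (V.toReal⁻¹) ^ 2 * S) + ENNReal.ofReal (2 * V.toReal⁻¹)
        * ∫⁻ z in Metric.ball h₀ (2 * r), ‖g (x + z) - g x‖ₑ ^ 2) :=
        setLIntegral_mono' hW.measurableSet hpoint
    _ = ENNReal.ofReal (2 * (V.toReal⁻¹) ^ 2 * S) * volume W + ENNReal.ofReal (2 * V.toReal⁻¹)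
        * ∫⁻ z in Metric.ball h₀ (2 * r), ∫⁻ x in W, ‖g (x + z) - g x‖ₑ ^ 2 := by
        rw [lintegral_add_left measurable_const, setLIntegral_const,
          lintegral_const_mul _ hmeas2.lintegral_prod_right',
          lintegral_lintegral_swap hmeas2.aemeasurable]
    _ ≤ ENNReal.ofReal (2 * (V.toReal⁻¹) ^ 2 * S) * volume W + ENNReal.ofReal (2 * V.toReal⁻¹)
        * (ENNReal.ofReal ((2 * n * (‖h₀‖ + 2 * r) * ‖G‖) ^ 2)
          * volume (Metric.ball h₀ (2 * r))) := by
        gcongr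
        rw [← setLIntegral_const]
        exact setLIntegral_mono' measurableSet_ball hz
    _ = _ := by
        rw [hball, ← ENNReal.ofReal_toReal hWfin]
        conv_lhs => rw [← ENNReal.ofReal_toReal hVt]
        rw [← ENNReal.ofReal_mul (by positivity), ← ENNReal.ofReal_mul (by positivity),
          ← ENNReal.ofReal_mul (by positivity), ← ENNReal.ofReal_mul (by positivity),
          ← ENNReal.ofReal_add (by positivity) (by positivity),
          ENNReal.toReal_ofReal ENNReal.toReal_nonneg, ENNReal.toReal_ofReal ENNReal.toReal_nonneg]
        congr 1
        field_simp

end Rellich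

/-! ### The cone condition and Rellich compactness on `C¹` domains -/

section RellichCompactness

variable {n : ℕ} {Ω W : Set (Fin n → ℂ)}

/-- A domain with `C¹` boundary satisfies a local cone condition. -/
theorem HasC1Boundary.exists_cone (hC : HasC1Boundary Ω) (hΩ : IsOpen Ω) {p : Fin n → ℂ}
    (hp : p ∈ closure Ω) :
    ∃ (U : Set (Fin n → ℂ)) (v : Fin n → ℂ) (δ : ℝ), IsOpen U ∧ p ∈ U ∧ 0 < δ ∧
      ∀ x ∈ Ω ∩ U, ∀ w ∈ Metric.ball v δ, ∀ s ∈ Icc (0 : ℝ) 1, x + s • w ∈ Ω := by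
  by_cases hpΩ : p ∈ Ω
  · obtain ⟨ε, hε, hball⟩ := Metric.isOpen_iff.1 hΩ p hpΩ
    refine ⟨Metric.ball p (ε / 2), 0, ε / 2, Metric.isOpen_ball,
      Metric.mem_ball_self (by positivity), by positivity, fun x hx w hw s hs => hball ?_⟩
    have h1 := hx.2
    rw [Metric.mem_ball, dist_eq_norm] at h1
    rw [mem_ball_zero_iff] at hw
    rw [Metric.mem_ball, dist_eq_norm]
    calc ‖x + s • w - p‖ = ‖(x - p) + s • w‖ := by congr 1; abel
      _ ≤ ‖x - p‖ + ‖s • w‖ := norm_add_le _ _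
      _ ≤ ‖x - p‖ + 1 * ‖w‖ := by
          rw [norm_smul, Real.norm_of_nonneg hs.1]
          gcongr
          exact hs.2
      _ < ε := by linarith
  · have hfr : p ∈ frontier Ω := by
      rw [frontier, hΩ.interior_eq]
      exact ⟨hp, hpΩ⟩
    obtain ⟨U, hU, hpU, r, hr, hdr, hΩU⟩ := hC p hfr
    obtain ⟨v, hv⟩ : ∃ v, fderiv ℝ r p v < 0 := by
      obtain ⟨v, hv⟩ : ∃ v, fderiv ℝ r p v ≠ 0 := by
        by_contra! h
        exact hdr p hpU (ContinuousLinearMap.ext h)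
      rcases lt_or_gt_of_ne hv with h | h
      · exact ⟨v, h⟩
      · exact ⟨-v, by simpa using h⟩
    -- Joint continuity of the differential keeps `r` decreasing in all directions near `v` at all
    -- points near `p`. This is the only use of `C¹` rather than mere differentiability.
    have hcont : ContinuousAt (fun y : (Fin n → ℂ) × (Fin n → ℂ) => fderiv ℝ r y.1 y.2) (p, v) := by
      have h1 : ContinuousAt (fderiv ℝ r) p :=
        (hr.continuousOn_fderiv_of_isOpen hU le_rfl).continuousAt (hU.mem_nhds hpU)
      exact (ContinuousAt.comp (f := Prod.fst) (x := (p, v)) h1 continuousAt_fst).clm_apply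
        continuousAt_snd
    have hev : ∀ᶠ y in 𝓝 (p, v), fderiv ℝ r y.1 y.2 < 0 ∧ y.1 ∈ U :=
      (hcont.eventually_lt continuousAt_const hv).and
        (continuousAt_fst.eventually (hU.mem_nhds hpU))
    obtain ⟨ρ, hρ, hball⟩ := Metric.eventually_nhds_iff_ball.1 hev
    have hneg : ∀ y ∈ Metric.ball p ρ, ∀ w ∈ Metric.ball v ρ, fderiv ℝ r y w < 0 ∧ y ∈ U := by
      intro y hy w hw
      refine hball (y, w) ?_
      rw [← ball_prod_same]
      exact ⟨hy, hw⟩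
    -- Chosen so that a cone vector has length less than `ρ / 2`; segments from the ball of radius
    -- `ρ / 2` then remain in the ball of radius `ρ`.
    set κ : ℝ := ρ / (2 * (‖v‖ + ρ)) with hκ
    have hvρ : 0 < ‖v‖ + ρ := by positivity
    have hκ0 : 0 < κ := by positivity
    refine ⟨Metric.ball p (ρ / 2), κ • v, κ * ρ, Metric.isOpen_ball,
      Metric.mem_ball_self (by positivity), by positivity, fun x hx w hw s hs => ?_⟩
    obtain ⟨w, rfl⟩ : ∃ w', w = κ • w' := ⟨κ⁻¹ • w, by rw [smul_inv_smul₀ hκ0.ne']⟩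
    have hw' : w ∈ Metric.ball v ρ := by
      rw [Metric.mem_ball, dist_smul₀, Real.norm_of_nonneg hκ0.le] at hw
      exact lt_of_mul_lt_mul_left hw hκ0.le
    have hwn : ‖w‖ < ‖v‖ + ρ := by
      rw [Metric.mem_ball, dist_eq_norm] at hw'
      calc ‖w‖ = ‖v + (w - v)‖ := by congr 1; abel
        _ ≤ ‖v‖ + ‖w - v‖ := norm_add_le _ _
        _ < _ := by linarith
    have hin : ∀ s ∈ Icc (0 : ℝ) 1, x + s • κ • w ∈ Metric.ball p ρ := by
      intro s hs
      have h1 := hx.2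
      rw [Metric.mem_ball, dist_eq_norm] at h1 ⊢
      calc ‖x + s • κ • w - p‖ = ‖(x - p) + s • κ • w‖ := by congr 1; abel
        _ ≤ ‖x - p‖ + ‖s • κ • w‖ := norm_add_le _ _
        _ ≤ ‖x - p‖ + 1 * (κ * (‖v‖ + ρ)) := by
            rw [norm_smul, norm_smul, Real.norm_of_nonneg hs.1, Real.norm_of_nonneg hκ0.le]
            gcongr
            exact hs.2
        _ = ‖x - p‖ + ρ / 2 := by rw [hκ]; field_simp
        _ < ρ := by linarith
    have hder : ∀ s ∈ Icc (0 : ℝ) 1, HasDerivAt (fun s : ℝ => r (x + s • κ • w))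
        (fderiv ℝ r (x + s • κ • w) (κ • w)) s := by
      intro s hs
      have h1 : HasDerivAt (fun s : ℝ => x + s • κ • w) (κ • w) s := by
        simpa using ((hasDerivAt_id s).smul_const (κ • w)).const_add x
      have h2 : DifferentiableAt ℝ r (x + s • κ • w) :=
        (hr.differentiableOn (by simp)).differentiableAt
          (hU.mem_nhds (hneg _ (hin s hs) w hw').2)
      exact h2.hasFDerivAt.comp_hasDerivAt s h1
    have hanti : AntitoneOn (fun s : ℝ => r (x + s • κ • w)) (Icc 0 1) := by
      refine antitoneOn_of_deriv_nonpos (convex_Icc 0 1)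
        (fun s hs => (hder s hs).continuousAt.continuousWithinAt)
        (fun s hs => (hder s (interior_subset hs)).differentiableAt.differentiableWithinAt)
        fun s hs => ?_
      rw [(hder s (interior_subset hs)).deriv, map_smul, smul_eq_mul]
      exact mul_nonpos_of_nonneg_of_nonpos hκ0.le
        (hneg _ (hin s (interior_subset hs)) w hw').1.le
    have h0 := hanti (left_mem_Icc.2 zero_le_one) hs hs.1
    simp only [zero_smul, add_zero] at h0
    have hxU : x ∈ U := by
      have := (hneg _ (hin 0 (left_mem_Icc.2 zero_le_one)) w hw').2
      simpa using this
    have hrx : r x < 0 := by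
      have : x ∈ Ω ∩ U := ⟨hx.1, hxU⟩
      rw [hΩU] at this
      exact this.2
    have : x + s • κ • w ∈ Ω ∩ U := by
      rw [hΩU]
      exact ⟨(hneg _ (hin s hs) w hw').2, h0.trans_lt hrx⟩
    exact this.1

/-- The `L²(Ω ∩ s)`-norm of a Sobolev function is bounded by finitely many averages up to a small
multiple of its gradient. -/
def HasAverageBound (Ω s : Set (Fin n → ℂ)) : Prop :=
  ∀ ε : ℝ, 0 < ε → ∃ (ι : Type) (_ : Fintype ι) (B : ι → Set (Fin n → ℂ)) (c : ℝ), 0 ≤ c ∧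
    (∀ i, MeasurableSet (B i)) ∧ (∀ i, volume (B i) ≠ ⊤) ∧
    ∀ g G, (g, G) ∈ weakGradGraph Ω → ∫⁻ x in Ω ∩ s, ‖g x‖ₑ ^ 2 ≤ ENNReal.ofReal
      (c * ∑ i, ‖pair g ((B i).indicator fun _ => 1)‖ ^ 2 + ε * ‖G‖ ^ 2)

/-- Joining the two finite families of sets and splitting `ε` evenly makes the local bounds fit for
a compactness induction. -/
theorem HasAverageBound.union {s t : Set (Fin n → ℂ)} (hs : HasAverageBound Ω s)
    (ht : HasAverageBound Ω t) : HasAverageBound Ω (s ∪ t) := by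
  intro ε hε
  obtain ⟨ι, _, B, c, hc, hB, hBf, h⟩ := hs (ε / 2) (by positivity)
  obtain ⟨ι', _, B', c', hc', hB', hBf', h'⟩ := ht (ε / 2) (by positivity)
  refine ⟨ι ⊕ ι', inferInstance, Sum.elim B B', c + c', by positivity, ?_, ?_, ?_⟩
  · rintro (i | i)
    exacts [hB i, hB' i]
  · rintro (i | i)
    exacts [hBf i, hBf' i]
  · intro g G hg
    rw [inter_union_distrib_left]
    refine (lintegral_union_le _ _ _).trans ((add_le_add (h g G hg) (h' g G hg)).trans ?_)
    rw [← ENNReal.ofReal_add (by positivity) (by positivity)]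
    refine ENNReal.ofReal_le_ofReal ?_
    rw [Fintype.sum_sum_type]
    simp only [Sum.elim_inl, Sum.elim_inr]
    have h1 : 0 ≤ c * ∑ i, ‖pair g ((B' i).indicator fun _ => 1)‖ ^ 2 := by positivity
    have h2 : 0 ≤ c' * ∑ i, ‖pair g ((B i).indicator fun _ => 1)‖ ^ 2 := by positivity
    linarith

theorem HasC1Boundary.hasAverageBound_nhds (hC : HasC1Boundary Ω) (hΩ : IsOpen Ω)
    (hb : Bornology.IsBounded Ω) {p : Fin n → ℂ} (hp : p ∈ closure Ω) :
    ∃ U ∈ 𝓝 p, HasAverageBound Ω U := by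
  obtain ⟨U, v, δ, hU, hpU, hδ, hcone⟩ := hC.exists_cone hΩ hp
  refine ⟨U, hU.mem_nhds hpU, fun ε hε => ?_⟩
  set A : ℝ := 2 * 2 ^ Module.finrank ℝ (Fin n → ℂ) * (2 * n * (‖v‖ + δ)) ^ 2 with hA
  have hA0 : 0 ≤ A := by positivity
  -- Shrinking the cone by `η ≤ 1` preserves the cone condition and multiplies the gradient
  -- coefficient by `η²`, which is at most `η`. The radius passed below is `η * δ / 2` because the
  -- averaging lemma uses a ball of twice its radius.
  set η : ℝ := min 1 (ε / (A + 1)) with hη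
  have hη0 : 0 < η := lt_min one_pos (by positivity)
  have hη1 : η ≤ 1 := min_le_left _ _
  obtain ⟨ι, hι, B, c, hc, hB, hBf, h⟩ := exists_averages_bound hb (hΩ.inter hU)
    (h₀ := η • v) (r := η * δ / 2) (by positivity) (by
      intro x hx z hz s hs
      obtain ⟨w, rfl⟩ : ∃ w, z = η • w := ⟨η⁻¹ • z, by rw [smul_inv_smul₀ hη0.ne']⟩
      have hw : w ∈ Metric.ball v δ := by
        rw [Metric.mem_ball, dist_smul₀, Real.norm_of_nonneg hη0.le, mul_div_cancel₀ _ two_ne_zero]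
          at hz
        exact lt_of_mul_lt_mul_left hz hη0.le
      rw [smul_smul]
      exact hcone x hx w hw _ ⟨mul_nonneg hs.1 hη0.le, mul_le_one₀ hs.2 hη0.le hη1⟩)
  refine ⟨ι, hι, B, c, hc, hB, hBf, fun g G hg => (h g G hg).trans (ENNReal.ofReal_le_ofReal ?_)⟩
  refine add_le_add le_rfl ?_
  have h1 : ‖η • v‖ + 2 * (η * δ / 2) = η * (‖v‖ + δ) := by
    rw [norm_smul, Real.norm_of_nonneg hη0.le]; ring
  rw [h1]
  calc 2 * 2 ^ Module.finrank ℝ (Fin n → ℂ) * (2 * n * (η * (‖v‖ + δ)) * ‖G‖) ^ 2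
      = A * (η * η) * ‖G‖ ^ 2 := by rw [hA]; ring
    _ ≤ ε * ‖G‖ ^ 2 := by
        gcongr
        calc A * (η * η) ≤ A * (1 * (ε / (A + 1))) := by
              gcongr
              exact min_le_right _ _
          _ ≤ ε := by
              rw [one_mul, mul_div_assoc', div_le_iff₀ (by positivity)]
              nlinarith

theorem HasC1Boundary.hasAverageBound (hC : HasC1Boundary Ω) (hΩ : IsOpen Ω)
    (hb : Bornology.IsBounded Ω) : HasAverageBound Ω (closure Ω) := by
  refine hb.isCompact_closure.induction_on (p := HasAverageBound Ω) ?_ ?_ ?_ ?_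
  · intro ε hε
    refine ⟨PEmpty, inferInstance, fun _ => ∅, 0, le_rfl, fun i => i.elim, fun i => i.elim,
      fun g G _ => ?_⟩
    simp
  · intro s t hst ht ε hε
    obtain ⟨ι, hι, B, c, hc, hB, hBf, h⟩ := ht ε hε
    exact ⟨ι, hι, B, c, hc, hB, hBf, fun g G hg =>
      (lintegral_mono_set (inter_subset_inter_right _ hst)).trans (h g G hg)⟩
  · exact fun s t => HasAverageBound.union
  · intro p hp
    obtain ⟨U, hU, h⟩ := hC.hasAverageBound_nhds hΩ hb hp
    exact ⟨U, mem_nhdsWithin_of_mem_nhds hU, h⟩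

/-- **Rellich's theorem** for bounded domains with `C¹` boundary. -/
theorem HasC1Boundary.exists_isCompact (hC : HasC1Boundary Ω) (hΩ : IsOpen Ω)
    (hb : Bornology.IsBounded Ω) :
    ∃ K : Set (L2 Ω), IsCompact K ∧
      ∀ g G, (g, G) ∈ weakGradGraph Ω → ‖g‖ ≤ 1 → ‖G‖ ≤ 1 → g ∈ K := by
  set S : Set (L2 Ω) := {g | ‖g‖ ≤ 1 ∧ ∃ G, (g, G) ∈ weakGradGraph Ω ∧ ‖G‖ ≤ 1} with hS
  suffices htb : TotallyBounded S from
    ⟨closure S, htb.closure.isCompact_of_isClosed isClosed_closure,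
      fun g G hg h1 h2 => subset_closure ⟨h1, G, hg, h2⟩⟩
  -- Functions are sorted by their vector of averages, which ranges over a bounded set in finite
  -- dimensions. Two functions in the same class have averages within `2 ρ` and gradients differing
  -- by at most `2`; with `ε ^ 2 / 16`, the gradient part costs `ε ^ 2 / 4`, and `ρ` makes the
  -- averages cost at most `ε ^ 2 / 2`.
  refine Metric.totallyBounded_of_finite_discretization fun ε hε => ?_
  obtain ⟨ι, _, B, c, hc, hB, hBf, h⟩ :=
    hC.hasAverageBound hΩ hb (ε ^ 2 / 16) (by positivity)
  have hmem : ∀ i, MemLp ((B i).indicator fun _ => (1 : ℂ)) 2 (volume.restrict Ω) := fun i =>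
    memLp_indicator_const 2 (hB i) 1
      (Or.inr ((Measure.restrict_apply_le _ _).trans_lt (hBf i).lt_top).ne)
  let Λ : L2 Ω → ι → ℂ := fun g i => pair g ((B i).indicator fun _ => 1)
  have hbdd : Bornology.IsBounded (Λ '' S) := by
    rw [isBounded_iff_forall_norm_le]
    refine ⟨∑ i, (eLpNorm ((B i).indicator fun _ => (1 : ℂ)) 2 (volume.restrict Ω)).toReal, ?_⟩
    rintro _ ⟨g, hg, rfl⟩
    refine (pi_norm_le_iff_of_nonneg (Finset.sum_nonneg fun _ _ => ENNReal.toReal_nonneg)).2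
      fun i => ?_
    refine (norm_pair_le (hmem i) g).trans ?_
    refine le_trans ?_ (Finset.single_le_sum (f := fun i =>
      (eLpNorm ((B i).indicator fun _ => (1 : ℂ)) 2 (volume.restrict Ω)).toReal)
      (fun _ _ => ENNReal.toReal_nonneg) (Finset.mem_univ i))
    exact mul_le_of_le_one_left ENNReal.toReal_nonneg hg.1
  set m : ℝ := c * Fintype.card ι with hm
  have hm0 : 0 ≤ m := by positivity
  set ρ : ℝ := min 1 (ε ^ 2 / (8 * (m + 1))) with hρ
  have hρ0 : 0 < ρ := lt_min one_pos (by positivity)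
  obtain ⟨T, hT, hcov⟩ := Metric.totallyBounded_iff.1
    (hbdd.isCompact_closure.totallyBounded.subset subset_closure) ρ hρ0
  have hch : ∀ g : S, ∃ y : T, Λ g ∈ Metric.ball (y : ι → ℂ) ρ := by
    intro g
    obtain ⟨y, hy, hgy⟩ := mem_iUnion₂.1 (hcov ⟨g, g.2, rfl⟩)
    exact ⟨⟨y, hy⟩, hgy⟩
  choose F hF using hch
  refine ⟨T, hT.fintype, F, fun g g' hgg' => ?_⟩
  obtain ⟨-, G, hG, hG1⟩ := g.2
  obtain ⟨-, G', hG', hG1'⟩ := g'.2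
  have hdiff := h ((g : L2 Ω) - (g' : L2 Ω)) (G - G') ((weakGradGraph Ω).sub_mem hG hG')
  rw [inter_eq_left.2 subset_closure, lintegral_enorm_sq_eq,
    ← ENNReal.ofReal_toReal (Lp.eLpNorm_ne_top _), ← ENNReal.ofReal_pow ENNReal.toReal_nonneg,
    ENNReal.ofReal_le_ofReal_iff (by positivity), ← Lp.norm_def] at hdiff
  have hGG : ‖G - G'‖ ≤ 2 := (norm_sub_le _ _).trans (by linarith)
  have hi : ∀ i, ‖pair ((g : L2 Ω) - (g' : L2 Ω)) ((B i).indicator fun _ => 1)‖ ≤ 2 * ρ := by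
    intro i
    have h1 : pair ((g : L2 Ω) - (g' : L2 Ω)) ((B i).indicator fun _ => 1) = Λ g i - Λ g' i := by
      have e : (g : L2 Ω) - (g' : L2 Ω) = g + (-1 : ℂ) • (g' : L2 Ω) := by rw [neg_one_smul, sub_eq_add_neg]
      rw [e, pair_add _ _ (hmem i), pair_smul]
      simp only [Λ]
      ring
    have h2 := hF g
    have h3 := hF g'
    rw [← hgg'] at h3
    have h4 : dist (Λ g) (Λ g') < 2 * ρ := by
      have := dist_triangle_right (Λ g) (Λ g') (F g : ι → ℂ)
      rw [Metric.mem_ball] at h2 h3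
      linarith
    rw [h1, ← dist_eq_norm]
    exact (dist_le_pi_dist _ _ i).trans h4.le
  have hsum : ∑ i, ‖pair ((g : L2 Ω) - (g' : L2 Ω)) ((B i).indicator fun _ => 1)‖ ^ 2
      ≤ Fintype.card ι * (2 * ρ) ^ 2 := by
    refine (Finset.sum_le_sum fun i _ => pow_le_pow_left₀ (norm_nonneg _) (hi i) 2).trans_eq ?_
    rw [Finset.sum_const, nsmul_eq_mul, Finset.card_univ]
  have hρ2 : 4 * m * ρ ^ 2 ≤ ε ^ 2 / 2 := by
    calc 4 * m * ρ ^ 2 = 4 * m * (ρ * ρ) := by ring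
      _ ≤ 4 * m * (1 * (ε ^ 2 / (8 * (m + 1)))) := by
          gcongr
          · exact min_le_left _ _
          · exact min_le_right _ _
      _ ≤ ε ^ 2 / 2 := by
          rw [one_mul, mul_div_assoc', div_le_iff₀ (by positivity)]
          nlinarith [sq_nonneg ε]
  have hfinal : ‖(g : L2 Ω) - (g' : L2 Ω)‖ ^ 2 < ε ^ 2 := by
    calc ‖(g : L2 Ω) - (g' : L2 Ω)‖ ^ 2
        ≤ c * (Fintype.card ι * (2 * ρ) ^ 2) + ε ^ 2 / 16 * 2 ^ 2 := by
          refine hdiff.trans ?_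
          gcongr
      _ = 4 * m * ρ ^ 2 + ε ^ 2 / 4 := by rw [hm]; ring
      _ < ε ^ 2 := by nlinarith [pow_pos hε 2]
  refine (dist_eq_norm (g : L2 Ω) (g' : L2 Ω)).trans_lt ?_
  exact lt_of_pow_lt_pow_left₀ 2 hε.le hfinal

end RellichCompactness

/-! ### The Kohn–Nirenberg Laplacian -/

section Laplacian

variable {n : ℕ} {Ω : Set (Fin n → ℂ)}

/-- The Hilbert space containing the triples `(∂̄u, ∂̄*u, √t ∇u)`. -/
abbrev EnergySpace (Ω : Set (Fin n → ℂ)) (p : ℕ) :=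
  WithLp 2 (L2Form Ω (p + 1 + 1) × WithLp 2 (L2Form Ω p ×
    PiLp 2 (fun _ : {J : Finset (Fin n) // J.card = p + 1} => L2Grad Ω)))

/-- The operator `u ↦ (∂̄u, ∂̄*u, √t ∇u)`. -/
def energyMap (Ω : Set (Fin n → ℂ)) (t : ℝ) (p : ℕ) :
    (kohnNirenbergForm Ω t (p + 1)).domain →ₗ[ℂ] EnergySpace Ω p where
  toFun u := WithLp.toLp 2
    (dbar Ω (p + 1) (p + 1 + 1) ⟨u, W1Form_le_dbar_domain Ω (p + 1) u.2.1⟩,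
      WithLp.toLp 2 (dbarStar Ω p (p + 1) ⟨u, u.2.2⟩,
        WithLp.toLp 2 fun J => (Real.sqrt t : ℂ) • weakGrad Ω ⟨u.1 J, u.2.1 J⟩))
  map_add' u v := by
    have h1 := (dbar Ω (p + 1) (p + 1 + 1)).map_add
      ⟨u, W1Form_le_dbar_domain Ω (p + 1) u.2.1⟩ ⟨v, W1Form_le_dbar_domain Ω (p + 1) v.2.1⟩
    have h2 := (dbarStar Ω p (p + 1)).map_add ⟨u, u.2.2⟩ ⟨v, v.2.2⟩
    have h3 := fun J => (weakGrad Ω).map_add ⟨u.1 J, u.2.1 J⟩ ⟨v.1 J, v.2.1 J⟩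
    refine congrArg (WithLp.toLp 2) (Prod.ext h1 (congrArg (WithLp.toLp 2) (Prod.ext h2
      (congrArg (WithLp.toLp 2) (funext fun J => ?_)))))
    exact (congrArg _ (h3 J)).trans (smul_add _ _ _)
  map_smul' c u := by
    have h1 := (dbar Ω (p + 1) (p + 1 + 1)).map_smul c
      ⟨u, W1Form_le_dbar_domain Ω (p + 1) u.2.1⟩
    have h2 := (dbarStar Ω p (p + 1)).map_smul c ⟨u, u.2.2⟩
    have h3 := fun J => (weakGrad Ω).map_smul c ⟨u.1 J, u.2.1 J⟩
    refine congrArg (WithLp.toLp 2) (Prod.ext h1 (congrArg (WithLp.toLp 2) (Prod.ext h2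
      (congrArg (WithLp.toLp 2) (funext fun J => ?_)))))
    exact (congrArg _ (h3 J)).trans (smul_comm _ _ _)

theorem energyMap_fst (t : ℝ) (p : ℕ) (u : (kohnNirenbergForm Ω t (p + 1)).domain) :
    (energyMap Ω t p u).fst = dbar Ω (p + 1) (p + 1 + 1) ⟨u, W1Form_le_dbar_domain Ω (p + 1) u.2.1⟩ :=
  rfl

theorem energyMap_snd_fst (t : ℝ) (p : ℕ) (u : (kohnNirenbergForm Ω t (p + 1)).domain) :
    (energyMap Ω t p u).snd.fst = dbarStar Ω p (p + 1) ⟨u, u.2.2⟩ :=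
  rfl

theorem energyMap_snd_snd (t : ℝ) (p : ℕ) (u : (kohnNirenbergForm Ω t (p + 1)).domain)
    (J : {J : Finset (Fin n) // J.card = p + 1}) :
    (energyMap Ω t p u).snd.snd J = (Real.sqrt t : ℂ) • weakGrad Ω ⟨u.1 J, u.2.1 J⟩ :=
  rfl

theorem EnergySpace.ext {p : ℕ} {F F' : EnergySpace Ω p} (h1 : F.fst = F'.fst)
    (h2 : F.snd.fst = F'.snd.fst) (h3 : ∀ J, F.snd.snd J = F'.snd.snd J) : F = F' :=
  (WithLp.ofLp_injective 2) (Prod.ext h1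
    ((WithLp.ofLp_injective 2) (Prod.ext h2 (PiLp.ext h3))))

/-- Weighting the gradient by `√t` presents the whole form as the square of a single operator, as
the abstract theory requires. -/
theorem kohnNirenbergForm_eq_gramForm {t : ℝ} (ht : 0 < t) (p : ℕ) :
    (kohnNirenbergForm Ω t (p + 1)).form = gramForm (energyMap Ω t p) := by
  ext u v
  have h1 : (kohnNirenbergForm Ω t (p + 1)).form u v
      = inner ℂ (dbar Ω (p + 1) (p + 1 + 1) ⟨u, W1Form_le_dbar_domain Ω (p + 1) u.2.1⟩)
          (dbar Ω (p + 1) (p + 1 + 1) ⟨v, W1Form_le_dbar_domain Ω (p + 1) v.2.1⟩)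
        + inner ℂ (dbarStar Ω p (p + 1) ⟨u, u.2.2⟩) (dbarStar Ω p (p + 1) ⟨v, v.2.2⟩)
        + t * ∑ J, inner ℂ (weakGrad Ω ⟨u.1 J, u.2.1 J⟩) (weakGrad Ω ⟨v.1 J, v.2.1 J⟩) :=
    add_smul_sum_apply _ _ _ _ _
  have hs : (Real.sqrt t : ℂ) * (Real.sqrt t : ℂ) = t := by
    rw [← Complex.ofReal_mul, Real.mul_self_sqrt ht.le]
  rw [h1, gramForm_apply, WithLp.prod_inner_apply, WithLp.prod_inner_apply, PiLp.inner_apply,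
    ← add_assoc, Finset.mul_sum]
  refine congrArg₂ _ rfl (Finset.sum_congr rfl fun J _ => ?_)
  refine Eq.trans ?_ ((inner_smul_left _ _ _).trans
    (congrArg _ (inner_smul_right _ _ _))).symm
  rw [← mul_assoc, Complex.conj_ofReal, hs]

theorem dense_kohnNirenbergForm_domain (hΩ : IsOpen Ω) (t : ℝ) (p : ℕ) :
    Dense ((kohnNirenbergForm Ω t (p + 1)).domain : Set (L2Form Ω (p + 1))) :=
  dense_of_W10_le hΩ fun _ hu => (kohnNirenbergForm_of_W10 hΩ t hu).1

/-- The graph of the energy map splits into three graph conditions on the separate components, each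
closed; since `√t ≠ 0`, the weak gradient can be recovered from its multiple. -/
theorem exists_energyMap_eq_iff (hΩ : IsOpen Ω) {t : ℝ} (ht : 0 < t) (p : ℕ)
    (v : L2Form Ω (p + 1)) (F : EnergySpace Ω p) :
    (∃ u : (kohnNirenbergForm Ω t (p + 1)).domain, (u : L2Form Ω (p + 1)) = v ∧
        energyMap Ω t p u = F) ↔
      (v, F.fst) ∈ dbarGraph Ω (p + 1) (p + 1 + 1) ∧ (v, F.snd.fst) ∈ (dbarStar Ω p (p + 1)).graph ∧
        ∀ J, (v J, (Real.sqrt t : ℂ)⁻¹ • F.snd.snd J) ∈ weakGradGraph Ω := by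
  have hs : (Real.sqrt t : ℂ) ≠ 0 := by simpa using (Real.sqrt_pos.2 ht).ne'
  constructor
  · rintro ⟨u, rfl, rfl⟩
    refine ⟨?_, ?_, fun J => ?_⟩
    · rw [energyMap_fst]
      have h := dbar_mem hΩ (⟨u, W1Form_le_dbar_domain Ω (p + 1) u.2.1⟩ :
        (dbar Ω (p + 1) (p + 1 + 1)).domain)
      exact h
    · rw [energyMap_snd_fst]
      have h := (dbarStar Ω p (p + 1)).mem_graph ⟨u, u.2.2⟩
      exact h
    · rw [energyMap_snd_snd, inv_smul_smul₀ hs]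
      have h := weakGrad_mem hΩ ⟨u.1 J, u.2.1 J⟩
      exact h
  · rintro ⟨h1, h2, h3⟩
    obtain ⟨⟨v', hv⟩, h4, h2⟩ := (LinearPMap.mem_graph_iff _).1 h2
    obtain rfl : v' = v := h4
    have hW : v' ∈ W1Form Ω (p + 1) := fun J => mem_W1 (h3 J)
    refine ⟨⟨v', hW, hv⟩, rfl, EnergySpace.ext ?_ ?_ fun J => ?_⟩
    · rw [energyMap_fst]
      exact dbar_eq hΩ _ h1
    · rw [energyMap_snd_fst]
      exact h2
    · rw [energyMap_snd_snd]
      refine (congrArg _ (weakGrad_eq hΩ (hW J) (h3 J))).trans (smul_inv_smul₀ hs _)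

theorem isClosed_energyMap (hΩ : IsOpen Ω) {t : ℝ} (ht : 0 < t) (p : ℕ) :
    IsClosed {w : L2Form Ω (p + 1) × EnergySpace Ω p |
      ∃ u : (kohnNirenbergForm Ω t (p + 1)).domain, (u : L2Form Ω (p + 1)) = w.1 ∧
        energyMap Ω t p u = w.2} := by
  simp_rw [exists_energyMap_eq_iff hΩ ht, Set.ofPred_and, Set.ofPred_forall]
  have hc1 : Continuous fun w : L2Form Ω (p + 1) × EnergySpace Ω p => (w.1, w.2.fst) := by
    fun_prop
  have hc2 : Continuous fun w : L2Form Ω (p + 1) × EnergySpace Ω p => (w.1, w.2.snd.fst) := by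
    fun_prop
  have hc3 : ∀ J, Continuous fun w : L2Form Ω (p + 1) × EnergySpace Ω p =>
      (w.1 J, (Real.sqrt t : ℂ)⁻¹ • w.2.snd.snd J) := by
    intro J
    fun_prop
  exact (isClosed_dbarGraph.preimage hc1).inter
    (((LinearPMap.adjoint_isClosed (dense_dbar_domain hΩ p)).preimage hc2).inter
    (isClosed_iInter fun J => isClosed_weakGradGraph.preimage (hc3 J)))

theorem nontrivial_L2Form (hΩ : IsOpen Ω) (hne : Ω.Nonempty) (hb : Bornology.IsBounded Ω)
    {q : ℕ} (hq : q ≤ n) : Nontrivial (L2Form Ω q) := by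
  have hne' : volume.restrict Ω Ω ≠ 0 := by
    rw [Measure.restrict_apply_self]
    exact (hΩ.measure_pos volume hne).ne'
  have hfin : volume.restrict Ω Ω ≠ ⊤ := by
    rw [Measure.restrict_apply_self]
    exact hb.measure_lt_top.ne
  have hone : indicatorConstLp 2 hΩ.measurableSet hfin (1 : ℂ) ≠ 0 := by
    rw [← norm_ne_zero_iff, norm_indicatorConstLp (by simp) (by simp), norm_one, one_mul]
    exact (Real.rpow_pos_of_pos (ENNReal.toReal_pos hne' hfin) _).ne'
  obtain ⟨J⟩ : Nonempty {J : Finset (Fin n) // J.card = q} := by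
    rw [← Fintype.card_pos_iff, card_multiIndex]
    exact Nat.choose_pos hq
  refine ⟨⟨WithLp.toLp 2 fun _ => indicatorConstLp 2 hΩ.measurableSet hfin (1 : ℂ), 0,
    fun h => hone ?_⟩⟩
  exact congrArg (fun u : L2Form Ω q => u J) h

theorem exists_isCompact_energyMap (hΩ : IsOpen Ω) (hb : Bornology.IsBounded Ω)
    (hC : HasC1Boundary Ω) {t c : ℝ} (ht : 0 < t) (hc : 0 < c) (p : ℕ)
    (hcoer : ∀ u : (kohnNirenbergForm Ω t (p + 1)).domain,
      c * ‖(u : L2Form Ω (p + 1))‖ ^ 2 ≤ ‖energyMap Ω t p u‖ ^ 2) :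
    ∃ K : Set (L2Form Ω (p + 1)), IsCompact K ∧
      ∀ u : (kohnNirenbergForm Ω t (p + 1)).domain, ‖energyMap Ω t p u‖ ≤ 1 →
        (u : L2Form Ω (p + 1)) ∈ K := by
  obtain ⟨K, hK, hKmem⟩ := hC.exists_isCompact hΩ hb
  -- A form of energy at most one has coefficients and gradients of norm at most `M`: the first by
  -- coercivity, the second by the `t`-term. Dividing by `M` brings each coefficient into the
  -- Rellich compact set.
  obtain ⟨M, hM0, hM1, hM2⟩ : ∃ M : ℝ, 0 < M ∧ 1 ≤ c * M ^ 2 ∧ 1 ≤ t * M ^ 2 := by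
    have hm : 0 < min c t := lt_min hc ht
    refine ⟨Real.sqrt (min c t)⁻¹, Real.sqrt_pos.2 (inv_pos.2 hm), ?_, ?_⟩ <;>
      rw [Real.sq_sqrt (inv_pos.2 hm).le, ← div_eq_mul_inv, one_le_div hm]
    exacts [min_le_left _ _, min_le_right _ _]
  have hMc : (M : ℂ) ≠ 0 := by exact_mod_cast hM0.ne'
  have key : ∀ {E : Type _} [NormedAddCommGroup E] [NormedSpace ℂ E] (x : E) (s : ℝ), 0 < s →
      1 ≤ s * M ^ 2 → s * ‖x‖ ^ 2 ≤ 1 → ‖(M : ℂ)⁻¹ • x‖ ≤ 1 := by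
    intro E _ _ x s hs h1 h2
    rw [norm_smul, norm_inv, Complex.norm_real, Real.norm_of_nonneg hM0.le,
      inv_mul_le_one₀ hM0]
    refine le_of_sq_le_sq ?_ hM0.le
    exact le_of_mul_le_mul_left (h2.trans h1) hs
  refine ⟨WithLp.toLp 2 '' Set.pi univ fun _ => (fun g : L2 Ω => (M : ℂ) • g) '' K,
    (isCompact_univ_pi fun _ => hK.image (continuous_const_smul _)).image
      (PiLp.continuous_toLp 2 _), fun u hu => ?_⟩
  have hu1 : ‖energyMap Ω t p u‖ ^ 2 ≤ 1 := pow_le_one₀ (norm_nonneg _) hu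
  refine ⟨u.1.ofLp, fun J _ => ⟨(M : ℂ)⁻¹ • u.1 J, ?_, smul_inv_smul₀ hMc _⟩, rfl⟩
  refine hKmem _ ((M : ℂ)⁻¹ • weakGrad Ω ⟨u.1 J, u.2.1 J⟩)
    ((weakGradGraph Ω).smul_mem _ (weakGrad_mem hΩ ⟨u.1 J, u.2.1 J⟩)) ?_ ?_
  · refine key _ c hc hM1 (le_trans ?_ ((hcoer u).trans hu1))
    rw [norm_sq_L2Form]
    exact mul_le_mul_of_nonneg_left
      (Finset.single_le_sum (f := fun J => ‖u.1 J‖ ^ 2) (fun _ _ => sq_nonneg _)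
        (Finset.mem_univ J)) hc.le
  · refine key _ t ht hM2 (le_trans ?_ hu1)
    rw [← gramForm_self_re, ← kohnNirenbergForm_eq_gramForm ht, kohnNirenbergForm_self_re]
    refine le_trans ?_ (le_add_of_nonneg_left (by positivity))
    exact mul_le_mul_of_nonneg_left
      (Finset.single_le_sum (f := fun J => ‖weakGrad Ω ⟨u.1 J, u.2.1 J⟩‖ ^ 2)
        (fun _ _ => sq_nonneg _) (Finset.mem_univ J)) ht.le

end Laplacian

end KohnNirenberg

end

theorem proposition2p1 (n q : ℕ) (hq : 1 ≤ q) (hqn : q + 1 ≤ n) (Ω : Set (Fin n → ℂ))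
    (hopen : IsOpen Ω) (hconn : IsConnected Ω) (hbdd : Bornology.IsBounded Ω) :
    (∀ t : ℝ, 0 < t → ∀ k : ℕ, 1 ≤ k →
      (dbarNeumannForm Ω q).varEigenvalue k ≤ (kohnNirenbergForm Ω t q).varEigenvalue k ∧
      ENNReal.ofReal t * (neumannForm Ω).varEigenvalue k
        ≤ (kohnNirenbergForm Ω t q).varEigenvalue (k * n.choose q) ∧
      (kohnNirenbergForm Ω t q).varEigenvalue (k * n.choose q)
        ≤ ENNReal.ofReal (1 / 4 + t) * (dirichletForm Ω).varEigenvalue k) ∧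
    (HasC1Boundary Ω →
      ∃ C : ℝ, 0 < C ∧ ∀ t : ℝ, 0 < t →
        HasPurelyDiscreteSpectrum (kohnNirenbergLaplacian Ω t q) ∧
        (∃ μ : ℝ, IsLeast {ν : ℝ | IsEigenvalue (kohnNirenbergLaplacian Ω t q) (ν : ℂ)} μ ∧
          (kohnNirenbergForm Ω t q).varEigenvalue 1 = ENNReal.ofReal μ ∧
          C * min t 1 ≤ μ) ∧
        ∃ N : L2Form Ω q →L[ℂ] L2Form Ω q,
          IsBoundedInverse (kohnNirenbergLaplacian Ω t q) 0 N ∧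
          IsCompactOperator N ∧
          ∀ u : L2Form Ω q, ‖N u‖ ≤ 1 / (C * min t 1) * ‖u‖) := by
  obtain ⟨p, rfl⟩ := Nat.exists_eq_add_of_le' hq
  refine ⟨fun t ht k hk => ⟨varEigenvalue_dbarNeumann_le ht _ _,
    mul_varEigenvalue_neumann_le ht hk (by omega), varEigenvalue_le_mul_dirichlet hopen ht hk⟩,
    fun hC => ?_⟩
  obtain ⟨C, hC0, hcoer⟩ := exists_coercive hopen hbdd p
  refine ⟨C, hC0, fun t ht => ?_⟩
  have hc : 0 < C * min t 1 := mul_pos hC0 (lt_min ht one_pos)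
  -- A lowest eigenvalue exists only on a nonzero space; here `Ω` is nonempty and a multi-index of
  -- length `p + 1` exists.
  have := nontrivial_L2Form hopen hconn.nonempty hbdd (show p + 1 ≤ n by omega)
  have hcoer' : ∀ u : (kohnNirenbergForm Ω t (p + 1)).domain,
      C * min t 1 * ‖(u : L2Form Ω (p + 1))‖ ^ 2 ≤ ‖energyMap Ω t p u‖ ^ 2 := fun u => by
    rw [← gramForm_self_re, ← kohnNirenbergForm_eq_gramForm ht]
    exact hcoer t ht u
  exact compactForm_spectrum _ (energyMap Ω t p) (kohnNirenbergForm_eq_gramForm ht p)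
    (dense_kohnNirenbergForm_domain hopen t p) (isClosed_energyMap hopen ht p) hc hcoer'
    (exists_isCompact_energyMap hopen hbdd hC ht hc p hcoer')
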